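/- **Conventions.** A tracial von Neumann algebra $(\mathcal M,\tau)$ is a von Neumann algebra with a normal faithful tracial state, $\mathcal U(\mathcal M)$ is its unitary group, and $\|x\|_2=\tau(x^*x)^{1/2}$. Let $\mathcal C$ be a class of tracial von Neumann algebras. Let $G$ be a countable group and $\mu$ a probability measure on $G$ whose support generates $G$. A map $\varphi:G\to\mathcal U(\mathcal M)$ is an $(\varepsilon,\mu)$-almost homomorphism if $\iint\|\varphi(gh)-\varphi(g)\varphi(h)\|_2^2\,d\mu(g)d\mu(h)\le\varepsilon$. The pair $(G,\mu)$ is $\mathcal C$-stable if there is a non-decreasing function $\delta:[0,4]\to[0,4]$ with $\lim_{t\to0}\delta(t)=0$ such that for every $(\mathcal M,\tau)\in\mathcal C$, every $\varepsilon\in[0,4]$ and every $(\varepsilon,\mu)$-almost homomorphism $\varphi:G\to\mathcal U(\mathcal M)$ there is a group homomorphism $\pi:G\to\mathcal U(\mathcal M)$ with $\int\|\varphi(g)-\pi(g)\|_2^2\,d\mu(g)\le\delta(\varepsilon)$. Such a $\delta$ is called a modulus of $\mathcal C$-stability of $(G,\mu)$ if moreover it is concave and $\delta(4)=4$. The spectral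 gap constant $\kappa(\mu)\in[0,\infty]$ is the infimum of the real numbers $k>0$ such that for every unitary representation $\pi$ of $G$ the spectrum of $\sum_g\nu(g)\pi(g)$ is contained in $[-1,1-\frac1k]\cup\{1\}$, where $\nu(g)=\frac12(\mu(g)+\mu(g^{-1}))$; it is $\infty$ if there is no such $k$. A countable group $G$ is Hilbert–Schmidt stable if for all integers $d_n\ge1$ and maps $\varphi_n:G\to\mathcal U(d_n)$ with $\lim_n\|\varphi_n(gh)-\varphi_n(g)\varphi_n(h)\|_2=0$ for all $g,h\in G$ there are homomorphisms $\pi_n:G\to\mathcal U(d_n)$ with $\lim_n\|\varphi_n(g)-\pi_n(g)\|_2=0$ for all $g\in G$. Here $\|a\|_2=(\frac1{d}\mathrm{Tr}(a^*a))^{1/2}$ on $M_d(\mathbf C)$. **Theorem.** (1) There is a universal constant $C>0$ such that the following holds. Let $\mathcal C$ be a class of tracial von Neumann algebras that is closed under passing to von Neumann subalgebras (with the same unit and the restricted trace). Let $G_1,G_2$ be countable groups with probability measures $\mu_1,\mu_2$ whose supports generate $G_1$ and $G_2$ respectively, and assume $\kappa(\mu_1)<\infty$. Let $\mu$ be the probability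 measure on $G_1\times G_2$ given by $$\mu(x,y)=\tfrac12\big(\mu_1(x)1_{y=1}+\mu_2(y)1_{x=1}\big).$$ Then the support of $\mu$ generates $G_1\times G_2$, and if $(G_1,\mu_1)$ and $(G_2,\mu_2)$ are $\mathcal C$-stable, then so is $(G_1\times G_2,\mu)$. If moreover $G_1$ is not the trivial group and $\delta_1,\delta_2$ are moduli of $\mathcal C$-stability of $(G_1,\mu_1)$ and $(G_2,\mu_2)$, then $(G_1\times G_2,\mu)$ has a modulus of $\mathcal C$-stability $\delta$ with $$\delta(\varepsilon)\le C\,\delta_2\big(\min(4,\kappa(\mu_1)\,\delta_1(\varepsilon))\big)\qquad\text{for all }\varepsilon\in[0,4].$$ (2) Let $G$ and $H$ be countable groups, at least one of which has Kazhdan's property (T). If $G$ and $H$ are Hilbert–Schmidt stable, then $G\times H$ is Hilbert–Schmidt stable. -/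

import Mathlib

open Set Filter Topology
open scoped ENNReal InnerProductSpace ComplexOrder

universe u₁ u₂ u v

noncomputable section

/-! ### Tracial von Neumann algebras -/

section Ultraweak

variable (H : Type v) [NormedAddCommGroup H] [InnerProductSpace ℂ H] [CompleteSpace H]

/-- The ultraweak (σ-weak, weak-*) topology on `B(H)`: the coarsest topology for which all the
functionals `x ↦ ∑ₙ ⟪ξₙ, x ηₙ⟫`, with `ξ` and `η` square-summable sequences of vectors, are
continuous. -/
@[reducible]
def ultraweakTopology : TopologicalSpace (H →L[ℂ] H) :=
  ⨅ (ξ : lp (fun _ : ℕ => H) 2) (η : lp (fun _ : ℕ => H) 2),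
    TopologicalSpace.induced (fun x : H →L[ℂ] H => ∑' n, ⟪ξ n, x (η n)⟫_ℂ) inferInstance

end Ultraweak

section TracialState

variable {H : Type v} [NormedAddCommGroup H] [InnerProductSpace ℂ H] [CompleteSpace H]

/-- `τ` is a normal faithful tracial state on the von Neumann algebra `M`. -/
structure IsNormalFaithfulTracialState (M : VonNeumannAlgebra H)
    (τ : M.toStarSubalgebra →ₗ[ℂ] ℂ) : Prop where
  nonneg : ∀ x, 0 ≤ τ (star x * x)
  map_one : τ 1 = 1
  faithful : ∀ x, τ (star x * x) = 0 → x = 0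
  tracial : ∀ x y, τ (x * y) = τ (y * x)
  normal : @Continuous M.toStarSubalgebra ℂ
    (TopologicalSpace.induced Subtype.val (ultraweakTopology H)) inferInstance τ

/-- Restriction of a linear form to a von Neumann subalgebra. -/
def restrictForm {M N : VonNeumannAlgebra H} (h : N ≤ M) (τ : M.toStarSubalgebra →ₗ[ℂ] ℂ) :
    N.toStarSubalgebra →ₗ[ℂ] ℂ where
  toFun x := τ ⟨x.1, h x.2⟩
  map_add' x y := τ.map_add ⟨x.1, h x.2⟩ ⟨y.1, h y.2⟩
  map_smul' c x := τ.map_smul c ⟨x.1, h x.2⟩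

theorem IsNormalFaithfulTracialState.restrict {M N : VonNeumannAlgebra H} (h : N ≤ M)
    {τ : M.toStarSubalgebra →ₗ[ℂ] ℂ} (hτ : IsNormalFaithfulTracialState M τ) :
    IsNormalFaithfulTracialState N (restrictForm h τ) where
  nonneg x := hτ.nonneg ⟨x.1, h x.2⟩
  map_one := hτ.map_one
  faithful x hx := by
    have h0 : (⟨x.1, h x.2⟩ : M.toStarSubalgebra) = 0 := hτ.faithful ⟨x.1, h x.2⟩ hx
    exact Subtype.ext (congrArg (fun z : M.toStarSubalgebra => z.1) h0)
  tracial x y := hτ.tracial ⟨x.1, h x.2⟩ ⟨y.1, h y.2⟩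
  normal := by
    let _ : TopologicalSpace (H →L[ℂ] H) := ultraweakTopology H
    have h1 : Continuous (fun x : N.toStarSubalgebra =>
        (⟨x.1, h x.2⟩ : M.toStarSubalgebra)) :=
      Continuous.subtype_mk continuous_subtype_val _
    exact Continuous.comp (g := τ) hτ.normal h1

end TracialState

/-- A von Neumann algebra on a complex Hilbert space, with a normal faithful tracial state. -/
structure TracialVNA : Type (v + 1) where
  H : Type v
  [normedAddCommGroup : NormedAddCommGroup H]
  [innerProductSpace : InnerProductSpace ℂ H]
  [completeSpace : CompleteSpace H]
  M : VonNeumannAlgebra H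
  τ : M.toStarSubalgebra →ₗ[ℂ] ℂ
  isState : IsNormalFaithfulTracialState M τ

attribute [instance] TracialVNA.normedAddCommGroup TracialVNA.innerProductSpace
  TracialVNA.completeSpace

namespace TracialVNA

/-- The elements of the von Neumann algebra. -/
abbrev Elem (A : TracialVNA.{v}) : Type v := A.M.toStarSubalgebra

/-- The unitary group of the von Neumann algebra. -/
abbrev U (A : TracialVNA.{v}) : Submonoid A.Elem := unitary A.Elem

/-- `‖x‖₂² = τ(x* x)`. -/
def normSq (A : TracialVNA.{v}) (x : A.Elem) : ℝ := (A.τ (star x * x)).re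

/-- A (unital) von Neumann subalgebra, with the restricted trace. -/
def restrict (A : TracialVNA.{v}) (N : VonNeumannAlgebra A.H) (h : N ≤ A.M) : TracialVNA.{v} where
  H := A.H
  M := N
  τ := restrictForm h A.τ
  isState := A.isState.restrict h

end TracialVNA

/-- The class `𝒞` is closed under passing to von Neumann subalgebras. -/
def ClosedUnderSubalgebras (𝒞 : Set TracialVNA.{v}) : Prop :=
  ∀ A ∈ 𝒞, ∀ (N : VonNeumannAlgebra A.H) (h : N ≤ A.M), A.restrict N h ∈ 𝒞

/-! ### Stability of a group with a probability measure -/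

/-- The support of `μ` generates the group. -/
def HasGeneratingSupport {G : Type u} [Group G] (μ : PMF G) : Prop :=
  Subgroup.closure μ.support = ⊤

/-- `φ` is an `(ε, μ)`-almost homomorphism:
`∬ ‖φ(gh) - φ(g) φ(h)‖₂² dμ(g) dμ(h) ≤ ε`. -/
def IsAlmostHom {G : Type u} [Group G] (A : TracialVNA.{v}) (ε : ℝ) (μ : PMF G)
    (φ : G → A.U) : Prop :=
  ∑' g, ∑' h, (μ g).toReal * (μ h).toReal *
    A.normSq ((φ (g * h) : A.Elem) - (φ g : A.Elem) * (φ h : A.Elem)) ≤ ε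

/-- `∫ ‖φ(g) - ψ(g)‖₂² dμ(g)`. -/
def distSq {G : Type u} (A : TracialVNA.{v}) (μ : PMF G) (φ ψ : G → A.U) : ℝ :=
  ∑' g, (μ g).toReal * A.normSq ((φ g : A.Elem) - (ψ g : A.Elem))

/-- `δ : [0,4] → [0,4]` is non-decreasing, tends to `0` at `0`, and every `(ε, μ)`-almost
homomorphism into the unitary group of a member of `𝒞` is `δ(ε)`-close to a homomorphism.
Only the values of `δ` on `[0,4]` matter. -/
structure IsStabilityFunction {G : Type u} [Group G] (𝒞 : Set TracialVNA.{v}) (μ : PMF G)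
    (δ : ℝ → ℝ) : Prop where
  mapsTo : MapsTo δ (Icc 0 4) (Icc 0 4)
  monotoneOn : MonotoneOn δ (Icc 0 4)
  tendsto : Tendsto δ (𝓝[>] 0) (𝓝 0)
  close : ∀ A ∈ 𝒞, ∀ ε ∈ Icc (0 : ℝ) 4, ∀ φ : G → A.U, IsAlmostHom A ε μ φ →
    ∃ π : G →* A.U, distSq A μ φ π ≤ δ ε

/-- `(G, μ)` is `𝒞`-stable. -/
def IsStable {G : Type u} [Group G] (𝒞 : Set TracialVNA.{v}) (μ : PMF G) : Prop :=
  ∃ δ : ℝ → ℝ, IsStabilityFunction 𝒞 μ δ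

/-- `δ` is a modulus of `𝒞`-stability of `(G, μ)`. -/
structure IsStabilityModulus {G : Type u} [Group G] (𝒞 : Set TracialVNA.{v}) (μ : PMF G)
    (δ : ℝ → ℝ) : Prop extends IsStabilityFunction 𝒞 μ δ where
  concaveOn : ConcaveOn ℝ (Icc 0 4) δ
  map_four : δ 4 = 4

open Classical in
/-- The averaged probability measure on `G₁ × G₂`,
`μ(x, y) = (μ₁(x) 1_{y = 1} + μ₂(y) 1_{x = 1}) / 2`. -/
def averagedMeasure {G₁ : Type u₁} {G₂ : Type u₂} [Group G₁] [Group G₂]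
    (μ₁ : PMF G₁) (μ₂ : PMF G₂) : PMF (G₁ × G₂) :=
  ⟨fun p => 2⁻¹ * ((if p.2 = 1 then μ₁ p.1 else 0) + (if p.1 = 1 then μ₂ p.2 else 0)), by
    have h1 : ∑' p : G₁ × G₂, (if p.2 = 1 then μ₁ p.1 else 0) = 1 := by
      rw [ENNReal.tsum_prod']
      simp [tsum_ite_eq, μ₁.tsum_coe]
    have h2 : ∑' p : G₁ × G₂, (if p.1 = 1 then μ₂ p.2 else 0) = 1 := by
      rw [ENNReal.tsum_prod', ENNReal.tsum_comm]
      simp [tsum_ite_eq, μ₂.tsum_coe]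
    have h3 := ENNReal.summable.hasSum (f := fun p : G₁ × G₂ =>
      (2⁻¹ : ℝ≥0∞) * ((if p.2 = 1 then μ₁ p.1 else 0) + (if p.1 = 1 then μ₂ p.2 else 0)))
    rw [ENNReal.tsum_mul_left, ENNReal.tsum_add, h1, h2, one_add_one_eq_two,
      ENNReal.inv_mul_cancel two_ne_zero ENNReal.ofNat_ne_top] at h3
    exact h3⟩

/-! ### Spectral gap and property (T) -/

section Representations

variable {G : Type u} [Group G] {K : Type v} [NormedAddCommGroup K] [InnerProductSpace ℂ K]
  [CompleteSpace K]

/-- The operator `π(ν) = ∑_g ν(g) π(g)`, where `ν(g) = (μ(g) + μ(g⁻¹)) / 2` is the symmetrization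
of `μ` (so `ν = μ` if `μ` is symmetric). -/
def averagingOperator (μ : PMF G) (π : G →* unitary (K →L[ℂ] K)) : K →L[ℂ] K :=
  ∑' g, (((μ g).toReal + (μ g⁻¹).toReal) / 2 : ℝ) • (π g : K →L[ℂ] K)

end Representations

/-- For every unitary representation `π`, the spectrum of `π(ν)`, with `ν` the symmetrization of
`μ`, is contained in `[-1, 1 - 1/k] ∪ {1}`. -/
def IsSpectralGapBound {G : Type u} [Group G] (μ : PMF G) (k : ℝ) : Prop :=
  ∀ (K : Type v) [NormedAddCommGroup K] [InnerProductSpace ℂ K] [CompleteSpace K]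
    (π : G →* unitary (K →L[ℂ] K)),
    spectrum ℂ (averagingOperator μ π) ⊆ (fun t : ℝ => (t : ℂ)) '' (Icc (-1) (1 - 1 / k) ∪ {1})

/-- The spectral gap constant `κ(μ) ∈ [0, ∞]` (the inverse of the spectral gap). It is `∞` if `μ`
has no spectral gap. -/
def kappa {G : Type u} [Group G] (μ : PMF G) : ℝ≥0∞ :=
  ⨅ (k : ℝ) (_ : 0 < k) (_ : IsSpectralGapBound.{u, v} μ k), ENNReal.ofReal k

/-- Kazhdan's property (T) for a discrete group: there are a finite subset `Q` and `ε > 0` such that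
every unitary representation with a `(Q, ε)`-invariant unit vector has a nonzero invariant
vector. -/
def HasPropertyT (G : Type u) [Group G] : Prop :=
  ∃ (Q : Finset G) (ε : ℝ), 0 < ε ∧
    ∀ (K : Type v) [NormedAddCommGroup K] [InnerProductSpace ℂ K] [CompleteSpace K]
      (π : G →* unitary (K →L[ℂ] K)),
      (∃ ξ : K, ‖ξ‖ = 1 ∧ ∀ g ∈ Q, ‖(π g : K →L[ℂ] K) ξ - ξ‖ < ε) →
        ∃ ξ : K, ξ ≠ 0 ∧ ∀ g, (π g : K →L[ℂ] K) ξ = ξ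

/-! ### Hilbert–Schmidt stability -/

/-- The normalized Hilbert–Schmidt norm `‖a‖₂ = (tr(a* a) / n)^{1/2}` of an `n × n` matrix. -/
def hsNorm {n : ℕ} (a : Matrix (Fin n) (Fin n) ℂ) : ℝ :=
  √((a.conjTranspose * a).trace.re / n)

/-- `G` is Hilbert–Schmidt stable: every asymptotic homomorphism (for the normalized
Hilbert–Schmidt norm) to finite-dimensional unitary groups is asymptotically close to a sequence of
homomorphisms. -/
def IsHilbertSchmidtStable (G : Type u) [Group G] : Prop :=
  ∀ (d : ℕ → ℕ), (∀ n, 0 < d n) →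
    ∀ φ : ∀ n, G → Matrix.unitaryGroup (Fin (d n)) ℂ,
      (∀ g h, Tendsto (fun n => hsNorm ((φ n (g * h)).1 - (φ n g).1 * (φ n h).1)) atTop (𝓝 0)) →
      ∃ π : ∀ n, G →* Matrix.unitaryGroup (Fin (d n)) ℂ,
        ∀ g, Tendsto (fun n => hsNorm ((φ n g).1 - (π n g).1)) atTop (𝓝 0)

end

/-! Part (1). Let φ be an almost homomorphism on G₁ × G₂. Stability of G₁ replaces φ(·, 1) by a
homomorphism π₁. On average over μ₁, the unitaries φ(1, h) almost commute with π₁, so they are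
almost invariant vectors of the conjugation representation of G₁ on L²(A, τ). The spectral gap of μ₁
(`spectralGap_inequality`) puts them close to the invariant vectors, and
`exists_unitary_mem_relCommutant` rounds them to unitaries ψ(h) of the relative commutant N of π₁.
Since N belongs to 𝒞, stability of G₂ applied to ψ inside N yields a homomorphism that commutes
exactly with π₁, and the product of the two is close to φ (`exists_hom_of_isAlmostHom_prod`).

The rounding avoids polar decomposition. The image of the unit ball of A in L²(A, τ) is closed,
convex and invariant, so the projection of a unitary x onto the invariant vectors comes from the
unit ball of N. The maximum of Re τ(x* a) over this weakly compact ball is attained at an extreme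
point, and extreme points of the ball of a finite von Neumann algebra are unitary.

For the explicit modulus, concavity moves constants outside δ₁ and δ₂, and κ(μ₁) ≥ 1/2 for a
nontrivial group absorbs the terms that do not carry κ.

Part (2) follows the same scheme along sequences, with property (T) in place of the gap. The
commutant of π₁ in a matrix algebra is only a finite-dimensional algebra, so stability has to pass
from matrices to such algebras. A compactness argument makes it quantitative with constants
independent of the matrix size (`exists_matrixStability`), the estimates are added over matrix
blocks (`exists_partial`), and a diagonal choice returns to sequences. -/

noncomputable section

set_option linter.unusedSectionVars false

/-! ### Unitary representations and invariant vectors -/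

section Invariants

variable {G : Type*} [Group G] {K : Type*} [NormedAddCommGroup K] [InnerProductSpace ℂ K]
  [CompleteSpace K]

/-- A homomorphism to bounded operators with isometric values is a unitary representation. -/
def unitaryRep (ρ : G →* (K →L[ℂ] K)) (h : ∀ g ξ, ‖ρ g ξ‖ = ‖ξ‖) :
    G →* unitary (K →L[ℂ] K) where
  toFun g := ⟨ρ g, by
    have h1 : star (ρ g) * ρ g = 1 :=
      (ContinuousLinearMap.norm_map_iff_adjoint_comp_self (ρ g)).1 (h g)
    have h2 : ρ g * ρ g⁻¹ = 1 := by rw [← map_mul, mul_inv_cancel, map_one]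
    have h3 : star (ρ g) = ρ g⁻¹ := left_inv_eq_right_inv h1 h2
    exact Unitary.mem_iff.2 ⟨h1, by rw [h3, h2]⟩⟩
  map_one' := Subtype.ext (map_one ρ)
  map_mul' g g' := Subtype.ext (map_mul ρ g g')

/-- The subspace of invariant vectors of a unitary representation. -/
def invariantVectors (π : G →* unitary (K →L[ℂ] K)) : Submodule ℂ K where
  carrier := {ξ | ∀ g, (π g : K →L[ℂ] K) ξ = ξ}
  add_mem' ha hb g := by simp [ha g, hb g]
  zero_mem' g := by simp
  smul_mem' c ξ h g := by simp [h g]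

theorem mem_invariantVectors {π : G →* unitary (K →L[ℂ] K)} {ξ : K} :
    ξ ∈ invariantVectors π ↔ ∀ g, (π g : K →L[ℂ] K) ξ = ξ := Iff.rfl

theorem isClosed_invariantVectors (π : G →* unitary (K →L[ℂ] K)) :
    IsClosed (invariantVectors π : Set K) := by
  have : (invariantVectors π : Set K) = ⋂ g, {ξ | (π g : K →L[ℂ] K) ξ = ξ} := by
    ext ξ; simp [mem_invariantVectors]
  rw [this]
  exact isClosed_iInter fun g => isClosed_eq (by fun_prop) continuous_id

instance (π : G →* unitary (K →L[ℂ] K)) : (invariantVectors π).HasOrthogonalProjection :=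
  haveI : CompleteSpace (invariantVectors π) := (isClosed_invariantVectors π).completeSpace_coe
  inferInstance

theorem coe_inv_apply_apply (π : G →* unitary (K →L[ℂ] K)) (g : G) (ξ : K) :
    (π g⁻¹ : K →L[ℂ] K) ((π g : K →L[ℂ] K) ξ) = ξ := by
  have : (π g⁻¹ * π g : unitary (K →L[ℂ] K)) = 1 := by rw [← map_mul, inv_mul_cancel, map_one]
  exact congrArg (fun u : unitary (K →L[ℂ] K) => (u : K →L[ℂ] K) ξ) this

theorem mem_invariantVectors_of_closure {π : G →* unitary (K →L[ℂ] K)} {s : Set G}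
    (hs : Subgroup.closure s = ⊤) {ξ : K} (h : ∀ g ∈ s, (π g : K →L[ℂ] K) ξ = ξ) :
    ξ ∈ invariantVectors π := by
  intro g
  have hg : g ∈ Subgroup.closure s := hs ▸ Subgroup.mem_top g
  induction hg using Subgroup.closure_induction with
  | mem x hx => exact h x hx
  | one => simp
  | mul x y _ _ hx hy => simp [hx, hy]
  | inv x _ hx =>
    conv_lhs => rw [← hx]
    exact coe_inv_apply_apply π x ξ

/-- Inner products against invariant vectors do not change under the action, so the difference of
the two vectors is orthogonal to the invariant subspace. -/
theorem starProjection_invariantVectors_apply (π : G →* unitary (K →L[ℂ] K)) (g : G) (ξ : K) :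
    (invariantVectors π).starProjection ((π g : K →L[ℂ] K) ξ) =
      (invariantVectors π).starProjection ξ := by
  refine Submodule.eq_starProjection_of_mem_orthogonal (Submodule.starProjection_apply_mem _ _) ?_
  rw [Submodule.mem_orthogonal]
  intro η hη
  have h1 : ⟪η, (π g : K →L[ℂ] K) ξ⟫_ℂ = ⟪η, ξ⟫_ℂ := by
    conv_lhs => rw [← mem_invariantVectors.1 hη g]
    exact Unitary.inner_map_map (π g) η ξ
  rw [inner_sub_right, h1, ← inner_sub_right]
  exact (Submodule.mem_orthogonal _ _).1
    (Submodule.sub_starProjection_mem_orthogonal (K := invariantVectors π) ξ) η hη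

/-- A closed convex invariant set is stable under the projection onto the invariant vectors. -/
theorem starProjection_invariantVectors_mem (π : G →* unitary (K →L[ℂ] K)) {B : Set K}
    (hB : IsClosed B) (hconv : Convex ℝ B) (hinv : ∀ g, ∀ ξ ∈ B, (π g : K →L[ℂ] K) ξ ∈ B)
    {ξ : K} (hξ : ξ ∈ B) : (invariantVectors π).starProjection ξ ∈ B := by
  let _ : InnerProductSpace ℝ K := InnerProductSpace.complexToReal
  set P := (invariantVectors π).starProjection with hP
  -- The vector of least norm in C is unique and the action preserves C and the norm, so it is
  -- fixed. It is then its own projection, hence equal to P ξ, and it lies in B.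
  let C : Set K := B ∩ {η | P η = P ξ}
  have hC : IsClosed C := hB.inter (isClosed_eq P.continuous continuous_const)
  have hCc : Convex ℝ C := by
    refine hconv.inter ?_
    intro a ha b hb s t _ _ hst
    simp only [mem_ofPred_eq] at ha hb ⊢
    rw [map_add, P.map_smul_of_tower, P.map_smul_of_tower, ha, hb, ← add_smul, hst, one_smul]
  obtain ⟨c, hcC, hc⟩ := exists_norm_eq_iInf_of_complete_convex (K := C)
    ⟨ξ, hξ, rfl⟩ hC.isComplete hCc 0
  have hmin : ∀ w ∈ C, ‖c‖ ≤ ‖w‖ := by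
    intro w hw
    simp only [zero_sub, norm_neg] at hc
    rw [hc]
    exact ciInf_le (f := fun w : C => ‖(w : K)‖)
      ⟨0, by rintro _ ⟨w, rfl⟩; exact norm_nonneg _⟩ ⟨w, hw⟩
  have hfix : c ∈ invariantVectors π := by
    intro g
    set d := (π g : K →L[ℂ] K) c with hd
    have hdC : d ∈ C := ⟨hinv g c hcC.1, by
      rw [mem_ofPred_eq, hd, hP, starProjection_invariantVectors_apply]; exact hcC.2⟩
    have hdn : ‖d‖ = ‖c‖ := Unitary.norm_map (π g) c
    have hm := hmin _ (hCc hcC hdC (by norm_num : (0 : ℝ) ≤ 1 / 2)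
      (by norm_num : (0 : ℝ) ≤ 1 / 2) (by norm_num))
    rw [← smul_add, norm_smul] at hm
    have hpar := parallelogram_law_with_norm ℝ c d
    have h0 : ‖c - d‖ * ‖c - d‖ ≤ 0 := by
      norm_num at hm
      nlinarith [norm_nonneg (c + d), norm_nonneg c]
    have : ‖c - d‖ = 0 := by nlinarith [norm_nonneg (c - d)]
    exact (sub_eq_zero.1 (norm_eq_zero.1 this)).symm
  have : P ξ = c := by
    rw [← hcC.2]; exact Submodule.starProjection_eq_self_iff.2 hfix
  rw [this]; exact hcC.1

end Invariants

/-! ### Spectral gap -/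

section SpectralGap

variable {G : Type u}

theorem PMF.summable_toReal (μ : PMF G) : Summable fun g => (μ g).toReal :=
  ENNReal.summable_toReal (by simp [μ.tsum_coe])

theorem PMF.tsum_toReal (μ : PMF G) : ∑' g, (μ g).toReal = 1 := by
  rw [← ENNReal.tsum_toReal_eq (fun a => μ.apply_ne_top a), μ.tsum_coe, ENNReal.toReal_one]

/-- A bounded function is integrable. -/
theorem PMF.summable_mul_of_le (μ : PMF G) {f : G → ℝ} {C : ℝ} (h0 : ∀ g, 0 ≤ f g)
    (hC : ∀ g, f g ≤ C) : Summable fun g => (μ g).toReal * f g :=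
  Summable.of_nonneg_of_le (fun g => mul_nonneg ENNReal.toReal_nonneg (h0 g))
    (fun g => mul_le_mul_of_nonneg_left (hC g) ENNReal.toReal_nonneg)
    (μ.summable_toReal.mul_right C)

variable [Group G]

theorem PMF.summable_toReal_inv (μ : PMF G) : Summable fun g => (μ g⁻¹).toReal :=
  (Equiv.inv G).summable_iff (f := fun g => (μ g).toReal) |>.2 μ.summable_toReal

variable {K : Type v} [NormedAddCommGroup K] [InnerProductSpace ℂ K] [CompleteSpace K]

theorem unitary_opNorm_le (u : unitary (K →L[ℂ] K)) : ‖(u : K →L[ℂ] K)‖ ≤ 1 :=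
  ContinuousLinearMap.opNorm_le_bound _ zero_le_one fun x => by rw [Unitary.norm_map, one_mul]

theorem summable_averagingOperator (μ : PMF G) (π : G →* unitary (K →L[ℂ] K)) :
    Summable fun g => (((μ g).toReal + (μ g⁻¹).toReal) / 2 : ℝ) • (π g : K →L[ℂ] K) := by
  refine Summable.of_norm_bounded (g := fun g => ((μ g).toReal + (μ g⁻¹).toReal) / 2)
    ((μ.summable_toReal.add μ.summable_toReal_inv).div_const 2) fun g => ?_
  have h0 : 0 ≤ ((μ g).toReal + (μ g⁻¹).toReal) / 2 := by positivity
  rw [norm_smul, Real.norm_of_nonneg h0]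
  exact mul_le_of_le_one_right h0 (unitary_opNorm_le _)

/-- Inversion permutes the terms: the weights are symmetric and the adjoint of π(g) is π(g⁻¹). -/
theorem isSelfAdjoint_averagingOperator (μ : PMF G) (π : G →* unitary (K →L[ℂ] K)) :
    IsSelfAdjoint (averagingOperator μ π) := by
  rw [IsSelfAdjoint, averagingOperator, tsum_star, ← (Equiv.inv G).tsum_eq]
  refine tsum_congr fun g => ?_
  rw [star_smul, star_trivial, Equiv.inv_apply, inv_inv, add_comm, map_inv π]
  congr 1
  rw [← Unitary.star_eq_inv, Unitary.coe_star, star_star]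

theorem summable_mul_norm_sub_sq (μ : PMF G) (π : G →* unitary (K →L[ℂ] K)) (ξ : K) :
    Summable fun g => (μ g).toReal * ‖(π g : K →L[ℂ] K) ξ - ξ‖ ^ 2 :=
  μ.summable_mul_of_le (C := (‖ξ‖ + ‖ξ‖) ^ 2) (fun g => by positivity) fun g => by
    gcongr
    exact (norm_sub_le _ _).trans_eq (by rw [Unitary.norm_map])

theorem norm_inv_apply_sub (π : G →* unitary (K →L[ℂ] K)) (ξ : K) (g : G) :
    ‖(π g⁻¹ : K →L[ℂ] K) ξ - ξ‖ = ‖(π g : K →L[ℂ] K) ξ - ξ‖ := by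
  rw [← Unitary.norm_map (π g⁻¹) ((π g : K →L[ℂ] K) ξ - ξ), map_sub, coe_inv_apply_apply,
    norm_sub_rev]

theorem norm_apply_sub_sq (u : unitary (K →L[ℂ] K)) (ξ : K) :
    ‖(u : K →L[ℂ] K) ξ - ξ‖ ^ 2 = 2 * (‖ξ‖ ^ 2 - (⟪ξ, (u : K →L[ℂ] K) ξ⟫_ℂ).re) := by
  rw [norm_sub_sq (𝕜 := ℂ), Unitary.norm_map, inner_re_symm]
  simp only [RCLike.re_to_complex]
  ring

/-- The Dirichlet form identity for 1 - π(ν). The displacement of ξ is the same for g and g⁻¹, so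
the symmetrized weights may be replaced by μ on the right. -/
theorem inner_averagingOperator (μ : PMF G) (π : G →* unitary (K →L[ℂ] K)) (ξ : K) :
    ‖ξ‖ ^ 2 - (⟪ξ, averagingOperator μ π ξ⟫_ℂ).re =
      2⁻¹ * ∑' g, (μ g).toReal * ‖(π g : K →L[ℂ] K) ξ - ξ‖ ^ 2 := by
  set ν : G → ℝ := fun g => ((μ g).toReal + (μ g⁻¹).toReal) / 2 with hν
  set F : G → ℝ := fun g => ‖(π g : K →L[ℂ] K) ξ - ξ‖ ^ 2 with hF
  let L : (K →L[ℂ] K) →L[ℝ] ℝ := (Complex.reCLM.comp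
    ((innerSL ℂ ξ).restrictScalars ℝ)).comp
      (((ContinuousLinearMap.apply ℂ K ξ)).restrictScalars ℝ)
  have hL : ∀ A, L A = (⟪ξ, A ξ⟫_ℂ).re := fun A => rfl
  have hT := L.hasSum (summable_averagingOperator μ π).hasSum
  have hs : HasSum (fun g => (μ g).toReal) 1 := μ.tsum_toReal ▸ μ.summable_toReal.hasSum
  have hsi : HasSum (fun g => (μ g⁻¹).toReal) 1 :=
    (Equiv.inv G).hasSum_iff (f := fun g => (μ g).toReal) |>.2 hs
  have hν1 : HasSum ν 1 := by simpa [hν] using (hs.add hsi).div_const 2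
  have h3 : HasSum (fun g => ν g * ‖ξ‖ ^ 2 - L (ν g • (π g : K →L[ℂ] K)))
      (1 * ‖ξ‖ ^ 2 - L (averagingOperator μ π)) := (hν1.mul_right _).sub hT
  have h4 : HasSum (fun g => (μ g).toReal * F g) (∑' g, (μ g).toReal * F g) :=
    (summable_mul_norm_sub_sq μ π ξ).hasSum
  have h5 : HasSum (fun g => (μ g⁻¹).toReal * F g) (∑' g, (μ g).toReal * F g) := by
    have := (Equiv.inv G).hasSum_iff (f := fun g => (μ g).toReal * F g) |>.2 h4
    refine this.congr_fun fun g => ?_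
    simp only [hF, Function.comp_apply, Equiv.inv_apply, norm_inv_apply_sub]
  have h6 := (h4.add h5).mul_left (4⁻¹ : ℝ)
  have h7 : (fun g => ν g * ‖ξ‖ ^ 2 - L (ν g • (π g : K →L[ℂ] K))) =
      fun g => 4⁻¹ * ((μ g).toReal * F g + (μ g⁻¹).toReal * F g) := by
    funext g
    rw [map_smul, hL, smul_eq_mul, hF]
    simp only [norm_apply_sub_sq, hν]
    ring
  rw [h7] at h3
  have := h3.unique h6
  rw [hL, one_mul] at this
  rw [this]; ring

/-- The Dirichlet form vanishes at ξ, so every g of positive mass fixes ξ, and these elements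
generate G. -/
theorem averagingOperator_eq_self {μ : PMF G} (hμ : HasGeneratingSupport μ)
    (π : G →* unitary (K →L[ℂ] K)) {ξ : K} (h : averagingOperator μ π ξ = ξ) :
    ξ ∈ invariantVectors π := by
  refine mem_invariantVectors_of_closure hμ fun g hg => ?_
  have h1 := inner_averagingOperator μ π ξ
  have h2 : (⟪ξ, ξ⟫_ℂ).re = ‖ξ‖ ^ 2 := inner_self_eq_norm_sq (𝕜 := ℂ) ξ
  rw [h, h2, sub_self] at h1
  have h3 : ∑' g, (μ g).toReal * ‖(π g : K →L[ℂ] K) ξ - ξ‖ ^ 2 = 0 := by linarith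
  have h4 := (hasSum_zero_iff_of_nonneg (fun g => by positivity)).1
    (h3 ▸ (summable_mul_norm_sub_sq μ π ξ).hasSum)
  have h5 := congrFun h4 g
  have h6 : (μ g).toReal ≠ 0 := ENNReal.toReal_ne_zero.2 ⟨(μ.mem_support_iff g).1 hg,
    μ.apply_ne_top g⟩
  simpa [h6, sub_eq_zero] using h5

/-- The spectral projection E of T at 1 maps into the invariant vectors and satisfies 1 - E ≤ k (1 -
T). Evaluating at ξ bounds the distance to the invariant vectors by the Dirichlet form. -/
theorem spectralGap_inequality_aux {μ : PMF G} (hμ : HasGeneratingSupport μ) {k : ℝ} (hk : 0 < k)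
    (hgap : IsSpectralGapBound.{u, v} μ k) (π : G →* unitary (K →L[ℂ] K)) (ξ : K) :
    ‖ξ - (invariantVectors π).starProjection ξ‖ ^ 2 ≤
      k / 2 * ∑' g, (μ g).toReal * ‖(π g : K →L[ℂ] K) ξ - ξ‖ ^ 2 := by
  set T := averagingOperator μ π with hT
  have hTs : IsSelfAdjoint T := isSelfAdjoint_averagingOperator μ π
  have hspec : ∀ t ∈ spectrum ℝ T, t ≤ 1 - 1 / k ∨ t = 1 := by
    intro t ht
    have h1 : (t : ℂ) ∈ spectrum ℂ T := (spectrum.algebraMap_mem_iff ℂ).2 ht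
    obtain ⟨s, hs, hst⟩ := hgap K π h1
    obtain rfl : s = t := Complex.ofReal_injective hst
    rcases hs with hs | hs
    · exact Or.inl hs.2
    · exact Or.inr hs
  -- On the spectrum this continuous function is the indicator of {1}: it vanishes up to 1 - 1/k and
  -- equals 1 at 1. So the continuous functional calculus already produces the spectral projection.
  -- Moreover 1 - f(t) ≤ k (1 - t) for all t.
  set f : ℝ → ℝ := fun t => max 0 (1 + k * (t - 1)) with hf
  have hfc : Continuous f := by fun_prop
  have hf01 : ∀ t ∈ spectrum ℝ T, (t = 1 ∧ f t = 1) ∨ f t = 0 := by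
    intro t ht
    rcases hspec t ht with h | h
    · right
      refine max_eq_left ?_
      have : k * (t - 1) ≤ k * (-(1 / k)) := by gcongr; linarith
      have h2 : k * (-(1 / k)) = -1 := by field_simp
      linarith
    · left; simp [hf, h]
  set E := cfc f T with hE
  have hEs : IsSelfAdjoint E := cfc_predicate f T
  have hTE : T * E = E := by
    rw [hE]
    nth_rewrite 1 [← cfc_id' ℝ T]
    rw [← cfc_mul (fun x => x) f T]
    refine cfc_congr fun t ht => ?_
    rcases hf01 t ht with h | h <;> simp [h]
  have hEE : E * E = E := by
    rw [hE, ← cfc_mul f f T]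
    refine cfc_congr fun t ht => ?_
    rcases hf01 t ht with ⟨_, h⟩ | h <;> simp [h]
  have hle : (1 : K →L[ℂ] K) - E ≤ k • (1 - T) := by
    have h1 : (1 : K →L[ℂ] K) - E = cfc (fun t => 1 - f t) T := by
      rw [cfc_sub (fun _ => (1 : ℝ)) f T, cfc_const_one ℝ T]
    have h2 : k • (1 - T) = cfc (fun t : ℝ => k • (1 - t)) T := by
      rw [cfc_smul k (fun t : ℝ => 1 - t) T,
        cfc_sub (fun _ => (1 : ℝ)) (fun t => t) T,
        cfc_const_one ℝ T, cfc_id' ℝ T]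
    rw [h1, h2]
    refine cfc_mono fun t _ => ?_
    have := le_max_right 0 (1 + k * (t - 1))
    simp only [smul_eq_mul, hf]
    linarith
  have hinv : E ξ ∈ invariantVectors π := averagingOperator_eq_self hμ π (by
    change (T * E) ξ = E ξ
    rw [hTE])
  have h1 : ‖ξ - (invariantVectors π).starProjection ξ‖ ≤ ‖ξ - E ξ‖ := by
    rw [Submodule.starProjection_minimal]
    exact ciInf_le (f := fun w : invariantVectors π => ‖ξ - w‖)
      ⟨0, by rintro _ ⟨w, rfl⟩; exact norm_nonneg _⟩ ⟨E ξ, hinv⟩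
  have h2 : ‖ξ - E ξ‖ ^ 2 = (⟪ξ, (1 - E) ξ⟫_ℂ).re := by
    have h3 : (1 - E) * (1 - E) = 1 - E := by
      rw [mul_sub, sub_mul, sub_mul, hEE]; simp
    have h4 : star (1 - E) = 1 - E := by rw [star_sub, star_one, hEs.star_eq]
    rw [← h3]
    nth_rewrite 1 [← h4]
    rw [mul_apply_eq_comp, ContinuousLinearMap.star_eq_adjoint,
      ContinuousLinearMap.adjoint_inner_right]
    exact (inner_self_eq_norm_sq (𝕜 := ℂ) _).symm
  have h3 : (⟪ξ, (1 - E) ξ⟫_ℂ).re ≤ (⟪ξ, (k • (1 - T)) ξ⟫_ℂ).re := by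
    have := ((ContinuousLinearMap.le_def _ _).1 hle).re_inner_nonneg_right ξ
    rw [sub_apply, inner_sub_right, map_sub] at this
    exact sub_nonneg.1 this
  have h4 : (⟪ξ, (k • (1 - T)) ξ⟫_ℂ).re =
      k * (2⁻¹ * ∑' g, (μ g).toReal * ‖(π g : K →L[ℂ] K) ξ - ξ‖ ^ 2) := by
    rw [← inner_averagingOperator, ← hT, smul_apply, inner_smul_right_eq_smul,
      Complex.smul_re, smul_eq_mul, sub_apply, inner_sub_right, Complex.sub_re,
      one_apply_eq_self]
    congr 2
    exact inner_self_eq_norm_sq (𝕜 := ℂ) ξ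
  calc _ ≤ ‖ξ - E ξ‖ ^ 2 := by gcongr
    _ ≤ _ := by rw [h2]; linarith

/-- The infimum defining κ(μ) is approached by admissible k, and the inequality passes to the limit.
-/
theorem spectralGap_inequality {μ : PMF G} (hμ : HasGeneratingSupport μ)
    (hκ : kappa.{u, v} μ ≠ ∞) (π : G →* unitary (K →L[ℂ] K)) (ξ : K) :
    ‖ξ - (invariantVectors π).starProjection ξ‖ ^ 2 ≤
      (kappa.{u, v} μ).toReal / 2 * ∑' g, (μ g).toReal * ‖(π g : K →L[ℂ] K) ξ - ξ‖ ^ 2 := by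
  set S := ∑' g, (μ g).toReal * ‖(π g : K →L[ℂ] K) ξ - ξ‖ ^ 2 with hS
  have hS0 : 0 ≤ S := tsum_nonneg fun g => by positivity
  have key : ∀ r, (kappa.{u, v} μ).toReal < r →
      ‖ξ - (invariantVectors π).starProjection ξ‖ ^ 2 ≤ r / 2 * S := by
    intro r hr
    have h1 : kappa.{u, v} μ < ENNReal.ofReal r := (ENNReal.lt_ofReal_iff_toReal_lt hκ).2 hr
    simp only [kappa, iInf_lt_iff] at h1
    obtain ⟨k, hk, hb, hlt⟩ := h1
    have hkr : k < r := (ENNReal.ofReal_lt_ofReal_iff_of_nonneg hk.le).1 hlt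
    exact (spectralGap_inequality_aux hμ hk hb π ξ).trans (by gcongr)
  have hlim : Tendsto (fun r : ℝ => r / 2 * S) (𝓝[>] (kappa.{u, v} μ).toReal)
      (𝓝 ((kappa.{u, v} μ).toReal / 2 * S)) :=
    (Continuous.tendsto (by fun_prop) _).mono_left nhdsWithin_le_nhds
  exact ge_of_tendsto hlim (eventually_mem_nhdsWithin.mono key)

end SpectralGap

/-! ### Weak compactness of the unit ball of a von Neumann algebra -/

section Forms

variable {H : Type v} [NormedAddCommGroup H] [InnerProductSpace ℂ H] [CompleteSpace H]

/-- The sesquilinear form of an operator. The topology of pointwise convergence on forms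
corresponds to the weak operator topology. -/
def opForm (a : H →L[ℂ] H) : H → H → ℂ := fun ξ η => ⟪ξ, a η⟫_ℂ

theorem opForm_injective : Function.Injective (opForm : (H →L[ℂ] H) → H → H → ℂ) := by
  intro a b h
  ext η
  exact ext_inner_left ℂ fun ξ => congrFun (congrFun h ξ) η

theorem exists_opForm_eq {s : H → H → ℂ} (hb : ∀ ξ η, ‖s ξ η‖ ≤ ‖ξ‖ * ‖η‖)
    (h1 : ∀ ξ η η', s ξ (η + η') = s ξ η + s ξ η') (h2 : ∀ (c : ℂ) ξ η, s ξ (c • η) = c * s ξ η)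
    (h3 : ∀ ξ ξ' η, s (ξ + ξ') η = s ξ η + s ξ' η)
    (h4 : ∀ (c : ℂ) ξ η, s (c • ξ) η = star c * s ξ η) :
    ∃ a : H →L[ℂ] H, ‖a‖ ≤ 1 ∧ opForm a = s := by
  let B : H →L⋆[ℂ] H →L[ℂ] ℂ := LinearMap.mkContinuous₂
    (LinearMap.mk₂'ₛₗ (starRingEnd ℂ) (RingHom.id ℂ) s h3 h4 h1 h2) 1
    (fun ξ η => by simpa using hb ξ η)
  have hB : ∀ ξ η, B ξ η = s ξ η := fun ξ η => rfl
  set a : H →L[ℂ] H := star (InnerProductSpace.continuousLinearMapOfBilin B) with ha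
  have hs : ∀ ξ η, ⟪ξ, a η⟫_ℂ = s ξ η := by
    intro ξ η
    rw [ha, ContinuousLinearMap.star_eq_adjoint, ContinuousLinearMap.adjoint_inner_right,
      InnerProductSpace.continuousLinearMapOfBilin_apply, hB]
  refine ⟨a, ContinuousLinearMap.opNorm_le_bound _ zero_le_one fun η => ?_, ?_⟩
  · have h5 : ‖a η‖ * ‖a η‖ ≤ ‖a η‖ * ‖η‖ := by
      refine le_trans (le_of_eq ?_) (hb (a η) η)
      rw [← hs, inner_self_eq_norm_sq_to_K]
      simp [sq]
    rw [one_mul]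
    rcases (norm_nonneg (a η)).eq_or_lt with h | h
    · rw [← h]; exact norm_nonneg _
    · exact le_of_mul_le_mul_left h5 h
  · funext ξ η; exact hs ξ η

/-- The forms of the elements of the unit ball of a von Neumann algebra. -/
def ballForms (M : VonNeumannAlgebra H) : Set (H → H → ℂ) := opForm '' {a | a ∈ M ∧ ‖a‖ ≤ 1}

theorem norm_opForm_le {a : H →L[ℂ] H} (ha : ‖a‖ ≤ 1) (ξ η : H) :
    ‖opForm a ξ η‖ ≤ ‖ξ‖ * ‖η‖ :=
  (norm_inner_le_norm _ _).trans <| by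
    gcongr
    exact (a.le_opNorm η).trans (mul_le_of_le_one_left (norm_nonneg _) ha)

/-- Tychonoff, as in Banach–Alaoglu. By the double commutant property, membership in M amounts to
commuting with M', which is a closed condition on forms because each b in M' can be moved to one
side or the other of the form. -/
theorem isCompact_ballForms (M : VonNeumannAlgebra H) : IsCompact (ballForms M) := by
  have hcpt : IsCompact {s : H → H → ℂ | ∀ ξ η, s ξ η ∈ Metric.closedBall 0 (‖ξ‖ * ‖η‖)} := by
    have := isCompact_univ_pi fun ξ : H => isCompact_univ_pi fun η : H =>
      isCompact_closedBall (0 : ℂ) (‖ξ‖ * ‖η‖)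
    convert this using 1
    ext s; simp [Set.mem_pi]
  have heq : ballForms M = {s : H → H → ℂ | ∀ ξ η, s ξ η ∈ Metric.closedBall 0 (‖ξ‖ * ‖η‖)} ∩
      ({s | ∀ ξ η η', s ξ (η + η') = s ξ η + s ξ η'} ∩
       {s | ∀ (c : ℂ) ξ η, s ξ (c • η) = c * s ξ η} ∩
       {s | ∀ ξ ξ' η, s (ξ + ξ') η = s ξ η + s ξ' η} ∩
       {s | ∀ (c : ℂ) ξ η, s (c • ξ) η = star c * s ξ η} ∩
       {s | ∀ b ∈ M.commutant, ∀ ξ η, s ((star b) ξ) η = s ξ (b η)}) := by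
    ext s
    constructor
    · rintro ⟨a, ⟨ha, hn⟩, rfl⟩
      refine ⟨fun ξ η => by simpa using norm_opForm_le hn ξ η, ⟨⟨⟨?_, ?_⟩, ?_⟩, ?_⟩, ?_⟩
      · intro ξ η η'; simp [opForm]
      · intro c ξ η; simp [opForm]
      · intro ξ ξ' η; simp [opForm]
      · intro c ξ η; simp [opForm, mul_comm]
      · intro b hb ξ η
        have : a (b η) = b (a η) :=
          congrArg (fun T : H →L[ℂ] H => T η) (VonNeumannAlgebra.mem_commutant_iff.1 hb a ha)
        rw [opForm, opForm, this, ContinuousLinearMap.star_eq_adjoint,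
          ContinuousLinearMap.adjoint_inner_left]
    · rintro ⟨hb, ⟨⟨⟨h1, h2⟩, h3⟩, h4⟩, h5⟩
      obtain ⟨a, ha, rfl⟩ := exists_opForm_eq (fun ξ η => by simpa using hb ξ η) h1 h2 h3 h4
      refine ⟨a, ⟨?_, ha⟩, rfl⟩
      rw [← VonNeumannAlgebra.commutant_commutant M, VonNeumannAlgebra.mem_commutant_iff]
      intro b hb'
      ext η
      refine ext_inner_left ℂ fun ξ => ?_
      have := h5 b hb' ξ η
      rw [opForm, opForm, ContinuousLinearMap.star_eq_adjoint,
        ContinuousLinearMap.adjoint_inner_left] at this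
      exact this
  rw [heq]
  refine hcpt.inter_right (IsClosed.inter (IsClosed.inter (IsClosed.inter (IsClosed.inter ?_ ?_)
    ?_) ?_) ?_)
  all_goals simp only [ofPred_forall]
  all_goals repeat refine isClosed_iInter fun _ => ?_
  all_goals exact isClosed_eq (by fun_prop) (by fun_prop)

theorem lp_two_summable_mul (ξ η : lp (fun _ : ℕ => H) 2) : Summable fun n => ‖ξ n‖ * ‖η n‖ := by
  have h : ∀ ζ : lp (fun _ : ℕ => H) 2, Summable fun n => ‖ζ n‖ ^ 2 := fun ζ => by
    have := (lp.memℓp ζ).summable (by norm_num)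
    simpa using this
  refine Summable.of_nonneg_of_le (fun n => by positivity) (fun n => ?_) ((h ξ).add (h η))
  nlinarith [sq_nonneg (‖ξ n‖ - ‖η n‖), sq_nonneg (‖ξ n‖ + ‖η n‖)]

/-- A normal linear form is weakly continuous on the unit ball. -/
theorem exists_continuousOn_ballForms {M : VonNeumannAlgebra H}
    {τ : M.toStarSubalgebra →ₗ[ℂ] ℂ} (hτ : IsNormalFaithfulTracialState M τ) :
    ∃ F : (H → H → ℂ) → ℂ, ContinuousOn F (ballForms M) ∧
      ∀ a : M.toStarSubalgebra, F (opForm a.1) = τ a := by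
  have hinj : Function.Injective fun a : M.toStarSubalgebra => opForm a.1 :=
    opForm_injective.comp Subtype.val_injective
  have hleft := Function.leftInverse_invFun hinj
  -- Off the range of `opForm` the value of `op` is arbitrary, which is harmless because continuity
  -- is claimed only on `ballForms M`.
  set op : (H → H → ℂ) → M.toStarSubalgebra :=
    Function.invFun fun a : M.toStarSubalgebra => opForm a.1 with hop
  refine ⟨fun s => τ (op s), ?_, fun a => congrArg τ (hleft a)⟩
  rw [continuousOn_iff_continuous_domRestrict]
  have hform : ∀ s ∈ ballForms M, opForm (op s).1 = s := by
    rintro _ ⟨a, ⟨ha, _⟩, rfl⟩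
    exact congrArg (fun b : M.toStarSubalgebra => opForm b.1) (hleft ⟨a, ha⟩)
  let _ : TopologicalSpace M.toStarSubalgebra :=
    TopologicalSpace.induced Subtype.val (ultraweakTopology H)
  have h1 : Continuous fun s : ballForms M => op s := by
    refine continuous_induced_rng.2 ?_
    refine continuous_iInf_rng.2 fun ξ => continuous_iInf_rng.2 fun η => continuous_induced_rng.2 ?_
    have h2 : ((fun x : H →L[ℂ] H => ∑' n, ⟪ξ n, x (η n)⟫_ℂ) ∘
        (Subtype.val ∘ fun s : ballForms M => op s)) =
        fun s : ballForms M => ∑' n, s.1 (ξ n) (η n) := by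
      funext s
      exact tsum_congr fun n => congrFun (congrFun (hform s.1 s.2) (ξ n)) (η n)
    rw [h2]
    -- On the unit ball the series is dominated by ‖ξ n‖ ‖η n‖ uniformly in the form, so weak
    -- continuity of each term gives ultraweak continuity of the sum.
    refine continuous_tsum (fun n => ?_) (lp_two_summable_mul ξ η) ?_
    · exact (continuous_apply (η n)).comp ((continuous_apply (ξ n)).comp continuous_subtype_val)
    rintro n ⟨_, a, ⟨_, ha⟩, rfl⟩
    exact norm_opForm_le ha _ _
  exact Continuous.comp (g := τ) hτ.normal h1

end Forms

/-! ### Extreme points of the unit ball of a tracial von Neumann algebra -/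

section Extreme

variable {H : Type v} [NormedAddCommGroup H] [InnerProductSpace ℂ H] [CompleteSpace H]

theorem opNorm_le_one_of_sq {a : H →L[ℂ] H} (h : ∀ ξ, ‖a ξ‖ ^ 2 ≤ ‖ξ‖ ^ 2) : ‖a‖ ≤ 1 :=
  ContinuousLinearMap.opNorm_le_bound _ zero_le_one fun ξ => by
    rw [one_mul]; exact (sq_le_sq₀ (norm_nonneg _) (norm_nonneg _)).1 (h ξ)

theorem norm_apply_le_of_opNorm_le_one {a : H →L[ℂ] H} (h : ‖a‖ ≤ 1) (ξ : H) : ‖a ξ‖ ≤ ‖ξ‖ :=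
  (a.le_opNorm ξ).trans (mul_le_of_le_one_left (norm_nonneg _) h)

theorem norm_apply_sq_eq (a : H →L[ℂ] H) (ξ : H) :
    ‖a ξ‖ ^ 2 = (⟪ξ, (star a * a) ξ⟫_ℂ).re := by
  rw [mul_apply_eq_comp, ContinuousLinearMap.star_eq_adjoint,
    ContinuousLinearMap.adjoint_inner_right]
  exact (inner_self_eq_norm_sq (𝕜 := ℂ) _).symm

/-- Together with `opNorm_add_half_le`, this exhibits any contraction x as a midpoint of two
contractions, so at an extreme point x (1 - x* x) = 0 and x is a partial isometry. -/
theorem opNorm_sub_half_le {x : H →L[ℂ] H} (hx : ‖x‖ ≤ 1) :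
    ‖x - (2⁻¹ : ℂ) • (x * (1 - star x * x))‖ ≤ 1 := by
  have h1 : x - (2⁻¹ : ℂ) • (x * (1 - star x * x)) = (2⁻¹ : ℂ) • (x + x * (star x * x)) := by
    rw [mul_sub, mul_one]; module
  have h2 : ‖x * (star x * x)‖ ≤ 1 := by
    calc ‖x * (star x * x)‖ ≤ ‖x‖ * (‖star x‖ * ‖x‖) :=
          (norm_mul_le _ _).trans (by gcongr; exact norm_mul_le _ _)
      _ ≤ 1 * (1 * 1) := by gcongr; rwa [norm_star]
      _ = 1 := by norm_num
  rw [h1, norm_smul]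
  have h3 := norm_add_le x (x * (star x * x))
  norm_num
  linarith

/-- With h = x* x, the square of the perturbed operator is 1 - (1 - h)² + ¼ |x (1 - h)|², and |x (1
- h)|² ≤ (1 - h)². -/
theorem opNorm_add_half_le {x : H →L[ℂ] H} (hx : ‖x‖ ≤ 1) :
    ‖x + (2⁻¹ : ℂ) • (x * (1 - star x * x))‖ ≤ 1 := by
  refine opNorm_le_one_of_sq fun ξ => ?_
  set h := star x * x with hh
  have hs : star h = h := by rw [hh, star_mul, star_star]
  have h1 : star (x + (2⁻¹ : ℂ) • (x * (1 - h))) * (x + (2⁻¹ : ℂ) • (x * (1 - h))) =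
      1 - (star (1 - h) * (1 - h) - (4⁻¹ : ℂ) • (star (x * (1 - h)) * (x * (1 - h)))) := by
    have e1 : star x * (x * (1 - h)) = h * (1 - h) := by rw [← mul_assoc]
    have e2 : ∀ y : H →L[ℂ] H, star x * (x * y) = h * y := fun y => by rw [← mul_assoc]
    have h2 : star (2⁻¹ : ℂ) = 2⁻¹ := by norm_num
    simp only [star_add, star_smul, star_mul, star_sub, star_one, hs, h2, add_mul, mul_add,
      smul_mul_assoc, mul_smul_comm, mul_assoc, e2, ← hh]
    simp only [mul_sub, sub_mul, mul_one, one_mul]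
    module
  rw [norm_apply_sq_eq, h1]
  simp only [sub_apply, smul_apply, inner_sub_right, one_apply_eq_self, inner_smul_right,
    Complex.sub_re]
  rw [← norm_apply_sq_eq]
  have h3 : (4⁻¹ * ⟪ξ, (star (x * (1 - h)) * (x * (1 - h))) ξ⟫_ℂ).re =
      4⁻¹ * ‖(x * (1 - h)) ξ‖ ^ 2 := by
    rw [norm_apply_sq_eq, show (4⁻¹ : ℂ) = ((4⁻¹ : ℝ) : ℂ) by norm_num, Complex.re_ofReal_mul]
  have h4 : (⟪ξ, ξ⟫_ℂ).re = ‖ξ‖ ^ 2 := inner_self_eq_norm_sq (𝕜 := ℂ) ξ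
  have h5 : ‖(x * (1 - h)) ξ‖ ^ 2 ≤ ‖(1 - h) ξ‖ ^ 2 := by
    gcongr; exact norm_apply_le_of_opNorm_le_one hx _
  rw [h3, h4]
  nlinarith [sq_nonneg ‖(1 - h) ξ‖]

/-- The hypothesis makes x a partial isometry with range projection 1 - p and initial projection 1 -
q. The corner p z q acts on the kernel of x and takes values orthogonal to its range, so squared
norms add by Pythagoras. -/
theorem opNorm_add_corner_le {x z : H →L[ℂ] H} (hx : x * (1 - star x * x) = 0) (hz : ‖z‖ ≤ 1) :
    ‖x + (1 - x * star x) * z * (1 - star x * x)‖ ≤ 1 := by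
  set p := 1 - x * star x with hp
  set q := 1 - star x * x with hq
  have hqs : star q = q := by simp [hq]
  have hps : star p = p := by simp [hp]
  have hqq : star q * q = q := by
    rw [hqs]; nth_rewrite 1 [hq]; rw [sub_mul, mul_assoc, hx, mul_zero, sub_zero, one_mul]
  have hx' : x * star x * x = x := by
    rw [hq, mul_sub, mul_one, sub_eq_zero, ← mul_assoc] at hx; exact hx.symm
  have hpx : p * x = 0 := by rw [hp, sub_mul, one_mul, hx', sub_self]
  have hpp : star p * p = p := by
    rw [hps]; nth_rewrite 2 [hp]; rw [mul_sub, ← mul_assoc, hpx, zero_mul, sub_zero, mul_one]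
  have hpn : ‖p‖ ≤ 1 := by
    have : ‖p‖ * ‖p‖ = ‖p‖ := by rw [← CStarRing.norm_star_mul_self, hpp]
    by_contra! hcon
    nlinarith
  refine opNorm_le_one_of_sq fun ξ => ?_
  have horth : ⟪x ξ, (p * z * q) ξ⟫_ℂ = 0 := by
    have : (p * z * q) ξ = (star p) ((z * q) ξ) := by rw [hps]; rfl
    rw [this, ContinuousLinearMap.star_eq_adjoint, ContinuousLinearMap.adjoint_inner_right,
      ← mul_apply_eq_comp, hpx]
    simp
  have h1 := norm_add_sq_eq_norm_sq_add_norm_sq_of_inner_eq_zero (x ξ) ((p * z * q) ξ) horth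
  have h2 : ‖x ξ‖ ^ 2 = ‖ξ‖ ^ 2 - ‖q ξ‖ ^ 2 := by
    have h4 : (⟪ξ, ξ⟫_ℂ).re = ‖ξ‖ ^ 2 := inner_self_eq_norm_sq (𝕜 := ℂ) ξ
    rw [norm_apply_sq_eq, norm_apply_sq_eq q, hqq, hq, sub_apply, inner_sub_right,
      Complex.sub_re, one_apply_eq_self, h4]
    ring
  have h3 : ‖(p * z * q) ξ‖ ≤ ‖q ξ‖ :=
    (norm_apply_le_of_opNorm_le_one hpn _).trans (norm_apply_le_of_opNorm_le_one hz _)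
  rw [add_apply]
  nlinarith [norm_nonneg ((p * z * q) ξ), norm_nonneg (q ξ)]

/-- If `p N q = 0`, then the central support of `q` is orthogonal to `p`. -/
theorem exists_central_support (N : VonNeumannAlgebra H) {p q : H →L[ℂ] H} (hq : q ∈ N)
    (h : ∀ b ∈ N, p * b * q = 0) :
    ∃ z ∈ N, z ∈ N.commutant ∧ star z = z ∧ z * q = q ∧ p * z = 0 := by
  -- The central support of q is the projection onto the closed span of N q H. Invariance of S under
  -- N' puts that projection in N, and invariance under N puts it in N'.
  set S : Set H := {η | ∃ b ∈ N, ∃ ξ, η = b (q ξ)} with hS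
  set K := (Submodule.span ℂ S).topologicalClosure with hK
  have hSK : ∀ η ∈ S, η ∈ K := fun η hη =>
    Submodule.le_topologicalClosure _ (Submodule.subset_span hη)
  have hKle : ∀ (L : Submodule ℂ H), IsClosed (L : Set H) → S ⊆ L → K ≤ L := fun L hL hSL =>
    Submodule.topologicalClosure_minimal _ (Submodule.span_le.2 hSL) hL
  have hinv : ∀ y : H →L[ℂ] H, (∀ η ∈ S, y η ∈ S) → ∀ η ∈ K, y η ∈ K := by
    intro y hy
    refine hKle (K.comap y.toLinearMap) ?_ fun η hη => hSK _ (hy η hη)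
    exact (Submodule.isClosed_topologicalClosure _).preimage y.continuous
  have : CompleteSpace K := (Submodule.isClosed_topologicalClosure _).completeSpace_coe
  have hz : IsStarProjection K.starProjection := isStarProjection_starProjection
  have hrange : ∀ y : H →L[ℂ] H, (∀ η ∈ S, y η ∈ S) →
      K.starProjection.range ∈ Module.End.invtSubmodule (y : H →ₗ[ℂ] H) := by
    intro y hy
    rw [Submodule.range_starProjection]
    exact fun η hη => hinv y hy η hη
  refine ⟨K.starProjection, ?_, ?_, hz.isSelfAdjoint, ?_, ?_⟩
  · rw [VonNeumannAlgebra.IsStarProjection.mem_iff hz]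
    refine fun y hy => hrange y ?_
    rintro _ ⟨b, hb, ξ, rfl⟩
    refine ⟨b, hb, y ξ, ?_⟩
    have h1 := VonNeumannAlgebra.mem_commutant_iff.1 hy (b * q) (mul_mem hb hq)
    exact (congrArg (fun T : H →L[ℂ] H => T ξ) h1).symm
  · rw [VonNeumannAlgebra.IsStarProjection.mem_iff hz, VonNeumannAlgebra.commutant_commutant]
    refine fun y hy => hrange y ?_
    rintro _ ⟨b, hb, ξ, rfl⟩
    exact ⟨y * b, mul_mem hy hb, ξ, rfl⟩
  · ext ξ
    exact Submodule.starProjection_eq_self_iff.2 (hSK _ ⟨1, one_mem _, ξ, rfl⟩)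
  · ext ξ
    have : K ≤ p.ker := by
      refine hKle _ p.isClosed_ker ?_
      rintro _ ⟨b, hb, ξ, rfl⟩
      exact congrArg (fun T : H →L[ℂ] H => T ξ) (h b hb)
    exact this (Submodule.starProjection_apply_mem _ _)

/-- Extreme points of the unit ball of a tracial von Neumann algebra are unitary. -/
theorem mem_unitary_of_extreme {N : VonNeumannAlgebra H} {τ : N.toStarSubalgebra →ₗ[ℂ] ℂ}
    (hτ : IsNormalFaithfulTracialState N τ) {u : N.toStarSubalgebra} (hu : ‖u.1‖ ≤ 1)
    (hext : ∀ a : N.toStarSubalgebra, ‖(u + a).1‖ ≤ 1 → ‖(u - a).1‖ ≤ 1 → a = 0) :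
    u ∈ unitary N.toStarSubalgebra := by
  -- The first perturbation shows that u is a partial isometry. Perturbing by the corners p z q then
  -- gives p N q = 0.
  have h1 : u * (1 - star u * u) = 0 := by
    have := hext ((2⁻¹ : ℂ) • (u * (1 - star u * u))) (opNorm_add_half_le hu)
      (opNorm_sub_half_le hu)
    exact (smul_eq_zero.1 this).resolve_left (by norm_num)
  have h1' : u.1 * (1 - star u.1 * u.1) = 0 := congrArg Subtype.val h1
  set p := 1 - u * star u with hp
  set q := 1 - star u * u with hq
  have hcorner : ∀ z : N.toStarSubalgebra, ‖z.1‖ ≤ 1 → p * z * q = 0 := by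
    intro z hz
    refine hext _ (opNorm_add_corner_le h1' hz) ?_
    have := opNorm_add_corner_le h1' (z := -z.1) (by rwa [norm_neg])
    rwa [mul_neg, neg_mul, ← sub_eq_add_neg] at this
  have hcorner' : ∀ z ∈ N, p.1 * z * q.1 = 0 := by
    intro z hz
    rcases eq_or_ne z 0 with rfl | hz0
    · simp
    have hn : ‖z‖ ≠ 0 := norm_ne_zero_iff.2 hz0
    have h2 := hcorner (((‖z‖⁻¹ : ℝ) : ℂ) • ⟨z, hz⟩) (by
      change ‖((‖z‖⁻¹ : ℝ) : ℂ) • z‖ ≤ 1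
      rw [norm_smul, Complex.norm_real, norm_inv, norm_norm, inv_mul_cancel₀ hn])
    rw [mul_smul_comm, smul_mul_assoc, smul_eq_zero] at h2
    exact congrArg Subtype.val (h2.resolve_left (by simpa using hn))
  obtain ⟨z, hzN, hzc, hzs, hzq, hpz⟩ := exists_central_support N q.2 hcorner'
  set z' : N.toStarSubalgebra := ⟨z, hzN⟩ with hz'
  have hzq' : z' * q = q := Subtype.ext hzq
  have hzp' : z' * p = 0 := by
    have h2 : p * z' = 0 := Subtype.ext hpz
    have h3 := congrArg star h2
    rw [star_mul, star_zero] at h3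
    have hps : star p = p := by simp [hp]
    have hzs' : star z' = z' := Subtype.ext hzs
    rwa [hps, hzs'] at h3
  have hcomm : star u * z' = z' * star u :=
    Subtype.ext (VonNeumannAlgebra.mem_commutant_iff.1 hzc _ (star u).2)
  -- As z is central, dominates q and is orthogonal to p = 1 - u u*, one has z = z u u* and u* z u =
  -- z - q. The trace property gives τ(z) = τ(z) - τ(q). This is where finiteness of the algebra
  -- enters.
  have hτq : τ q = 0 := by
    have h2 : z' = z' * u * star u := by
      rw [hp, mul_sub, mul_one, sub_eq_zero, ← mul_assoc] at hzp'; exact hzp'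
    have h3 : star u * (z' * u) = z' - q := by
      rw [← mul_assoc, hcomm, mul_assoc]
      have : z' * (star u * u) = z' - z' * q := by rw [hq, mul_sub, mul_one, sub_sub_cancel]
      rw [this, hzq']
    have h4 : τ z' = τ z' - τ q := by
      conv_lhs => rw [h2, hτ.tracial, h3, map_sub]
    exact sub_eq_self.1 h4.symm
  have hτp : τ p = 0 := by
    rw [← hτq, hp, hq, map_sub, map_sub, hτ.tracial]
  have hqq : star q * q = q := by
    have hqs : star q = q := by simp [hq]
    rw [hqs]; nth_rewrite 1 [hq]; rw [sub_mul, mul_assoc, h1, mul_zero, sub_zero, one_mul]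
  have hq0 : q = 0 := hτ.faithful q (by rw [hqq, hτq])
  have hpp : star p * p = p := by
    have hps : star p = p := by simp [hp]
    have h2 : p * u = 0 := by
      have : u * star u * u = u := by
        rw [hq, mul_sub, mul_one, sub_eq_zero, ← mul_assoc] at h1; exact h1.symm
      rw [hp, sub_mul, one_mul, this, sub_self]
    rw [hps]; nth_rewrite 2 [hp]; rw [mul_sub, ← mul_assoc, h2, zero_mul, sub_zero, mul_one]
  have hp0 : p = 0 := hτ.faithful p (by rw [hpp, hτp])
  exact Unitary.mem_iff.2 ⟨(sub_eq_zero.1 hq0).symm, (sub_eq_zero.1 hp0).symm⟩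

/-- Left multiplication by x* becomes, on forms, substitution of x in the first variable. This is
weakly continuous and preserves the ball. -/
theorem exists_continuousOn_star_mul {M : VonNeumannAlgebra H}
    {τ : M.toStarSubalgebra →ₗ[ℂ] ℂ} (hτ : IsNormalFaithfulTracialState M τ)
    (x : M.toStarSubalgebra) (hx : ‖x.1‖ ≤ 1) :
    ∃ f : (H → H → ℂ) → ℂ, ContinuousOn f (ballForms M) ∧
      ∀ a : M.toStarSubalgebra, f (opForm a.1) = τ (star x * a) := by
  obtain ⟨F, hFc, hF⟩ := exists_continuousOn_ballForms hτ
  refine ⟨fun s => F fun ξ η => s (x.1 ξ) η, hFc.comp (Continuous.continuousOn ?_) ?_, ?_⟩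
  · refine continuous_pi fun ξ => continuous_pi fun η => ?_
    exact (continuous_apply η).comp (continuous_apply (x.1 ξ))
  · rintro _ ⟨a, ⟨ha, han⟩, rfl⟩
    refine ⟨star x.1 * a, ⟨mul_mem (star_mem x.2) ha, ?_⟩, ?_⟩
    · refine (norm_mul_le _ _).trans (mul_le_one₀ ?_ (norm_nonneg _) han)
      rwa [norm_star]
    · funext ξ η
      change ⟪ξ, (star x.1) (a η)⟫_ℂ = ⟪x.1 ξ, a η⟫_ℂ
      rw [ContinuousLinearMap.star_eq_adjoint, ContinuousLinearMap.adjoint_inner_right]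
  · intro a
    rw [← hF]
    change F _ = F _
    congr 1
    funext ξ η
    change ⟪x.1 ξ, a.1 η⟫_ℂ = ⟪ξ, (star x.1) (a.1 η)⟫_ℂ
    rw [ContinuousLinearMap.star_eq_adjoint, ContinuousLinearMap.adjoint_inner_right]

/-- Let `x` be an element of the unit ball of a tracial von Neumann algebra `M`, and `N` a
subalgebra. The maximum of `Re τ(x* a)` over the unit ball of `N` is attained at a unitary. -/
theorem exists_unitary_maximizer {M N : VonNeumannAlgebra H} (hNM : N ≤ M)
    {τ : M.toStarSubalgebra →ₗ[ℂ] ℂ} (hτ : IsNormalFaithfulTracialState M τ)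
    (x : M.toStarSubalgebra) (hx : ‖x.1‖ ≤ 1) :
    ∃ u ∈ unitary N.toStarSubalgebra, ∀ a : N.toStarSubalgebra, ‖a.1‖ ≤ 1 →
      (τ (star x * ⟨a.1, hNM a.2⟩)).re ≤ (τ (star x * ⟨u.1, hNM u.2⟩)).re := by
  obtain ⟨F, hFc, hF⟩ := exists_continuousOn_star_mul hτ x hx
  set S := ballForms N with hS
  let f : (H → H → ℂ) → ℝ := fun s => (F s).re
  have hxF : ∀ a : N.toStarSubalgebra, f (opForm a.1) = (τ (star x * ⟨a.1, hNM a.2⟩)).re :=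
    fun a => congrArg Complex.re (hF ⟨a.1, hNM a.2⟩)
  have hfc : ContinuousOn f S :=
    Complex.continuous_re.comp_continuousOn (hFc.mono (image_mono fun a ha => ⟨hNM ha.1, ha.2⟩))
  have hne : S.Nonempty := ⟨_, 0, ⟨zero_mem _, by simp⟩, rfl⟩
  have hScpt : IsCompact S := isCompact_ballForms N
  obtain ⟨s₀, hs₀, hmax⟩ := hScpt.exists_isMaxOn hne hfc
  -- The maximizers form a compact face, which has an extreme point by Krein–Milman. If u ± a lie in
  -- the ball, the mean of their values is the maximum, so both are maximizers and extremality in T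
  -- already forces a = 0.
  set T := S ∩ f ⁻¹' (Ici (f s₀)) with hT
  have hTcpt : IsCompact T :=
    hScpt.of_isClosed_subset (hfc.preimage_isClosed_of_isClosed hScpt.isClosed isClosed_Ici)
      inter_subset_left
  obtain ⟨s, hs⟩ := hTcpt.extremePoints_nonempty ⟨s₀, hs₀, by simp⟩
  obtain ⟨⟨⟨u, ⟨huN, hun⟩, rfl⟩, hfu⟩, hext⟩ := mem_extremePoints.1 hs
  set u' : N.toStarSubalgebra := ⟨u, huN⟩ with hu'
  have hle : ∀ a : N.toStarSubalgebra, ‖a.1‖ ≤ 1 → f (opForm a.1) ≤ f s₀ :=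
    fun a ha => hmax ⟨a.1, ⟨a.2, ha⟩, rfl⟩
  refine ⟨u', mem_unitary_of_extreme (hτ.restrict hNM) hun ?_, fun a ha => ?_⟩
  · intro a ha1 ha2
    have hadd : f (opForm (u' + a).1) + f (opForm (u' - a).1) = 2 * f (opForm u'.1) := by
      rw [hxF, hxF, hxF, ← Complex.add_re, ← map_add, ← mul_add]
      have : (⟨(u' + a).1, hNM (u' + a).2⟩ : M.toStarSubalgebra) + ⟨(u' - a).1, hNM (u' - a).2⟩ =
          (2 : ℂ) • ⟨u'.1, hNM u'.2⟩ := by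
        refine Subtype.ext ?_
        change (u + a.1) + (u - a.1) = (2 : ℂ) • u
        module
      rw [this, mul_smul_comm, map_smul]
      simp
    have hfu' : f s₀ ≤ f (opForm u'.1) := hfu
    have h1 := hle _ ha1
    have h2 := hle _ ha2
    have m1 : opForm (u' + a).1 ∈ T := ⟨⟨_, ⟨(u' + a).2, ha1⟩, rfl⟩, by
      change f s₀ ≤ _; linarith⟩
    have m2 : opForm (u' - a).1 ∈ T := ⟨⟨_, ⟨(u' - a).2, ha2⟩, rfl⟩, by
      change f s₀ ≤ _; linarith⟩
    have h3 := (hext _ m1 _ m2 ⟨1 / 2, 1 / 2, by norm_num, by norm_num, by norm_num, by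
      funext ξ η
      change (1 / 2 : ℝ) • ⟪ξ, (u + a.1) η⟫_ℂ + (1 / 2 : ℝ) • ⟪ξ, (u - a.1) η⟫_ℂ = ⟪ξ, u η⟫_ℂ
      rw [← smul_add, ← inner_add_right, ← add_apply]
      have : u + a.1 + (u - a.1) = (2 : ℂ) • u := by module
      rw [this, smul_apply, inner_smul_right, Complex.real_smul]
      push_cast; ring⟩).1
    have h4 : u + a.1 = u := opForm_injective h3
    exact Subtype.ext (by simpa using h4)
  · rw [← hxF, ← hxF]
    exact (hle a ha).trans hfu

end Extreme

/-! ### The GNS space of a tracial von Neumann algebra -/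

namespace TracialVNA

variable (A : TracialVNA.{v})

/-- A positive form is hermitian by polarization: reality of τ(y* y) is applied to y = 1 + x and y =
1 + i x. -/
theorem τ_star (x : A.Elem) : A.τ (star x) = star (A.τ x) := by
  have key : ∀ x y : A.Elem, (A.τ (star x * y)).im + (A.τ (star y * x)).im = 0 := by
    intro x y
    have h0 := (Complex.nonneg_iff.1 (A.isState.nonneg (x + y))).2
    have h1 := (Complex.nonneg_iff.1 (A.isState.nonneg x)).2
    have h2 := (Complex.nonneg_iff.1 (A.isState.nonneg y)).2
    rw [star_add, add_mul, mul_add, mul_add, map_add, map_add, map_add] at h0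
    simp only [Complex.add_im] at h0
    linarith
  have h1 := key 1 x
  have h2 := key 1 (Complex.I • x)
  simp only [star_one, one_mul, mul_one, star_smul, map_smul, smul_eq_mul, Complex.star_def,
    Complex.conj_I, Complex.mul_im, Complex.neg_im, Complex.neg_re, Complex.I_re,
    Complex.I_im] at h1 h2
  apply Complex.ext
  · rw [Complex.star_def, Complex.conj_re]; linarith
  · rw [Complex.star_def, Complex.conj_im]; linarith

/-- The elements of `A`, viewed as vectors of the GNS space. -/
def L2Pre : Type v := A.Elem

variable {A} in
/-- The element of `A` underlying a vector. -/
def L2Pre.elem (x : A.L2Pre) : A.Elem := x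

instance : AddCommGroup A.L2Pre := inferInstanceAs (AddCommGroup A.Elem)

instance : Module ℂ A.L2Pre := inferInstanceAs (Module ℂ A.Elem)

/-- The inner product `⟪x, y⟫ = τ(x* y)`. -/
@[reducible]
def innerCore : InnerProductSpace.Core ℂ A.L2Pre where
  inner x y := A.τ (star x.elem * y.elem)
  conj_inner_symm x y := by
    have := A.τ_star (star y.elem * x.elem)
    rw [star_mul, star_star] at this
    exact this.symm
  re_inner_nonneg x := (Complex.nonneg_iff.1 (A.isState.nonneg x)).1
  add_left x y z := by
    change A.τ (star (x.elem + y.elem) * z.elem) = _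
    rw [star_add, add_mul, map_add]
  smul_left x y c := by
    change A.τ (star (c • x.elem) * y.elem) = _
    rw [star_smul, smul_mul_assoc, map_smul]; rfl
  definite x := A.isState.faithful x

instance : NormedAddCommGroup A.L2Pre := A.innerCore.toNormedAddCommGroup

instance : InnerProductSpace ℂ A.L2Pre := InnerProductSpace.ofCore A.innerCore.toCore

/-- The GNS space `L²(A, τ)`. -/
abbrev L2 : Type v := UniformSpace.Completion A.L2Pre

/-- The inclusion of `A` in its GNS space. -/
def toL2 : A.Elem →ₗ[ℂ] A.L2 where
  toFun x := ((show A.L2Pre from x : A.L2Pre) : A.L2)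
  map_add' x y := UniformSpace.Completion.coe_add (α := A.L2Pre) x y
  map_smul' c x := UniformSpace.Completion.coe_smul (X := A.L2Pre) c x

theorem inner_toL2 (x y : A.Elem) : ⟪A.toL2 x, A.toL2 y⟫_ℂ = A.τ (star x * y) :=
  UniformSpace.Completion.inner_coe (𝕜 := ℂ) (E := A.L2Pre) x y

theorem norm_toL2_sq (x : A.Elem) : ‖A.toL2 x‖ ^ 2 = A.normSq x := by
  rw [normSq, ← inner_toL2]
  exact (inner_self_eq_norm_sq (𝕜 := ℂ) _).symm

theorem toL2_injective : Function.Injective A.toL2 :=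
  UniformSpace.Completion.coe_injective A.L2Pre

theorem L2_induction {p : A.L2 → Prop} (hp : IsClosed {ξ | p ξ}) (h : ∀ x, p (A.toL2 x)) (ξ : A.L2) :
    p ξ :=
  UniformSpace.Completion.induction_on ξ hp h

/-- Conjugation by a unitary, on the dense subspace `A` of `L²(A, τ)`. -/
def conjPre (u : A.U) : A.L2Pre →ₗᵢ[ℂ] A.L2Pre where
  toFun x := (u : A.Elem) * x.elem * star (u : A.Elem)
  map_add' x y := by
    change (u : A.Elem) * (x.elem + y.elem) * star (u : A.Elem) = _
    rw [mul_add, add_mul]; rfl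
  map_smul' c x := by
    change (u : A.Elem) * (c • x.elem) * star (u : A.Elem) = _
    rw [mul_smul_comm, smul_mul_assoc]; rfl
  norm_map' x := by
    have h : ∀ y : A.L2Pre, ‖y‖ = √(A.τ (star y.elem * y.elem)).re := fun y => rfl
    rw [h, h]
    congr 2
    change A.τ (star ((u : A.Elem) * x.elem * star (u : A.Elem)) *
      ((u : A.Elem) * x.elem * star (u : A.Elem))) = A.τ (star x.elem * x.elem)
    rw [A.isState.tracial]
    have h1 : star (u : A.Elem) * (u : A.Elem) = 1 := Unitary.coe_star_mul_self u
    simp only [star_mul, star_star, mul_assoc]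
    rw [← mul_assoc (star (u : A.Elem)) (u : A.Elem), h1, one_mul, A.isState.tracial]
    simp only [mul_assoc, h1, mul_one]
    exact A.isState.tracial _ _

variable {A} {G : Type*} [Group G]

/-- The unitary representation of `G` on `L²(A, τ)` by conjugation. -/
def conjRep (π : G →* A.U) : G →* unitary (A.L2 →L[ℂ] A.L2) :=
  unitaryRep
    { toFun := fun g => (A.conjPre (π g)).toContinuousLinearMap.completion
      map_one' := by
        ext ξ
        induction ξ using UniformSpace.Completion.induction_on with
        | hp => exact isClosed_eq (by fun_prop) (by fun_prop)
        | ih x =>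
          rw [ContinuousLinearMap.completion_apply_coe]
          change A.toL2 ((π 1 : A.Elem) * x.elem * star (π 1 : A.Elem)) = A.toL2 x.elem
          simp
      map_mul' := fun g h => by
        ext ξ
        induction ξ using UniformSpace.Completion.induction_on with
        | hp => exact isClosed_eq (by fun_prop) (by fun_prop)
        | ih x =>
          rw [mul_apply_eq_comp, ContinuousLinearMap.completion_apply_coe,
            ContinuousLinearMap.completion_apply_coe, ContinuousLinearMap.completion_apply_coe]
          change A.toL2 ((π (g * h) : A.Elem) * x.elem * star (π (g * h) : A.Elem)) =
            A.toL2 ((π g : A.Elem) * ((π h : A.Elem) * x.elem * star (π h : A.Elem)) *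
              star (π g : A.Elem))
          simp [mul_assoc] }
    fun g ξ => by
      induction ξ using UniformSpace.Completion.induction_on with
      | hp => exact isClosed_eq (by fun_prop) (by fun_prop)
      | ih x =>
        change ‖(A.conjPre (π g)).toContinuousLinearMap.completion x‖ = _
        rw [ContinuousLinearMap.completion_apply_coe, UniformSpace.Completion.norm_coe,
          UniformSpace.Completion.norm_coe]
        exact (A.conjPre (π g)).norm_map x

theorem conjRep_toL2 (π : G →* A.U) (g : G) (x : A.Elem) :
    (conjRep π g : A.L2 →L[ℂ] A.L2) (A.toL2 x) =
      A.toL2 ((π g : A.Elem) * x * star (π g : A.Elem)) :=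
  ContinuousLinearMap.completion_apply_coe (A.conjPre (π g)).toContinuousLinearMap x

/-! ### Unitary invariance of the 2-norm -/

theorem normSq_nonneg (x : A.Elem) : 0 ≤ A.normSq x := by
  rw [← norm_toL2_sq]; positivity

theorem normSq_mul_unitary (x : A.Elem) (u : A.U) : A.normSq (x * u) = A.normSq x := by
  rw [normSq, normSq, A.isState.tracial, star_mul, ← mul_assoc, mul_assoc x,
    Unitary.mul_star_self_of_mem u.2, mul_one, A.isState.tracial]

theorem normSq_unitary_mul (u : A.U) (x : A.Elem) : A.normSq (u * x) = A.normSq x := by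
  rw [normSq, normSq, star_mul, mul_assoc, ← mul_assoc _ (u : A.Elem), Unitary.coe_star_mul_self,
    one_mul]

theorem normSq_unitary (u : A.U) : A.normSq u = 1 := by
  rw [normSq, Unitary.coe_star_mul_self, A.isState.map_one, Complex.one_re]

theorem normSq_neg (x : A.Elem) : A.normSq (-x) = A.normSq x := by
  rw [normSq, normSq, star_neg, neg_mul_neg]

theorem normSq_sub_comm (x y : A.Elem) : A.normSq (x - y) = A.normSq (y - x) := by
  rw [← normSq_neg, neg_sub]

theorem normSq_add_le (x y : A.Elem) : A.normSq (x + y) ≤ 2 * (A.normSq x + A.normSq y) := by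
  simp only [← norm_toL2_sq, map_add]
  have h1 := norm_add_le (A.toL2 x) (A.toL2 y)
  nlinarith [sq_nonneg (‖A.toL2 x‖ - ‖A.toL2 y‖), norm_nonneg (A.toL2 x + A.toL2 y)]

theorem norm_conjRep_sub_sq (π : G →* A.U) (g : G) (x : A.Elem) :
    ‖(conjRep π g : A.L2 →L[ℂ] A.L2) (A.toL2 x) - A.toL2 x‖ ^ 2 =
      A.normSq ((π g : A.Elem) * x - x * (π g : A.Elem)) := by
  rw [conjRep_toL2, ← map_sub, norm_toL2_sq, ← normSq_mul_unitary _ (π g), sub_mul, mul_assoc,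
    Unitary.coe_star_mul_self, mul_one]

/-! ### Relative commutants -/

/-- The commutant in `A` of the image of `π`. -/
def relCommutant (π : G →* A.U) : VonNeumannAlgebra A.H where
  toStarSubalgebra := StarSubalgebra.centralizer ℂ
    ((A.M.commutant : Set (A.H →L[ℂ] A.H)) ∪ Set.range fun g => ((π g : A.Elem) : A.H →L[ℂ] A.H))
  centralizer_centralizer' := by
    -- Commuting with M' puts an operator in M'' = M, and the rest of S imposes commutation with π.
    -- Any centralizer is its own double centralizer.
    set S : Set (A.H →L[ℂ] A.H) := (A.M.commutant : Set (A.H →L[ℂ] A.H)) ∪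
      Set.range fun g => ((π g : A.Elem) : A.H →L[ℂ] A.H)
    have h : (StarSubalgebra.centralizer ℂ S).carrier = (S ∪ star S).centralizer :=
      StarSubalgebra.coe_centralizer ℂ S
    rw [h, Set.centralizer_centralizer_centralizer]

theorem mem_relCommutant {π : G →* A.U} {a : A.H →L[ℂ] A.H} :
    a ∈ relCommutant π ↔ a ∈ A.M ∧ ∀ g, ((π g : A.Elem) : A.H →L[ℂ] A.H) * a =
      a * ((π g : A.Elem) : A.H →L[ℂ] A.H) := by
  change a ∈ StarSubalgebra.centralizer ℂ _ ↔ _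
  rw [StarSubalgebra.mem_centralizer_iff]
  constructor
  · intro h
    refine ⟨?_, fun g => (h _ (Or.inr ⟨g, rfl⟩)).1⟩
    rw [← VonNeumannAlgebra.commutant_commutant A.M, VonNeumannAlgebra.mem_commutant_iff]
    exact fun b hb => (h b (Or.inl hb)).1
  · rintro ⟨h1, h2⟩ b (hb | ⟨g, rfl⟩)
    · rw [← VonNeumannAlgebra.commutant_commutant A.M, VonNeumannAlgebra.mem_commutant_iff] at h1
      exact ⟨h1 b hb, h1 _ (star_mem hb)⟩
    · refine ⟨h2 g, ?_⟩
      have h3 : star ((π g : A.Elem) : A.H →L[ℂ] A.H) =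
          ((π g⁻¹ : A.Elem) : A.H →L[ℂ] A.H) := by
        rw [map_inv, ← Unitary.star_eq_inv]; rfl
      change star ((π g : A.Elem) : A.H →L[ℂ] A.H) * a = a * star ((π g : A.Elem) : A.H →L[ℂ] A.H)
      rw [h3]; exact h2 g⁻¹

theorem relCommutant_le (π : G →* A.U) : relCommutant π ≤ A.M :=
  fun _ ha => (mem_relCommutant.1 ha).1

/-- The image in `L²(A, τ)` of the unit ball of `A` is closed. -/
theorem isClosed_toL2_ball (A : TracialVNA.{v}) :
    IsClosed (A.toL2 '' {a | ‖(a : A.H →L[ℂ] A.H)‖ ≤ 1}) := by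
  refine isClosed_of_closure_subset fun ζ hζ => ?_
  obtain ⟨z, hz, hlim⟩ := mem_closure_iff_seq_limit.1 hζ
  choose a ha hza using hz
  obtain rfl : (fun n => A.toL2 (a n)) = z := funext hza
  -- Let y be a weak limit of the a n along an ultrafilter, which exists in the compact ball.
  -- Pairings with elements of A are weakly continuous on the ball, so y and ζ have the same inner
  -- products with the dense image of A.
  set U : Ultrafilter (A.H → A.H → ℂ) := (hyperfilter ℕ).map fun n => opForm (a n).1 with hU
  obtain ⟨s, ⟨y, ⟨hyM, hy⟩, rfl⟩, hs⟩ := (isCompact_ballForms A.M).ultrafilter_le_nhds' U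
    (Ultrafilter.mem_map.2 (Filter.univ_mem' fun n => ⟨_, ⟨(a n).2, ha n⟩, rfl⟩))
  have hs' : Tendsto (fun n => opForm (a n).1) (hyperfilter ℕ) (𝓝[ballForms A.M] (opForm y)) :=
    tendsto_nhdsWithin_iff.2 ⟨hs, Filter.Eventually.of_forall fun n => ⟨_, ⟨(a n).2, ha n⟩, rfl⟩⟩
  set y' : A.Elem := ⟨y, hyM⟩ with hy'
  refine ⟨y', hy, ?_⟩
  have h1 : ∀ w : A.Elem, ‖w.1‖ ≤ 1 → ⟪A.toL2 w, A.toL2 y'⟫_ℂ = ⟪A.toL2 w, ζ⟫_ℂ := by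
    intro w hw
    obtain ⟨f, hfc, hf⟩ := exists_continuousOn_star_mul A.isState w hw
    have h2 := (hfc _ ⟨y, ⟨hyM, hy⟩, rfl⟩).tendsto.comp hs'
    have h3 : Tendsto (fun n => ⟪A.toL2 w, A.toL2 (a n)⟫_ℂ) (hyperfilter ℕ)
        (𝓝 ⟪A.toL2 w, ζ⟫_ℂ) :=
      (tendsto_const_nhds.inner hlim).mono_left (by
        rw [← Nat.cofinite_eq_atTop]; exact hyperfilter_le_cofinite)
    refine tendsto_nhds_unique ?_ h3
    refine (h2.congr fun n => ?_).trans (by rw [inner_toL2, ← hf])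
    rw [Function.comp_apply, hf, inner_toL2]
  have h2 : ∀ ξ : A.L2, ⟪ξ, A.toL2 y' - ζ⟫_ℂ = 0 := by
    refine A.L2_induction (isClosed_eq (by fun_prop) continuous_const) fun w => ?_
    have hn : 0 < ‖w.1‖ + 1 := by positivity
    have h3 := h1 ((((‖w.1‖ + 1)⁻¹ : ℝ) : ℂ) • w) (by
      change ‖(((‖w.1‖ + 1)⁻¹ : ℝ) : ℂ) • w.1‖ ≤ 1
      rw [norm_smul, Complex.norm_real, norm_inv, Real.norm_of_nonneg hn.le, inv_mul_le_one₀ hn]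
      linarith)
    rw [map_smul, inner_smul_left, inner_smul_left] at h3
    rw [inner_sub_right, sub_eq_zero]
    refine mul_left_cancel₀ ?_ h3
    simpa using Complex.ofReal_ne_zero.2 hn.ne'
  exact sub_eq_zero.1 (inner_self_eq_zero.1 (h2 _))

/-- Every unitary `x` in `A` is close to a unitary in the commutant of `π`, at a distance controlled
by the distance in `L²(A, τ)` from `x` to the vectors fixed by conjugation. -/
theorem exists_unitary_mem_relCommutant (π : G →* A.U) (x : A.U) :
    ∃ u : A.U, ((u : A.Elem) : A.H →L[ℂ] A.H) ∈ relCommutant π ∧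
      A.normSq ((x : A.Elem) - (u : A.Elem)) ≤
        2 * ‖A.toL2 x - (invariantVectors (conjRep π)).starProjection (A.toL2 x)‖ ^ 2 := by
  have hball : ∀ u : A.U, ‖((u : A.Elem) : A.H →L[ℂ] A.H)‖ ≤ 1 := fun u =>
    unitary_opNorm_le ⟨_, Unitary.mem_iff.2 ⟨congrArg Subtype.val (Unitary.star_mul_self_of_mem u.2),
      congrArg Subtype.val (Unitary.mul_star_self_of_mem u.2)⟩⟩
  -- The projection of x onto the invariant vectors is represented by an operator y of norm at most
  -- 1. Invariance under conjugation will say that y commutes with π.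
  obtain ⟨y, hy, hPy⟩ := starProjection_invariantVectors_mem (conjRep π) A.isClosed_toL2_ball
    (by
      rintro _ ⟨a, ha, rfl⟩ _ ⟨b, hb, rfl⟩ s t hs ht hst
      refine ⟨(s : ℂ) • a + (t : ℂ) • b, ?_, ?_⟩
      · change ‖(s : ℂ) • a.1 + (t : ℂ) • b.1‖ ≤ 1
        refine (norm_add_le _ _).trans ?_
        rw [norm_smul, norm_smul, Complex.norm_real, Complex.norm_real, Real.norm_of_nonneg hs,
          Real.norm_of_nonneg ht, ← hst]
        have ha' : ‖a.1‖ ≤ 1 := ha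
        have hb' : ‖b.1‖ ≤ 1 := hb
        nlinarith
      · rw [map_add, map_smul, map_smul]; rfl)
    (by
      rintro g _ ⟨a, ha, rfl⟩
      refine ⟨_, ?_, (conjRep_toL2 π g a).symm⟩
      change ‖((π g : A.Elem) : A.H →L[ℂ] A.H) * a.1 * star ((π g : A.Elem) : A.H →L[ℂ] A.H)‖ ≤ 1
      have ha' : ‖a.1‖ ≤ 1 := ha
      refine (norm_mul_le _ _).trans (mul_le_one₀ ((norm_mul_le _ _).trans (mul_le_one₀ (hball _)
        (norm_nonneg _) ha')) (norm_nonneg _) ?_)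
      rw [norm_star]; exact hball _)
    ⟨x, hball x, rfl⟩
  set P := (invariantVectors (conjRep π)).starProjection with hP
  have hyN : y.1 ∈ relCommutant π := by
    refine mem_relCommutant.2 ⟨y.2, fun g => ?_⟩
    have h1 : P (A.toL2 x) ∈ invariantVectors (conjRep π) := Submodule.starProjection_apply_mem _ _
    rw [← hPy] at h1
    have h2 : (π g : A.Elem) * y * star (π g : A.Elem) = y :=
      A.toL2_injective ((conjRep_toL2 π g y).symm.trans (mem_invariantVectors.1 h1 g))
    have h3 : (π g : A.Elem) * y = y * (π g : A.Elem) := by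
      conv_rhs => rw [← h2, mul_assoc, Unitary.coe_star_mul_self, mul_one]
    exact congrArg Subtype.val h3
  obtain ⟨u, hu, hmax⟩ := exists_unitary_maximizer (relCommutant_le π) A.isState x.1 (hball x)
  have e1 : star u.1 * u.1 = 1 := congrArg Subtype.val (Unitary.mem_iff.1 hu).1
  have e2 : u.1 * star u.1 = 1 := congrArg Subtype.val (Unitary.mem_iff.1 hu).2
  set u' : A.U := ⟨⟨u.1, relCommutant_le π u.2⟩, Unitary.mem_iff.2
    ⟨Subtype.ext e1, Subtype.ext e2⟩⟩ with hu'
  refine ⟨u', u.2, ?_⟩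
  -- Maximality of u is tested against y. Since x and u have 2-norm 1, ‖x - u‖₂² = 2 - 2 Re⟨x, u⟩ ≤
  -- 2 - 2 ‖P x‖² = 2 ‖x - P x‖².
  have h1 : (⟪A.toL2 x, P (A.toL2 x)⟫_ℂ).re ≤ (⟪A.toL2 x, A.toL2 u'⟫_ℂ).re := by
    rw [← hPy, inner_toL2, inner_toL2]
    exact hmax ⟨y.1, hyN⟩ hy
  have h2 : ‖A.toL2 x‖ ^ 2 = 1 := by rw [norm_toL2_sq, normSq_unitary]
  have h3 : ‖A.toL2 u'‖ ^ 2 = 1 := by rw [norm_toL2_sq, normSq_unitary]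
  have h4 : (⟪A.toL2 x, P (A.toL2 x)⟫_ℂ).re = ‖P (A.toL2 x)‖ ^ 2 := by
    have h5 : P (P (A.toL2 x)) = P (A.toL2 x) :=
      Submodule.starProjection_eq_self_iff.2 (Submodule.starProjection_apply_mem _ _)
    rw [← h5, ← Submodule.inner_starProjection_left_eq_right, h5]
    exact inner_self_eq_norm_sq (𝕜 := ℂ) _
  rw [← norm_toL2_sq, map_sub, norm_sub_sq (𝕜 := ℂ), norm_sub_sq (𝕜 := ℂ), h2, h3]
  simp only [RCLike.re_to_complex]
  linarith

end TracialVNA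

/-! ### Means of bounded functions -/

/-- A function is bounded. -/
def IsBoundedFun {α : Type*} (f : α → ℝ) : Prop := ∃ C, ∀ x, |f x| ≤ C

namespace IsBoundedFun

variable {α : Type*} {f g : α → ℝ}

theorem add (hf : IsBoundedFun f) (hg : IsBoundedFun g) : IsBoundedFun fun x => f x + g x := by
  obtain ⟨C, hC⟩ := hf
  obtain ⟨D, hD⟩ := hg
  exact ⟨C + D, fun x => (abs_add_le _ _).trans (add_le_add (hC x) (hD x))⟩

theorem const_mul (c : ℝ) (hf : IsBoundedFun f) : IsBoundedFun fun x => c * f x := by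
  obtain ⟨C, hC⟩ := hf
  exact ⟨|c| * C, fun x => by rw [abs_mul]; gcongr; exact hC x⟩

theorem const (c : ℝ) : IsBoundedFun fun _ : α => c := ⟨|c|, fun _ => le_rfl⟩

theorem of_nonneg {C : ℝ} (h0 : ∀ x, 0 ≤ f x) (hC : ∀ x, f x ≤ C) : IsBoundedFun f :=
  ⟨C, fun x => by rw [abs_of_nonneg (h0 x)]; exact hC x⟩

theorem comp {β : Type*} (hf : IsBoundedFun f) (i : β → α) : IsBoundedFun fun x => f (i x) := by
  obtain ⟨C, hC⟩ := hf
  exact ⟨C, fun x => hC _⟩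

end IsBoundedFun

namespace PMF

variable {α : Type*} {β : Type*} (μ : PMF α) (ν : PMF β)

/-- The integral of a function. -/
def mean (f : α → ℝ) : ℝ := ∑' x, (μ x).toReal * f x

variable {f g : α → ℝ}

theorem summable_mean (hf : IsBoundedFun f) : Summable fun x => (μ x).toReal * f x := by
  obtain ⟨C, hC⟩ := hf
  refine Summable.of_norm_bounded (μ.summable_toReal.mul_right C) fun x => ?_
  rw [norm_mul, Real.norm_of_nonneg ENNReal.toReal_nonneg]
  exact mul_le_mul_of_nonneg_left (hC x) ENNReal.toReal_nonneg

theorem mean_add (hf : IsBoundedFun f) (hg : IsBoundedFun g) :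
    μ.mean (fun x => f x + g x) = μ.mean f + μ.mean g := by
  simp only [mean, mul_add]
  exact (μ.summable_mean hf).tsum_add (μ.summable_mean hg)

theorem mean_const_mul (c : ℝ) (f : α → ℝ) : μ.mean (fun x => c * f x) = c * μ.mean f := by
  simp only [mean, ← tsum_mul_left]
  exact tsum_congr fun x => by ring

theorem mean_const (c : ℝ) : μ.mean (fun _ => c) = c := by
  rw [mean, tsum_mul_right, μ.tsum_toReal, one_mul]

theorem mean_mono (hf : IsBoundedFun f) (hg : IsBoundedFun g) (h : ∀ x, f x ≤ g x) :
    μ.mean f ≤ μ.mean g :=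
  (μ.summable_mean hf).tsum_le_tsum
    (fun x => mul_le_mul_of_nonneg_left (h x) ENNReal.toReal_nonneg) (μ.summable_mean hg)

theorem mean_nonneg (h : ∀ x, 0 ≤ f x) : 0 ≤ μ.mean f :=
  tsum_nonneg fun x => mul_nonneg ENNReal.toReal_nonneg (h x)

theorem abs_mean_le {C : ℝ} (h : ∀ x, |f x| ≤ C) : |μ.mean f| ≤ C := by
  have hf : IsBoundedFun f := ⟨C, h⟩
  rw [abs_le]
  constructor
  · calc -C = μ.mean fun _ => -C := (μ.mean_const _).symm
      _ ≤ _ := μ.mean_mono (.const _) hf fun x => (abs_le.1 (h x)).1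
  · calc _ ≤ μ.mean fun _ => C := μ.mean_mono hf (.const _) fun x => (abs_le.1 (h x)).2
      _ = C := μ.mean_const _

theorem isBoundedFun_mean {F : α × β → ℝ} (hF : IsBoundedFun F) :
    IsBoundedFun fun x => ν.mean fun y => F (x, y) := by
  obtain ⟨C, hC⟩ := hF
  exact ⟨C, fun x => ν.abs_mean_le fun y => hC _⟩

theorem mean_comm {F : α × β → ℝ} (hF : IsBoundedFun F) :
    μ.mean (fun x => ν.mean fun y => F (x, y)) = ν.mean (fun y => μ.mean fun x => F (x, y)) := by
  obtain ⟨C, hC⟩ := hF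
  have hs : Summable fun p : α × β => (μ p.1).toReal * ((ν p.2).toReal * F p) := by
    have h1 : Summable fun p : α × β => (μ p.1).toReal * (ν p.2).toReal :=
      μ.summable_toReal.mul_of_nonneg ν.summable_toReal (fun _ => ENNReal.toReal_nonneg)
        (fun _ => ENNReal.toReal_nonneg)
    refine Summable.of_norm_bounded (h1.mul_right C) fun p => ?_
    rw [← mul_assoc, norm_mul, Real.norm_of_nonneg
      (mul_nonneg ENNReal.toReal_nonneg ENNReal.toReal_nonneg)]
    exact mul_le_mul_of_nonneg_left (hC p) (mul_nonneg ENNReal.toReal_nonneg ENNReal.toReal_nonneg)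
  simp only [mean, ← tsum_mul_left]
  rw [← Summable.tsum_comm (f := fun x y => (μ x).toReal * ((ν y).toReal * F (x, y))) hs]
  exact tsum_congr fun y => tsum_congr fun x => by ring

end PMF

/-! ### The averaged measure -/

section Averaged

variable {G₁ : Type u₁} {G₂ : Type u₂} [Group G₁] [Group G₂] (μ₁ : PMF G₁) (μ₂ : PMF G₂)

open Classical in
theorem averagedMeasure_apply (p : G₁ × G₂) : averagedMeasure μ₁ μ₂ p =
    2⁻¹ * ((if p.2 = 1 then μ₁ p.1 else 0) + (if p.1 = 1 then μ₂ p.2 else 0)) := rfl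

theorem mean_averagedMeasure {f : G₁ × G₂ → ℝ} (hf : IsBoundedFun f) :
    (averagedMeasure μ₁ μ₂).mean f =
      2⁻¹ * (μ₁.mean (fun x => f (x, 1)) + μ₂.mean (fun y => f (1, y))) := by
  classical
  have h1 : HasSum (fun p : G₁ × G₂ => (if p.2 = 1 then (μ₁ p.1).toReal else 0) * f p)
      (μ₁.mean fun x => f (x, 1)) := by
    have hi : Function.Injective fun x : G₁ => (x, (1 : G₂)) := fun x y h => (Prod.ext_iff.1 h).1
    refine (hi.hasSum_iff ?_).1 ?_
    · rintro ⟨x, y⟩ hp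
      have : y ≠ 1 := fun h => hp ⟨x, by rw [h]⟩
      simp [this]
    · have := (μ₁.summable_mean (hf.comp fun x => (x, (1 : G₂)))).hasSum
      simpa [Function.comp_def, PMF.mean] using this
  have h2 : HasSum (fun p : G₁ × G₂ => (if p.1 = 1 then (μ₂ p.2).toReal else 0) * f p)
      (μ₂.mean fun y => f (1, y)) := by
    have hi : Function.Injective fun y : G₂ => ((1 : G₁), y) := fun x y h => (Prod.ext_iff.1 h).2
    refine (hi.hasSum_iff ?_).1 ?_
    · rintro ⟨x, y⟩ hp
      have : x ≠ 1 := fun h => hp ⟨y, by rw [h]⟩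
      simp [this]
    · have := (μ₂.summable_mean (hf.comp fun y => ((1 : G₁), y))).hasSum
      simpa [Function.comp_def, PMF.mean] using this
  rw [← ((h1.add h2).mul_left (2⁻¹ : ℝ)).tsum_eq, PMF.mean]
  refine tsum_congr fun p => ?_
  rw [averagedMeasure_apply, ENNReal.toReal_mul, ENNReal.toReal_add]
  · rw [apply_ite ENNReal.toReal, apply_ite ENNReal.toReal]
    simp only [ENNReal.toReal_inv, ENNReal.toReal_ofNat, ENNReal.toReal_zero]
    ring
  · split_ifs
    · exact μ₁.apply_ne_top _
    · simp
  · split_ifs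
    · exact μ₂.apply_ne_top _
    · simp

variable {μ₁ μ₂}

theorem hasGeneratingSupport_averagedMeasure (h₁ : HasGeneratingSupport μ₁)
    (h₂ : HasGeneratingSupport μ₂) : HasGeneratingSupport (averagedMeasure μ₁ μ₂) := by
  set S := Subgroup.closure (averagedMeasure μ₁ μ₂).support with hS
  have e1 : ∀ x, (x, (1 : G₂)) ∈ S := by
    have : Subgroup.closure μ₁.support ≤ S.comap (MonoidHom.inl G₁ G₂) := by
      refine (Subgroup.closure_le _).2 fun x hx => Subgroup.subset_closure ?_
      rw [PMF.mem_support_iff] at hx ⊢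
      simp [averagedMeasure_apply, hx]
    rw [h₁] at this
    exact fun x => this (Subgroup.mem_top x)
  have e2 : ∀ y, ((1 : G₁), y) ∈ S := by
    have : Subgroup.closure μ₂.support ≤ S.comap (MonoidHom.inr G₁ G₂) := by
      refine (Subgroup.closure_le _).2 fun x hx => Subgroup.subset_closure ?_
      rw [PMF.mem_support_iff] at hx ⊢
      simp [averagedMeasure_apply, hx]
    rw [h₂] at this
    exact fun x => this (Subgroup.mem_top x)
  refine Subgroup.eq_top_iff' _ |>.2 fun p => ?_
  have := S.mul_mem (e1 p.1) (e2 p.2)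
  simpa using this

end Averaged

/-! ### Almost homomorphisms on a product -/

namespace TracialVNA

variable {A : TracialVNA.{v}}

/-! ### Estimates for defects and commutators of unitaries -/

theorem normSq_add_three_le (x y z : A.Elem) :
    A.normSq (x + y + z) ≤ 3 * (A.normSq x + A.normSq y + A.normSq z) := by
  simp only [← norm_toL2_sq, map_add]
  have h1 := (norm_add_le (A.toL2 x + A.toL2 y) (A.toL2 z)).trans
    (add_le_add_left (norm_add_le (A.toL2 x) (A.toL2 y)) _)
  nlinarith [sq_nonneg (‖A.toL2 x‖ - ‖A.toL2 y‖), sq_nonneg (‖A.toL2 x‖ - ‖A.toL2 z‖),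
    sq_nonneg (‖A.toL2 y‖ - ‖A.toL2 z‖), norm_nonneg (A.toL2 x + A.toL2 y + A.toL2 z)]

theorem normSq_add_four_le (x y z w : A.Elem) :
    A.normSq (x + y + z + w) ≤ 4 * (A.normSq x + A.normSq y + A.normSq z + A.normSq w) := by
  have h1 := normSq_add_le (x + y) (z + w)
  have h2 := normSq_add_le x y
  have h3 := normSq_add_le z w
  rw [← add_assoc] at h1
  linarith

theorem normSq_sub_unitary_le (u w : A.U) : A.normSq ((u : A.Elem) - (w : A.Elem)) ≤ 4 := by
  have := normSq_add_le (u : A.Elem) (-(w : A.Elem))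
  rw [normSq_neg, normSq_unitary, normSq_unitary, ← sub_eq_add_neg] at this
  linarith

theorem normSq_sub_mul_unitary_le (u w z : A.U) :
    A.normSq ((u : A.Elem) - (w : A.Elem) * (z : A.Elem)) ≤ 4 :=
  normSq_sub_unitary_le u (w * z)

/-- `‖[u, x]‖₂²`. -/
def commSq (u x : A.U) : ℝ :=
  A.normSq ((u : A.Elem) * (x : A.Elem) - (x : A.Elem) * (u : A.Elem))

theorem commSq_nonneg (u x : A.U) : 0 ≤ commSq u x := normSq_nonneg _

theorem commSq_le_four (u x : A.U) : commSq u x ≤ 4 := normSq_sub_unitary_le (u * x) (x * u)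

theorem normSq_commutator_le (u : A.U) (x : A.Elem) :
    A.normSq ((u : A.Elem) * x - x * (u : A.Elem)) ≤ 4 * A.normSq x := by
  have := normSq_add_le ((u : A.Elem) * x) (-(x * (u : A.Elem)))
  rw [normSq_neg, normSq_unitary_mul, normSq_mul_unitary, ← sub_eq_add_neg] at this
  linarith

/-- The Leibniz rule [u, x y] = [u, x] y + x [u, y], plus the commutator of u with z - x y. The
latter has squared norm at most 4 ‖z - x y‖₂², and three summands cost a factor 3. -/
theorem commSq_mul_le (u x y z : A.U) :
    commSq u z ≤ 12 * A.normSq ((z : A.Elem) - (x : A.Elem) * (y : A.Elem)) +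
      3 * (commSq u x + commSq u y) := by
  have h : (u : A.Elem) * z - z * u =
      ((u : A.Elem) * (z - x * y) - (z - x * y) * u) + ((u : A.Elem) * x - x * u) * y +
        (x : A.Elem) * (u * y - y * u) := by noncomm_ring
  have h1 := normSq_add_three_le (A := A) ((u : A.Elem) * (z - x * y) - (z - x * y) * u)
    (((u : A.Elem) * x - x * u) * y) ((x : A.Elem) * (u * y - y * u))
  rw [← h, normSq_mul_unitary, normSq_unitary_mul] at h1
  have h2 := normSq_commutator_le (A := A) u ((z : A.Elem) - x * y)
  simp only [commSq] at *
  linarith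

/-- Meant for z = φ(g, h), u = φ(g, 1), x = φ(1, h) and u' = π₁(g): both u x and x u are close to z,
and replacing u by u' costs the commutator of x with u' - u. -/
theorem commSq_perturb_le (u u' x z : A.U) :
    commSq u' x ≤ 4 * A.normSq ((z : A.Elem) - (u : A.Elem) * (x : A.Elem)) +
      4 * A.normSq ((z : A.Elem) - (x : A.Elem) * (u : A.Elem)) +
      8 * A.normSq ((u : A.Elem) - (u' : A.Elem)) := by
  have h : (u' : A.Elem) * x - x * u' =
      ((z : A.Elem) - x * u + -((z : A.Elem) - u * x)) +
        (((u' : A.Elem) - u) * x - x * ((u' : A.Elem) - u)) := by noncomm_ring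
  have h1 := normSq_add_le (A := A) ((z : A.Elem) - x * u + -((z : A.Elem) - u * x))
    (((u' : A.Elem) - u) * x - x * ((u' : A.Elem) - u))
  have h2 := normSq_add_le (A := A) ((z : A.Elem) - x * u) (-((z : A.Elem) - u * x))
  have h3 := normSq_commutator_le (A := A) x ((u' : A.Elem) - u)
  rw [← h] at h1
  rw [normSq_neg] at h2
  rw [normSq_sub_comm (u : A.Elem)]
  have h4 : A.normSq (((u' : A.Elem) - u) * x - x * ((u' : A.Elem) - u)) ≤
      4 * A.normSq ((u' : A.Elem) - u) := by rw [normSq_sub_comm]; exact h3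
  simp only [commSq]
  linarith

/-- Telescoping transfers the multiplicative defect from φ(1, ·) to nearby unitaries. -/
theorem normSq_defect_le (x y z x' y' z' : A.U) :
    A.normSq ((z' : A.Elem) - (x' : A.Elem) * (y' : A.Elem)) ≤
      4 * (A.normSq ((z : A.Elem) - (z' : A.Elem)) +
        A.normSq ((z : A.Elem) - (x : A.Elem) * (y : A.Elem)) +
        A.normSq ((x : A.Elem) - (x' : A.Elem)) + A.normSq ((y : A.Elem) - (y' : A.Elem))) := by
  have h : (z' : A.Elem) - x' * y' = ((z' : A.Elem) - z) + (z - x * y) + ((x : A.Elem) - x') * y +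
      (x' : A.Elem) * (y - y') := by noncomm_ring
  have h1 := normSq_add_four_le (A := A) ((z' : A.Elem) - z) ((z : A.Elem) - x * y)
    (((x : A.Elem) - x') * y) ((x' : A.Elem) * (y - y'))
  rw [← h, normSq_mul_unitary, normSq_unitary_mul, normSq_sub_comm (z' : A.Elem) z] at h1
  exact h1

/-- The inclusion of the unitary group of a subalgebra. -/
def inclU (A : TracialVNA.{v}) (N : VonNeumannAlgebra A.H) (h : N ≤ A.M) :
    (A.restrict N h).U →* A.U where
  toFun u := ⟨⟨u.1.1, h u.1.2⟩, Unitary.mem_iff.2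
    ⟨Subtype.ext (congrArg Subtype.val (Unitary.mem_iff.1 u.2).1 :),
     Subtype.ext (congrArg Subtype.val (Unitary.mem_iff.1 u.2).2 :)⟩⟩
  map_one' := rfl
  map_mul' _ _ := rfl

end TracialVNA

open TracialVNA

variable {G : Type u} [Group G] {A : TracialVNA.{v}}

/-- The factor 2 from `exists_unitary_mem_relCommutant` cancels the 1/2 in `spectralGap_inequality`.
-/
theorem exists_unitary_of_spectralGap {μ : PMF G} (hμ : HasGeneratingSupport μ)
    (hκ : kappa.{u, v} μ ≠ ∞) (π : G →* A.U) (x : A.U) :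
    ∃ u : A.U, ((u : A.Elem) : A.H →L[ℂ] A.H) ∈ relCommutant π ∧
      A.normSq ((x : A.Elem) - (u : A.Elem)) ≤
        (kappa.{u, v} μ).toReal * μ.mean fun g => commSq (π g) x := by
  obtain ⟨u, hu, h⟩ := exists_unitary_mem_relCommutant π x
  refine ⟨u, hu, h.trans ?_⟩
  have := spectralGap_inequality hμ hκ (conjRep π) (A.toL2 x)
  simp only [norm_conjRep_sub_sq] at this
  simp only [PMF.mean, commSq]
  linarith

theorem isAlmostHom_iff {ε : ℝ} {μ : PMF G} {φ : G → A.U} : IsAlmostHom A ε μ φ ↔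
    (μ.mean fun g => μ.mean fun h =>
      A.normSq ((φ (g * h) : A.Elem) - (φ g : A.Elem) * (φ h : A.Elem))) ≤ ε := by
  simp only [IsAlmostHom, PMF.mean, mul_assoc, tsum_mul_left]

theorem isAlmostHom_four {μ : PMF G} {φ : G → A.U} : IsAlmostHom A 4 μ φ :=
  isAlmostHom_iff.2 <| (le_abs_self _).trans <| μ.abs_mean_le fun g => μ.abs_mean_le fun h => by
    rw [abs_of_nonneg (normSq_nonneg _)]
    exact normSq_sub_mul_unitary_le _ _ _

/-- The defect of any unitary-valued map is at most 4, so capping ε at 4 loses nothing and keeps the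
argument in the domain of δ. -/
theorem IsStabilityFunction.close_min {𝒞 : Set TracialVNA.{v}} {μ : PMF G} {δ : ℝ → ℝ}
    (hδ : IsStabilityFunction 𝒞 μ δ) (hA : A ∈ 𝒞) {ε : ℝ} (hε : 0 ≤ ε) {φ : G → A.U}
    (hφ : IsAlmostHom A ε μ φ) : ∃ π : G →* A.U, distSq A μ φ π ≤ δ (min 4 ε) := by
  refine hδ.close A hA _ ⟨le_min (by norm_num) hε, min_le_left _ _⟩ φ ?_
  rcases min_cases 4 ε with h | h <;> rw [h.1]
  · exact isAlmostHom_four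
  · exact hφ

theorem isBoundedFun_normSq_sub {α : Type*} (f g h : α → A.U) : IsBoundedFun fun x =>
    A.normSq ((f x : A.Elem) - (g x : A.Elem) * (h x : A.Elem)) :=
  .of_nonneg (fun _ => normSq_nonneg _) fun _ => normSq_sub_mul_unitary_le _ _ _

theorem isBoundedFun_normSq_sub' {α : Type*} (f g : α → A.U) : IsBoundedFun fun x =>
    A.normSq ((f x : A.Elem) - (g x : A.Elem)) :=
  .of_nonneg (fun _ => normSq_nonneg _) fun _ => normSq_sub_unitary_le _ _

theorem isBoundedFun_commSq {α : Type*} (f g : α → A.U) : IsBoundedFun fun x =>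
    commSq (f x) (g x) :=
  .of_nonneg (fun _ => commSq_nonneg _ _) fun _ => commSq_le_four _ _

section Product

variable {G₁ : Type u₁} {G₂ : Type u₂} [Group G₁] [Group G₂] {μ₁ : PMF G₁} {μ₂ : PMF G₂}

/-- The averaged measure gives weight 1/2 to each axis, so the double integral is a quarter of the
sum of four integrals, one for each ordered pair of axes. Fubini reorders the third. -/
theorem isAlmostHom_averagedMeasure {ε : ℝ} {φ : G₁ × G₂ → A.U}
    (h : IsAlmostHom A ε (averagedMeasure μ₁ μ₂) φ) :
    (μ₁.mean fun g => μ₁.mean fun h => A.normSq ((φ (g * h, 1) : A.Elem) - φ (g, 1) * φ (h, 1))) +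
    (μ₁.mean fun g => μ₂.mean fun h => A.normSq ((φ (g, h) : A.Elem) - φ (g, 1) * φ (1, h))) +
    ((μ₁.mean fun g => μ₂.mean fun h => A.normSq ((φ (g, h) : A.Elem) - φ (1, h) * φ (g, 1))) +
    (μ₂.mean fun g => μ₂.mean fun h => A.normSq ((φ (1, g * h) : A.Elem) - φ (1, g) * φ (1, h)))) ≤
      4 * ε := by
  rw [isAlmostHom_iff] at h
  have hF : IsBoundedFun fun p : (G₁ × G₂) × (G₁ × G₂) =>
      A.normSq ((φ (p.1 * p.2) : A.Elem) - φ p.1 * φ p.2) := isBoundedFun_normSq_sub _ _ _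
  have h1 : ∀ p, ((averagedMeasure μ₁ μ₂).mean fun q =>
      A.normSq ((φ (p * q) : A.Elem) - φ p * φ q)) =
      2⁻¹ * ((μ₁.mean fun x => A.normSq ((φ (p * (x, 1)) : A.Elem) - φ p * φ (x, 1))) +
        μ₂.mean fun y => A.normSq ((φ (p * (1, y)) : A.Elem) - φ p * φ (1, y))) :=
    fun p => mean_averagedMeasure _ _ (isBoundedFun_normSq_sub _ _ _)
  have b1 : IsBoundedFun fun p : G₁ × G₂ =>
      μ₁.mean fun x => A.normSq ((φ (p * (x, 1)) : A.Elem) - φ p * φ (x, 1)) :=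
    μ₁.isBoundedFun_mean (hF.comp fun q : (G₁ × G₂) × G₁ => (q.1, (q.2, 1)))
  have b2 : IsBoundedFun fun p : G₁ × G₂ =>
      μ₂.mean fun y => A.normSq ((φ (p * (1, y)) : A.Elem) - φ p * φ (1, y)) :=
    μ₂.isBoundedFun_mean (hF.comp fun q : (G₁ × G₂) × G₂ => (q.1, (1, q.2)))
  simp only [h1] at h
  rw [PMF.mean_const_mul, PMF.mean_add _ b1 b2, mean_averagedMeasure _ _ b1,
    mean_averagedMeasure _ _ b2] at h
  simp only [Prod.mk_mul_mk, one_mul, mul_one] at h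
  have h2 := μ₂.mean_comm μ₁ (F := fun p : G₂ × G₁ =>
    A.normSq ((φ (p.2, p.1) : A.Elem) - φ (1, p.1) * φ (p.2, 1))) (isBoundedFun_normSq_sub _ _ _)
  simp only at h2
  rw [h2] at h
  linarith

/-- The estimate behind the stability of products. -/
theorem exists_hom_of_isAlmostHom_prod {𝒞 : Set TracialVNA.{v}} (h𝒞 : ClosedUnderSubalgebras 𝒞)
    (hμ₁ : HasGeneratingSupport μ₁) (hκ : kappa.{u₁, v} μ₁ ≠ ∞) {δ₁ δ₂ : ℝ → ℝ}
    (hδ₁ : IsStabilityFunction 𝒞 μ₁ δ₁) (hδ₂ : IsStabilityFunction 𝒞 μ₂ δ₂) (hA : A ∈ 𝒞)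
    {ε : ℝ} (hε : 0 ≤ ε) {φ : G₁ × G₂ → A.U} (hφ : IsAlmostHom A ε (averagedMeasure μ₁ μ₂) φ)
    {κ d : ℝ} (hκ' : κ = (kappa.{u₁, v} μ₁).toReal) (hd : d = δ₁ (min 4 (4 * ε))) :
    ∃ π : G₁ × G₂ →* A.U, distSq A (averagedMeasure μ₁ μ₂) φ π ≤
      d / 2 + κ * (16 * ε + 8 * d) + δ₂ (min 4 (4 * (κ * (176 * ε + 64 * d) + 4 * ε))) := by
  have hκ0 : 0 ≤ κ := hκ' ▸ ENNReal.toReal_nonneg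
  have hd0 : 0 ≤ d := hd ▸ (hδ₁.mapsTo ⟨le_min (by norm_num) (by linarith), min_le_left _ _⟩).1
  have hmain := isAlmostHom_averagedMeasure hφ
  have nn := fun x : A.Elem => normSq_nonneg x
  set a := μ₁.mean fun g => μ₁.mean fun h =>
    A.normSq ((φ (g * h, 1) : A.Elem) - φ (g, 1) * φ (h, 1)) with ha
  set b := μ₁.mean fun g => μ₂.mean fun h =>
    A.normSq ((φ (g, h) : A.Elem) - φ (g, 1) * φ (1, h)) with hb
  set b' := μ₁.mean fun g => μ₂.mean fun h =>
    A.normSq ((φ (g, h) : A.Elem) - φ (1, h) * φ (g, 1)) with hb'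
  set c := μ₂.mean fun g => μ₂.mean fun h =>
    A.normSq ((φ (1, g * h) : A.Elem) - φ (1, g) * φ (1, h)) with hc
  have ha0 : 0 ≤ a := PMF.mean_nonneg _ fun _ => PMF.mean_nonneg _ fun _ => nn _
  have hb0 : 0 ≤ b := PMF.mean_nonneg _ fun _ => PMF.mean_nonneg _ fun _ => nn _
  have hb0' : 0 ≤ b' := PMF.mean_nonneg _ fun _ => PMF.mean_nonneg _ fun _ => nn _
  have hc0 : 0 ≤ c := PMF.mean_nonneg _ fun _ => PMF.mean_nonneg _ fun _ => nn _
  obtain ⟨π₁, hπ₁⟩ := hδ₁.close_min hA (ε := 4 * ε) (φ := fun g => φ (g, 1)) (by linarith)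
    (isAlmostHom_iff.2 (by linarith))
  rw [← hd] at hπ₁
  replace hπ₁ : (μ₁.mean fun g => A.normSq ((φ (g, 1) : A.Elem) - π₁ g)) ≤ d := hπ₁
  -- K(h) is the mean squared commutator of φ(1, h) with π₁. The mixed integrals b, b' and the
  -- distance d from π₁ bound its μ₂-mean by 4 (b + b') + 8 d ≤ 16 ε + 8 d.
  set K : G₂ → ℝ := fun h => μ₁.mean fun g => commSq (π₁ g) (φ (1, h)) with hK
  have hKb : IsBoundedFun K := μ₁.isBoundedFun_mean
    (F := fun p : G₂ × G₁ => commSq (π₁ p.2) (φ (1, p.1))) (isBoundedFun_commSq _ _)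
  have hKm : μ₂.mean K ≤ 16 * ε + 8 * d := by
    have e1 : μ₂.mean K = μ₁.mean fun g => μ₂.mean fun h => commSq (π₁ g) (φ (1, h)) :=
      μ₂.mean_comm μ₁ (F := fun p : G₂ × G₁ => commSq (π₁ p.2) (φ (1, p.1)))
        (isBoundedFun_commSq _ _)
    have B1 : IsBoundedFun fun p : G₁ × G₂ =>
        A.normSq ((φ (p.1, p.2) : A.Elem) - φ (p.1, 1) * φ (1, p.2)) := isBoundedFun_normSq_sub _ _ _
    have B2 : IsBoundedFun fun p : G₁ × G₂ =>
        A.normSq ((φ (p.1, p.2) : A.Elem) - φ (1, p.2) * φ (p.1, 1)) := isBoundedFun_normSq_sub _ _ _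
    have B3 : IsBoundedFun fun g : G₁ => A.normSq ((φ (g, 1) : A.Elem) - π₁ g) :=
      isBoundedFun_normSq_sub' _ _
    have B1' := μ₂.isBoundedFun_mean B1
    have B2' := μ₂.isBoundedFun_mean B2
    have e2 : ∀ g, (μ₂.mean fun h => commSq (π₁ g) (φ (1, h))) ≤
        4 * (μ₂.mean fun h => A.normSq ((φ (g, h) : A.Elem) - φ (g, 1) * φ (1, h))) +
        4 * (μ₂.mean fun h => A.normSq ((φ (g, h) : A.Elem) - φ (1, h) * φ (g, 1))) +
        8 * A.normSq ((φ (g, 1) : A.Elem) - π₁ g) := by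
      intro g
      have b1 := (B1.comp fun h : G₂ => (g, h)).const_mul 4
      have b2 := (B2.comp fun h : G₂ => (g, h)).const_mul 4
      have b3 : IsBoundedFun fun _ : G₂ => 8 * A.normSq ((φ (g, 1) : A.Elem) - π₁ g) := .const _
      refine (μ₂.mean_mono (isBoundedFun_commSq _ _) ((b1.add b2).add b3)
        fun h => commSq_perturb_le _ _ _ _).trans_eq ?_
      rw [PMF.mean_add _ (b1.add b2) b3, PMF.mean_add _ b1 b2, PMF.mean_const_mul,
        PMF.mean_const_mul, PMF.mean_const]
    have e3 := μ₁.mean_mono (μ₂.isBoundedFun_mean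
      (F := fun p : G₁ × G₂ => commSq (π₁ p.1) (φ (1, p.2))) (isBoundedFun_commSq _ _))
      (((B1'.const_mul 4).add (B2'.const_mul 4)).add (B3.const_mul 8)) e2
    rw [PMF.mean_add _ ((B1'.const_mul 4).add (B2'.const_mul 4)) (B3.const_mul 8),
      PMF.mean_add _ (B1'.const_mul 4) (B2'.const_mul 4), PMF.mean_const_mul,
      PMF.mean_const_mul, PMF.mean_const_mul, ← e1] at e3
    change μ₂.mean K ≤ 4 * b + 4 * b' + 8 * _ at e3
    linarith
  choose ψ hψN hψ using fun h => exists_unitary_of_spectralGap hμ₁ hκ π₁ (φ (1, h))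
  rw [← hκ'] at hψ
  replace hψ : ∀ h, A.normSq ((φ (1, h) : A.Elem) - ψ h) ≤ κ * K h := hψ
  set N := relCommutant π₁ with hN
  have hNM : N ≤ A.M := relCommutant_le π₁
  let ψ' : G₂ → (A.restrict N hNM).U := fun h => ⟨⟨(ψ h).1.1, hψN h⟩, Unitary.mem_iff.2
    ⟨Subtype.ext (congrArg Subtype.val (Unitary.mem_iff.1 (ψ h).2).1 :),
     Subtype.ext (congrArg Subtype.val (Unitary.mem_iff.1 (ψ h).2).2 :)⟩⟩
  have hψ' : IsAlmostHom (A.restrict N hNM) (4 * (κ * (176 * ε + 64 * d) + 4 * ε)) μ₂ ψ' := by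
    rw [isAlmostHom_iff]
    change (μ₂.mean fun g => μ₂.mean fun h =>
      A.normSq ((ψ (g * h) : A.Elem) - ψ g * ψ h)) ≤ _
    have e1 : ∀ g h, A.normSq ((ψ (g * h) : A.Elem) - ψ g * ψ h) ≤
        (4 * (12 * κ + 1)) * A.normSq ((φ (1, g * h) : A.Elem) - φ (1, g) * φ (1, h)) +
          16 * κ * K h + 16 * κ * K g := by
      intro g h
      have f1 := normSq_defect_le (φ (1, g)) (φ (1, h)) (φ (1, g * h)) (ψ g) (ψ h) (ψ (g * h))
      -- The product gh is not distributed according to μ₂, so the mean of K does not control K(gh).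
      -- The Leibniz estimate bounds it pointwise instead. Inserted in f1, it turns 4 κ K(gh) + 4 κ
      -- K(g) + 4 κ K(h) into 16 κ (K(g) + K(h)) plus 48 κ times the defect.
      have f2 : K (g * h) ≤ 12 * A.normSq ((φ (1, g * h) : A.Elem) - φ (1, g) * φ (1, h)) +
          3 * (K g + K h) := by
        have b1 := isBoundedFun_commSq π₁ fun _ => φ (1, g)
        have b2 := isBoundedFun_commSq π₁ fun _ => φ (1, h)
        have b3 : IsBoundedFun fun _ : G₁ =>
          12 * A.normSq ((φ (1, g * h) : A.Elem) - φ (1, g) * φ (1, h)) := .const _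
        refine (μ₁.mean_mono (isBoundedFun_commSq _ _) (b3.add ((b1.add b2).const_mul 3))
          fun g' => commSq_mul_le _ _ _ _).trans_eq ?_
        rw [PMF.mean_add _ b3 ((b1.add b2).const_mul 3), PMF.mean_const, PMF.mean_const_mul,
          PMF.mean_add _ b1 b2]
      have f3 := mul_le_mul_of_nonneg_left f2 hκ0
      have f4 := hψ (g * h)
      have f5 := hψ g
      have f6 := hψ h
      nlinarith
    have B : IsBoundedFun fun p : G₂ × G₂ =>
      A.normSq ((φ (1, p.1 * p.2) : A.Elem) - φ (1, p.1) * φ (1, p.2)) := isBoundedFun_normSq_sub _ _ _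
    have e2 : ∀ g, (μ₂.mean fun h => A.normSq ((ψ (g * h) : A.Elem) - ψ g * ψ h)) ≤
        (4 * (12 * κ + 1)) * (μ₂.mean fun h =>
          A.normSq ((φ (1, g * h) : A.Elem) - φ (1, g) * φ (1, h))) +
          16 * κ * μ₂.mean K + 16 * κ * K g := by
      intro g
      have b1 := (B.comp fun h : G₂ => (g, h)).const_mul (4 * (12 * κ + 1))
      have b2 := hKb.const_mul (16 * κ)
      have b3 : IsBoundedFun fun _ : G₂ => 16 * κ * K g := .const _
      refine (μ₂.mean_mono (isBoundedFun_normSq_sub _ _ _) ((b1.add b2).add b3)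
        (e1 g)).trans_eq ?_
      rw [PMF.mean_add _ (b1.add b2) b3, PMF.mean_add _ b1 b2, PMF.mean_const_mul,
        PMF.mean_const_mul, PMF.mean_const]
    have b1 := (μ₂.isBoundedFun_mean B).const_mul (4 * (12 * κ + 1))
    have b2 : IsBoundedFun fun _ : G₂ => 16 * κ * μ₂.mean K := .const _
    have b3 := hKb.const_mul (16 * κ)
    have e3 := μ₂.mean_mono (μ₂.isBoundedFun_mean (F := fun p : G₂ × G₂ =>
      A.normSq ((ψ (p.1 * p.2) : A.Elem) - ψ p.1 * ψ p.2)) (isBoundedFun_normSq_sub _ _ _))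
      ((b1.add b2).add b3) e2
    rw [PMF.mean_add _ (b1.add b2) b3, PMF.mean_add _ b1 b2, PMF.mean_const, PMF.mean_const_mul,
      PMF.mean_const_mul] at e3
    refine e3.trans ?_
    change 4 * (12 * κ + 1) * c + 16 * κ * μ₂.mean K + 16 * κ * μ₂.mean K ≤ _
    have e4 : 4 * (12 * κ + 1) * c ≤ 4 * (12 * κ + 1) * (4 * ε) := by gcongr; linarith
    have e5 : 16 * κ * μ₂.mean K ≤ 16 * κ * (16 * ε + 8 * d) := by gcongr
    linarith
  -- Stability of G₂ is applied inside the relative commutant, which lies in 𝒞, so the resulting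
  -- homomorphism commutes exactly with π₁.
  obtain ⟨π₂, hπ₂⟩ := hδ₂.close_min (h𝒞 A hA N hNM) (by positivity) hψ'
  set D := δ₂ (min 4 (4 * (κ * (176 * ε + 64 * d) + 4 * ε))) with hD
  set σ : G₂ →* A.U := (A.inclU N hNM).comp π₂ with hσ
  replace hπ₂ : (μ₂.mean fun h => A.normSq ((ψ h : A.Elem) - σ h)) ≤ D := hπ₂
  have hcomm : ∀ g h, Commute (π₁ g) (σ h) := fun g h =>
    Subtype.ext (Subtype.ext ((mem_relCommutant.1 (π₂ h).1.2).2 g))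
  refine ⟨π₁.noncommCoprod σ hcomm, ?_⟩
  change (averagedMeasure μ₁ μ₂).mean (fun p => A.normSq
    ((φ p : A.Elem) - π₁.noncommCoprod σ hcomm p)) ≤ _
  rw [mean_averagedMeasure _ _ (isBoundedFun_normSq_sub' _ _)]
  simp only [MonoidHom.noncommCoprod_apply, map_one, one_mul, mul_one]
  have B1 := hKb.const_mul (2 * κ)
  have B2 : IsBoundedFun fun h => 2 * A.normSq ((ψ h : A.Elem) - σ h) :=
    (isBoundedFun_normSq_sub' _ _).const_mul 2
  have e1 := μ₂.mean_mono (isBoundedFun_normSq_sub' (fun h => φ (1, h)) σ) (B1.add B2) fun h => by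
    have := normSq_add_le (A := A) ((φ (1, h) : A.Elem) - ψ h) ((ψ h : A.Elem) - σ h)
    rw [sub_add_sub_cancel] at this
    have := hψ h
    linarith
  rw [PMF.mean_add _ B1 B2, PMF.mean_const_mul, PMF.mean_const_mul] at e1
  have e2 : 2 * κ * μ₂.mean K ≤ 2 * κ * (16 * ε + 8 * d) := by gcongr
  linarith

end Product

/-! ### A lower bound for the spectral gap constant -/

section Regular

/-- Composition with a permutation, on `ℓ²(X)`. -/
def lpPermute {X : Type v} (e : Equiv.Perm X) :
    lp (fun _ : X => ℂ) 2 →ₗᵢ[ℂ] lp (fun _ : X => ℂ) 2 where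
  toFun f := ⟨fun x => f (e x), by
    refine memℓp_gen ?_
    have := (lp.memℓp f).summable (by norm_num)
    exact e.summable_iff (f := fun x => ‖f x‖ ^ (2 : ℝ≥0∞).toReal) |>.2 this⟩
  map_add' f g := rfl
  map_smul' c f := rfl
  norm_map' f := by
    change ‖(⟨fun x => f (e x), _⟩ : lp (fun _ : X => ℂ) 2)‖ = ‖f‖
    rw [lp.norm_eq_tsum_rpow (by norm_num), lp.norm_eq_tsum_rpow (by norm_num)]
    congr 1
    exact e.tsum_eq fun x => ‖f x‖ ^ (2 : ℝ≥0∞).toReal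

theorem lpPermute_apply {X : Type v} (e : Equiv.Perm X) (f : lp (fun _ : X => ℂ) 2) (x : X) :
    lpPermute e f x = f (e x) := rfl

variable (G : Type u) [Group G] [Small.{v} G]

/-- The left regular representation, on a Hilbert space in a given universe. -/
def regularRep : G →* unitary (lp (fun _ : Shrink.{v} G => ℂ) 2 →L[ℂ]
    lp (fun _ : Shrink.{v} G => ℂ) 2) :=
  unitaryRep
    { toFun := fun g => (lpPermute
        ((equivShrink G).symm.trans ((Equiv.mulLeft g⁻¹).trans (equivShrink G)))).toContinuousLinearMap
      map_one' := by
        ext f x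
        simp [lpPermute_apply]
      map_mul' := fun g h => by
        ext f x
        simp [lpPermute_apply] }
    fun g f => (lpPermute _).norm_map f

theorem exists_regularRep_ne [Nontrivial G] :
    ∃ (g : G) (ξ : lp (fun _ : Shrink.{v} G => ℂ) 2),
      (regularRep.{u, v} G g : _ →L[ℂ] _) ξ ≠ ξ := by
  classical
  obtain ⟨g, hg⟩ := exists_ne (1 : G)
  refine ⟨g, lp.single (E := fun _ : Shrink.{v} G => ℂ) 2 (equivShrink G 1) (1 : ℂ), fun h => ?_⟩
  have h1 := congrArg (fun f : lp (fun _ : Shrink.{v} G => ℂ) 2 => f (equivShrink G 1)) h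
  simp only at h1
  change lp.single (E := fun _ : Shrink.{v} G => ℂ) 2 (equivShrink G 1) (1 : ℂ) (equivShrink G (g⁻¹ * (equivShrink G).symm
    (equivShrink G 1))) = _ at h1
  rw [lp.single_apply_self, Equiv.symm_apply_apply, mul_one, lp.single_apply_ne] at h1
  · exact zero_ne_one h1
  · exact fun h => hg (inv_eq_one.1 ((equivShrink G).injective h))

variable {G}

/-- For k < 1/2 the interval [-1, 1 - 1/k] is empty, so the self-adjoint operator T has spectrum in
{1} and equals 1. -/
theorem mem_invariantVectors_of_lt_half {μ : PMF G} (hμ : HasGeneratingSupport μ)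
    {k : ℝ} (hk : 0 < k) (hlt : k < 1 / 2) (h : IsSpectralGapBound.{u, v} μ k) {K : Type v}
    [NormedAddCommGroup K] [InnerProductSpace ℂ K] [CompleteSpace K]
    (π : G →* unitary (K →L[ℂ] K)) (ξ : K) : ξ ∈ invariantVectors π := by
  set T := averagingOperator μ π with hT
  have hTs : IsSelfAdjoint T := isSelfAdjoint_averagingOperator μ _
  have h1 : T = 1 := by
    rw [← cfc_id' ℝ T, ← cfc_const_one ℝ T]
    refine cfc_congr fun t ht => ?_
    obtain ⟨s, hs, hst⟩ := h _ _ ((spectrum.algebraMap_mem_iff ℂ).2 ht)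
    obtain rfl : s = t := Complex.ofReal_injective hst
    rcases hs with hs | hs
    · have h2 : 2 < 1 / k := by rw [lt_div_iff₀ hk]; linarith
      exact absurd (hs.1.trans hs.2) (by linarith)
    · exact hs
  exact averagingOperator_eq_self hμ _ (by rw [← hT, h1]; rfl)

/-- Otherwise every representation would be trivial, contradicting the regular representation of a
nontrivial group. -/
theorem half_le_of_isSpectralGapBound [Nontrivial G] {μ : PMF G} (hμ : HasGeneratingSupport μ)
    {k : ℝ} (hk : 0 < k) (h : IsSpectralGapBound.{u, v} μ k) : 1 / 2 ≤ k := by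
  by_contra! hlt
  obtain ⟨g, ξ, hne⟩ := exists_regularRep_ne.{u, v} G
  exact hne (mem_invariantVectors_of_lt_half hμ hk hlt h _ ξ g)

/-- Serves to absorb into κ(μ₁) δ₁(ε) the terms that carry no factor κ; for the trivial group κ
would be 0. -/
theorem half_le_kappa [Nontrivial G] {μ : PMF G} (hμ : HasGeneratingSupport μ)
    (hκ : kappa.{u, v} μ ≠ ∞) : 1 / 2 ≤ (kappa.{u, v} μ).toReal := by
  rw [← ENNReal.ofReal_le_iff_le_toReal hκ]
  exact le_iInf fun k => le_iInf fun hk => le_iInf fun h =>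
    ENNReal.ofReal_le_ofReal (half_le_of_isSpectralGapBound hμ hk h)

end Regular

/-! ### Moduli of stability -/

section Moduli

variable {G : Type u} [Group G] {𝒞 : Set TracialVNA.{v}} {μ : PMF G} {δ : ℝ → ℝ}

namespace IsStabilityModulus

/-- The concave graph lies above its chord, and the values at 0 and 4 are at least 0 and equal to 4.
-/
theorem le_apply (h : IsStabilityModulus 𝒞 μ δ) {t : ℝ} (ht : t ∈ Icc (0 : ℝ) 4) : t ≤ δ t := by
  have h0 := (h.mapsTo (show (0 : ℝ) ∈ Icc (0 : ℝ) 4 by norm_num)).1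
  have := h.concaveOn.2 (show (0 : ℝ) ∈ Icc (0 : ℝ) 4 by norm_num)
    (show (4 : ℝ) ∈ Icc (0 : ℝ) 4 by norm_num)
    (show 0 ≤ 1 - t / 4 by linarith [ht.2]) (show 0 ≤ t / 4 by linarith [ht.1]) (by ring)
  simp only [smul_eq_mul, mul_zero, zero_add, h.map_four, div_mul_cancel₀ t four_ne_zero] at this
  nlinarith [ht.2]

/-- Concavity between 0 and c s, with δ(0) ≥ 0, gives δ(s) ≥ δ(c s)/c. -/
theorem apply_mul_le (h : IsStabilityModulus 𝒞 μ δ) {c s : ℝ} (hc : 1 ≤ c) (hs : 0 ≤ s)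
    (hcs : c * s ≤ 4) : δ (c * s) ≤ c * δ s := by
  have hc0 : 0 < c := by linarith
  have h0 := (h.mapsTo (show (0 : ℝ) ∈ Icc (0 : ℝ) 4 by norm_num)).1
  have hc1 : 0 ≤ 1 - 1 / c := by rw [sub_nonneg, div_le_one hc0]; exact hc
  have h2 := h.concaveOn.2 (show (0 : ℝ) ∈ Icc (0 : ℝ) 4 by norm_num)
    (show c * s ∈ Icc (0 : ℝ) 4 from ⟨by positivity, hcs⟩)
    hc1 (show 0 ≤ 1 / c by positivity) (by ring)
  have h3 : (1 / c) • (c * s) = s := by rw [smul_eq_mul]; field_simp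
  rw [h3, smul_zero, zero_add] at h2
  simp only [smul_eq_mul] at h2
  have h4 : 1 / c * δ (c * s) ≤ δ s := by nlinarith
  calc δ (c * s) = c * (1 / c * δ (c * s)) := by field_simp
    _ ≤ c * δ s := by gcongr

/-- Where the cap is active, δ(4) = 4 ≤ c s ≤ c δ(s). -/
theorem apply_min_mul_le (h : IsStabilityModulus 𝒞 μ δ) {c s : ℝ} (hc : 1 ≤ c)
    (hs : s ∈ Icc (0 : ℝ) 4) : δ (min 4 (c * s)) ≤ c * δ s := by
  rcases le_total (c * s) 4 with h1 | h1
  · rw [min_eq_right h1]; exact h.apply_mul_le hc hs.1 h1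
  · rw [min_eq_left h1, h.map_four]
    have := h.le_apply hs
    exact h1.trans (by gcongr)

end IsStabilityModulus

theorem tendsto_comp_min {α : Type*} {l : Filter α}
    (hδ : Tendsto δ (𝓝[>] 0) (𝓝 0)) {f : α → ℝ} (hf : Tendsto f l (𝓝 0))
    (hpos : ∀ᶠ x in l, 0 < f x) : Tendsto (fun x => δ (min 4 (f x))) l (𝓝 0) := by
  refine hδ.comp (tendsto_nhdsWithin_iff.2 ⟨?_, ?_⟩)
  · have : Tendsto (fun x => min 4 (f x)) l (𝓝 (min 4 0)) := tendsto_const_nhds.min hf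
    simpa using this
  · filter_upwards [hpos] with x hx
    exact lt_min (by norm_num) hx

theorem distSq_le_four {A : TracialVNA.{v}} (φ ψ : G → A.U) : distSq A μ φ ψ ≤ 4 :=
  (le_abs_self _).trans <| μ.abs_mean_le (f := fun g => A.normSq ((φ g : A.Elem) - ψ g)) fun g => by
    rw [abs_of_nonneg (TracialVNA.normSq_nonneg _)]
    exact TracialVNA.normSq_sub_unitary_le _ _

variable {G₁ : Type u₁} {G₂ : Type u₂} [Group G₁] [Group G₂] {μ₁ : PMF G₁} {μ₂ : PMF G₂}
  {δ₁ δ₂ : ℝ → ℝ}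

/-- `𝒞`-stability passes to products. -/
theorem isStable_averagedMeasure (h𝒞 : ClosedUnderSubalgebras 𝒞)
    (hμ₁ : HasGeneratingSupport μ₁) (hκ : kappa.{u₁, v} μ₁ ≠ ∞)
    (h₁ : IsStable 𝒞 μ₁) (h₂ : IsStable 𝒞 μ₂) : IsStable 𝒞 (averagedMeasure μ₁ μ₂) := by
  obtain ⟨δ₁, hδ₁⟩ := h₁
  obtain ⟨δ₂, hδ₂⟩ := h₂
  set κ := (kappa.{u₁, v} μ₁).toReal with hκ'
  have hκ0 : 0 ≤ κ := ENNReal.toReal_nonneg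
  set d : ℝ → ℝ := fun ε => δ₁ (min 4 (4 * ε)) with hd
  set D : ℝ → ℝ := fun ε => 4 * (κ * (176 * ε + 64 * d ε) + 4 * ε) with hD
  have hI : ∀ {t : ℝ}, 0 ≤ t → min 4 t ∈ Icc (0 : ℝ) 4 :=
    fun ht => ⟨le_min (by norm_num) ht, min_le_left _ _⟩
  have hd0 : ∀ {ε}, 0 ≤ ε → 0 ≤ d ε := fun hε => (hδ₁.mapsTo (hI (by linarith))).1
  have hD0 : ∀ {ε}, 0 ≤ ε → 0 ≤ D ε := fun hε => by have := hd0 hε; positivity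
  have hdm : ∀ {ε ε'}, 0 ≤ ε → ε ≤ ε' → d ε ≤ d ε' := fun h0 h =>
    hδ₁.monotoneOn (hI (by linarith)) (hI (by linarith)) (min_le_min_left _ (by linarith))
  have hDm : ∀ {ε ε'}, 0 ≤ ε → ε ≤ ε' → D ε ≤ D ε' := fun h0 h => by
    have := hdm h0 h
    simp only [hD]
    gcongr
  have hid : Tendsto (fun ε : ℝ => ε) (𝓝[>] 0) (𝓝 0) := tendsto_id.mono_left nhdsWithin_le_nhds
  have hpos : ∀ᶠ ε : ℝ in 𝓝[>] 0, 0 < ε := eventually_mem_nhdsWithin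
  have hdt : Tendsto d (𝓝[>] 0) (𝓝 0) := tendsto_comp_min hδ₁.tendsto
    (by simpa using hid.const_mul 4) (hpos.mono fun ε hε => by positivity)
  have hDt : Tendsto (fun ε => δ₂ (min 4 (D ε))) (𝓝[>] 0) (𝓝 0) := by
    refine tendsto_comp_min hδ₂.tendsto ?_ (hpos.mono fun ε hε => ?_)
    · simpa using ((((hid.const_mul 176).add (hdt.const_mul 64)).const_mul κ).add
        (hid.const_mul 4)).const_mul 4
    · have := hd0 hε.le
      positivity
  -- The cap at 4 is free: squared distances between unitary-valued maps never exceed 4.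
  refine ⟨fun ε => min 4 (d ε / 2 + κ * (16 * ε + 8 * d ε) + δ₂ (min 4 (D ε))), ?_, ?_, ?_, ?_⟩
  · intro ε hε
    refine hI ?_
    have h1 := hd0 hε.1
    have h2 := (hδ₂.mapsTo (hI (hD0 hε.1))).1
    have h3 := hε.1
    positivity
  · intro ε hε ε' hε' h
    have h1 := hdm hε.1 h
    have h2 := hδ₂.monotoneOn (hI (hD0 hε.1)) (hI (hD0 hε'.1)) (min_le_min_left _ (hDm hε.1 h))
    simp only
    gcongr
  · have := (tendsto_const_nhds (x := (4 : ℝ)) (f := 𝓝[>] (0 : ℝ))).min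
      (((hdt.div_const 2).add (((hid.const_mul 16).add (hdt.const_mul 8)).const_mul κ)).add hDt)
    simpa using this
  · intro A hA ε hε φ hφ
    obtain ⟨π, hπ⟩ := exists_hom_of_isAlmostHom_prod h𝒞 hμ₁ hκ hδ₁ hδ₂ hA hε.1 hφ hκ' rfl
    exact ⟨π, le_min (distSq_le_four _ _) hπ⟩

/-- The modulus is min(4, 2000 δ₂(min(4, κ δ₁(ε)))). It is concave because δ₂ is concave and
nondecreasing and its argument is concave in ε. -/
theorem exists_isStabilityModulus_averagedMeasure [Countable G₁] [Nontrivial G₁]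
    (h𝒞 : ClosedUnderSubalgebras 𝒞)
    (hμ₁ : HasGeneratingSupport μ₁) (hκ : kappa.{u₁, v} μ₁ ≠ ∞)
    (h₁ : IsStabilityModulus 𝒞 μ₁ δ₁) (h₂ : IsStabilityModulus 𝒞 μ₂ δ₂) :
    ∃ δ : ℝ → ℝ, IsStabilityModulus 𝒞 (averagedMeasure μ₁ μ₂) δ ∧
      ∀ ε ∈ Icc (0 : ℝ) 4, δ ε ≤ 2000 * δ₂ (min 4 ((kappa.{u₁, v} μ₁).toReal * δ₁ ε)) := by
  set κ := (kappa.{u₁, v} μ₁).toReal with hκ'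
  have hκ2 : 1 / 2 ≤ κ := half_le_kappa hμ₁ hκ
  have hI : ∀ {t : ℝ}, 0 ≤ t → min 4 t ∈ Icc (0 : ℝ) 4 :=
    fun ht => ⟨le_min (by norm_num) ht, min_le_left _ _⟩
  have hδ0 : ∀ {ε}, ε ∈ Icc (0 : ℝ) 4 → 0 ≤ δ₁ ε := fun hε => (h₁.mapsTo hε).1
  set s : ℝ → ℝ := fun ε => min 4 (κ * δ₁ ε) with hs
  have hsI : ∀ {ε}, ε ∈ Icc (0 : ℝ) 4 → s ε ∈ Icc (0 : ℝ) 4 := fun hε => hI (by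
    have := hδ0 hε; positivity)
  have hsm : MonotoneOn s (Icc 0 4) := fun ε hε ε' hε' h => by
    have := h₁.monotoneOn hε hε' h
    simp only [hs]
    gcongr
  have hsc : ConcaveOn ℝ (Icc 0 4) s := by
    refine (concaveOn_const 4 (convex_Icc _ _)).inf ?_
    simpa using h₁.concaveOn.smul (by linarith : (0 : ℝ) ≤ κ)
  have hc : ConcaveOn ℝ (Icc 0 4) fun ε => δ₂ (s ε) := by
    refine ⟨convex_Icc _ _, fun x hx y hy a b ha hb hab => ?_⟩
    have hz := (convex_Icc (0 : ℝ) 4) hx hy ha hb hab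
    exact (h₂.concaveOn.2 (hsI hx) (hsI hy) ha hb hab).trans (h₂.monotoneOn
      ((convex_Icc (0 : ℝ) 4) (hsI hx) (hsI hy) ha hb hab) (hsI hz) (hsc.2 hx hy ha hb hab))
  refine ⟨fun ε => min 4 (2000 * δ₂ (s ε)), ⟨⟨?_, ?_, ?_, ?_⟩, ?_, ?_⟩,
    fun ε _ => min_le_right _ _⟩
  · exact fun ε hε => hI (by have := (h₂.mapsTo (hsI hε)).1; positivity)
  · intro ε hε ε' hε' h
    have := h₂.monotoneOn (hsI hε) (hsI hε') (hsm hε hε' h)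
    simp only
    gcongr
  · have h3 : Tendsto (fun ε => δ₂ (s ε)) (𝓝[>] 0) (𝓝 0) := by
      refine tendsto_comp_min h₂.tendsto (by simpa using h₁.tendsto.const_mul κ) ?_
      have h4 : ∀ᶠ ε : ℝ in 𝓝[>] 0, ε ∈ Ioo (0 : ℝ) 4 := Ioo_mem_nhdsGT (by norm_num)
      filter_upwards [h4] with ε hε
      have := h₁.le_apply ⟨hε.1.le, hε.2.le⟩
      have := hε.1
      nlinarith
    simpa using (tendsto_const_nhds (x := (4 : ℝ)) (f := 𝓝[>] (0 : ℝ))).min (h3.const_mul 2000)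
  · intro A hA ε hε φ hφ
    obtain ⟨π, hπ⟩ := exists_hom_of_isAlmostHom_prod h𝒞 hμ₁ hκ h₁.toIsStabilityFunction
      h₂.toIsStabilityFunction hA hε.1 hφ hκ' rfl
    refine ⟨π, le_min (distSq_le_four _ _) ?_⟩
    have hs2 := h₂.le_apply (hsI hε)
    rcases le_total (κ * δ₁ ε) 4 with h4 | h4
    · have hse : s ε = κ * δ₁ ε := min_eq_right h4
      rw [hse] at hs2 ⊢
      have hd := h₁.apply_min_mul_le (c := 4) (by norm_num) hε
      have he := h₁.le_apply hε
      have h0 := hδ0 hε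
      have hd0 : 0 ≤ δ₁ (min 4 (4 * ε)) := (h₁.mapsTo (hI (by linarith [hε.1]))).1
      set d := δ₁ (min 4 (4 * ε)) with hd'
      -- From ε ≤ δ₁(ε), d ≤ 4 δ₁(ε) and 1 ≤ 2 κ, the coefficient is 704 + 1024 + 32 = 1760. In the
      -- same way h8 gets 4 + 16 + 32 = 52, and 1760 + 52 ≤ 2000.
      have h5 : 4 * (κ * (176 * ε + 64 * d) + 4 * ε) ≤ 1760 * (κ * δ₁ ε) := by nlinarith
      have h6 : δ₂ (min 4 (4 * (κ * (176 * ε + 64 * d) + 4 * ε))) ≤ 1760 * δ₂ (κ * δ₁ ε) := by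
        refine le_trans ?_ (h₂.apply_min_mul_le (by norm_num) ⟨by positivity, h4⟩)
        have h7 : 0 ≤ 4 * (κ * (176 * ε + 64 * d) + 4 * ε) := by have := hε.1; positivity
        exact h₂.monotoneOn (hI h7) (hI (h7.trans h5)) (min_le_min_left _ h5)
      have h8 : d / 2 + κ * (16 * ε + 8 * d) ≤ 52 * (κ * δ₁ ε) := by nlinarith
      have h9 : 0 ≤ κ * δ₁ ε := by positivity
      linarith
    · have hse : s ε = 4 := min_eq_left h4
      rw [hse, h₂.map_four]
      exact (distSq_le_four _ _).trans (by norm_num)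
  · refine (concaveOn_const 4 (convex_Icc _ _)).inf ?_
    simpa using hc.smul (by norm_num : (0 : ℝ) ≤ 2000)
  · have h4 : (4 : ℝ) ∈ Icc (0 : ℝ) 4 := by norm_num
    -- The bound κ ≥ 1/2 also makes the cap active at ε = 4, which gives the normalization δ(4) = 4.
    have h5 : 2 ≤ s 4 := le_min (by norm_num) (by rw [h₁.map_four]; linarith)
    have h6 := h₂.le_apply (hsI h4)
    exact min_eq_left (by linarith)

end Moduli

/-! ### Finite-dimensional tracial von Neumann algebras -/

namespace TracialVNA

variable {A : TracialVNA.{v}}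

theorem eq_zero_of_star_mul_self {x : A.Elem} (h : star x * x = 0) : x = 0 :=
  A.isState.faithful x (by rw [h, map_zero])

theorem normSq_add_of_orthogonal {x y : A.Elem} (h : star x * y = 0) :
    A.normSq (x + y) = A.normSq x + A.normSq y := by
  have h' : star y * x = 0 := by simpa using congrArg star h
  rw [normSq, normSq, normSq, star_add, add_mul, mul_add, mul_add, h, h', add_zero, zero_add,
    map_add, Complex.add_re]

/-- The dimension of the range of an element. -/
def rank (x : A.Elem) : ℕ := Module.finrank ℂ (x.1 : A.H →ₗ[ℂ] A.H).range

/-- Self-adjoint idempotents. -/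
structure IsProj (e : A.Elem) : Prop where
  star_eq : star e = e
  mul_self : e * e = e

theorem IsProj.apply_of_mem_range {e : A.Elem} (he : IsProj e) {ξ : A.H}
    (h : ξ ∈ (e.1 : A.H →ₗ[ℂ] A.H).range) : e.1 ξ = ξ := by
  obtain ⟨η, rfl⟩ := h
  exact congrArg (fun a : A.Elem => a.1 η) he.mul_self

variable [FiniteDimensional ℂ A.H]

theorem rank_sub_lt {p z : A.Elem} (hp : IsProj p) (hz : IsProj z) (hpz : p * z = z)
    (hzp : z * p = z) (hz0 : z ≠ 0) : rank (p - z) < rank p := by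
  refine Submodule.finrank_lt_finrank_of_lt (lt_of_le_of_ne ?_ fun h => hz0 ?_)
  · rintro _ ⟨ξ, rfl⟩
    refine ⟨(p - z).1 ξ, ?_⟩
    have h1 : p * (p - z) = p - z := by rw [mul_sub, hp.mul_self, hpz]
    exact congrArg (fun a : A.Elem => a.1 ξ) h1
  · have h1 : z * (p - z) = 0 := by rw [mul_sub, hzp, hz.mul_self, sub_self]
    refine Subtype.ext (ContinuousLinearMap.ext fun ξ => ?_)
    have h2 : z.1 ξ ∈ (p.1 : A.H →ₗ[ℂ] A.H).range :=
      ⟨z.1 ξ, congrArg (fun a : A.Elem => a.1 ξ) hpz⟩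
    rw [← h] at h2
    obtain ⟨η, hη⟩ := h2
    have h3 : z.1 ((p - z).1 η) = 0 := congrArg (fun a : A.Elem => a.1 η) h1
    have h4 : z.1 (z.1 ξ) = z.1 ξ := congrArg (fun a : A.Elem => a.1 ξ) hz.mul_self
    rw [← h4]
    exact (congrArg z.1 hη).symm.trans h3

/-- A minimal projection. -/
structure IsMinimalProj (e : A.Elem) : Prop extends IsProj e where
  ne_zero : e ≠ 0
  exists_smul : ∀ a, e * a = a → a * e = a → ∃ c : ℂ, a = c • e

/-- Take a nonzero projection e of least rank under p. If a = e a e, an eigenspace of a inside the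
range of e is invariant under the commutant, so its projection lies in the algebra. Least rank
forces it to be the whole range, and a is a scalar multiple of e. -/
theorem exists_isMinimalProj {p : A.Elem} (hp : IsProj p) (hp0 : p ≠ 0) :
    ∃ e, IsMinimalProj e ∧ p * e = e := by
  obtain ⟨e, ⟨he, he0, hpe⟩, hmin⟩ := (measure (rank (A := A))).wf.has_min
    {e | IsProj e ∧ e ≠ 0 ∧ p * e = e} ⟨p, hp, hp0, hp.mul_self⟩
  refine ⟨e, ⟨he, he0, fun a hea hae => ?_⟩, hpe⟩
  set W : Submodule ℂ A.H := (e.1 : A.H →ₗ[ℂ] A.H).range with hW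
  have haW : ∀ ξ ∈ W, (a.1 : A.H →ₗ[ℂ] A.H) ξ ∈ W := fun ξ _ =>
    ⟨a.1 ξ, congrArg (fun b : A.Elem => b.1 ξ) hea⟩
  have hWn : Nontrivial W := by
    rw [Submodule.nontrivial_iff_ne_bot]
    intro h
    refine he0 (Subtype.ext (ContinuousLinearMap.ext fun ξ => ?_))
    have : e.1 ξ ∈ W := ⟨ξ, rfl⟩
    rw [h] at this
    exact this
  obtain ⟨c, hc⟩ := Module.End.exists_eigenvalue ((a.1 : A.H →ₗ[ℂ] A.H).restrict haW)
  obtain ⟨w, hw⟩ := hc.exists_hasEigenvector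
  have hw1 : a.1 w.1 = c • w.1 := congrArg Subtype.val hw.apply_eq_smul
  have hw0 : w.1 ≠ 0 := fun h => hw.2 (Subtype.ext h)
  set K : Submodule ℂ A.H := W ⊓ ((a.1 - c • 1 : A.H →L[ℂ] A.H) : A.H →ₗ[ℂ] A.H).ker with hK
  have hmemK : ∀ ξ, ξ ∈ K ↔ ξ ∈ W ∧ a.1 ξ = c • ξ := fun ξ => by
    rw [hK, Submodule.mem_inf, LinearMap.mem_ker]
    exact and_congr_right fun _ => sub_eq_zero
  have hKp : IsStarProjection K.starProjection := isStarProjection_starProjection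
  have hKM : K.starProjection ∈ A.M := by
    rw [VonNeumannAlgebra.IsStarProjection.mem_iff hKp]
    intro y hy
    rw [Submodule.range_starProjection]
    intro ξ hξ
    have hcomm : ∀ b : A.Elem, b.1 (y ξ) = y (b.1 ξ) := fun b =>
      congrArg (fun T : A.H →L[ℂ] A.H => T ξ) (VonNeumannAlgebra.mem_commutant_iff.1 hy b.1 b.2)
    rw [hmemK] at hξ
    change y ξ ∈ K
    rw [hmemK]
    refine ⟨⟨y ξ, ?_⟩, ?_⟩
    · exact (hcomm e).trans (congrArg y (he.apply_of_mem_range hξ.1))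
    · rw [hcomm, hξ.2, map_smul]
  set q : A.Elem := ⟨K.starProjection, hKM⟩ with hq
  have hqp : IsProj q := ⟨Subtype.ext hKp.isSelfAdjoint, Subtype.ext hKp.isIdempotentElem⟩
  have hwK : w.1 ∈ K := (hmemK _).2 ⟨w.2, hw1⟩
  have hq0 : q ≠ 0 := by
    intro h
    have h1 : K.starProjection w.1 = 0 := congrArg (fun b : A.Elem => b.1 w.1) h
    rw [Submodule.starProjection_eq_self_iff.2 hwK] at h1
    exact hw0 h1
  have heq : e * q = q := Subtype.ext <| ContinuousLinearMap.ext fun ξ =>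
    he.apply_of_mem_range ((hmemK _).1 (Submodule.starProjection_apply_mem K ξ)).1
  have hle : Module.finrank ℂ W ≤ Module.finrank ℂ K := by
    have h1 := hmin q ⟨hqp, hq0, by rw [← heq, ← mul_assoc, hpe]⟩
    have h2 : rank q = Module.finrank ℂ K := by
      exact congrArg (fun S : Submodule ℂ A.H => Module.finrank ℂ S)
        (Submodule.range_starProjection K)
    rw [← h2]
    exact not_lt.1 h1
  have hKW : K = W := Submodule.eq_of_le_of_finrank_le inf_le_left hle
  refine ⟨c, ?_⟩
  rw [← hae]
  refine Subtype.ext (ContinuousLinearMap.ext fun ξ => ?_)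
  have h1 : e.1 ξ ∈ K := by rw [hKW]; exact ⟨ξ, rfl⟩
  exact ((hmemK _).1 h1).2

/-- A column of matrix units over the minimal projection `e`. -/
structure IsColumn (e : A.Elem) {k : ℕ} (f : Fin k → A.Elem) : Prop where
  ortho : ∀ i j, star (f i) * f j = if i = j then e else 0

/-! ### Columns of matrix units and their supports -/

namespace IsColumn

variable {e : A.Elem} {k : ℕ} {f : Fin k → A.Elem}

theorem mul_eq (he : IsProj e) (hf : IsColumn e f) (i : Fin k) : f i * e = f i := by
  have h1 := hf.ortho i i
  rw [if_pos rfl] at h1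
  have h2 : f i - f i * e = 0 := by
    refine eq_zero_of_star_mul_self ?_
    have : star (f i - f i * e) * (f i - f i * e) =
        star (f i) * f i - star (f i) * f i * e - (star e * (star (f i) * f i) -
          star e * (star (f i) * f i) * e) := by
      rw [star_sub, star_mul]; noncomm_ring
    rw [this, h1, he.star_eq, he.mul_self, he.mul_self, sub_self]
  exact (sub_eq_zero.1 h2).symm

theorem mul_star_eq (he : IsProj e) (hf : IsColumn e f) (i : Fin k) :
    e * star (f i) = star (f i) := by
  have := congrArg star (hf.mul_eq he i)
  rwa [star_mul, he.star_eq] at this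

/-- The support of a column. -/
def supp (f : Fin k → A.Elem) : A.Elem := ∑ i, f i * star (f i)

theorem star_mul_supp (he : IsProj e) (hf : IsColumn e f) (i : Fin k) :
    star (f i) * supp f = star (f i) := by
  rw [supp, Finset.mul_sum, Finset.sum_eq_single i]
  · rw [← mul_assoc, hf.ortho, if_pos rfl, hf.mul_star_eq he]
  · intro j _ hj
    rw [← mul_assoc, hf.ortho, if_neg hj.symm, zero_mul]
  · simp

theorem isProj_supp (he : IsProj e) (hf : IsColumn e f) : IsProj (supp f) := by
  refine ⟨by simp [supp], ?_⟩
  rw [show supp f * supp f = (∑ i, f i * star (f i)) * supp f from rfl, Finset.sum_mul]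
  exact Finset.sum_congr rfl fun i _ => by rw [mul_assoc, hf.star_mul_supp he]

/-- The f i (f i)* are orthogonal projections of trace τ(e) = `A.normSq e` with sum below 1. This
bounds the length of columns over e. -/
theorem card_mul_le (he : IsProj e) (hf : IsColumn e f) : k * A.normSq e ≤ 1 := by
  have h1 : A.τ (supp f) = k * A.τ e := by
    rw [supp, map_sum, Finset.sum_congr rfl fun i _ => by
      rw [A.isState.tracial, hf.ortho, if_pos rfl]]
    simp
  have hs := hf.isProj_supp he
  have h2 := normSq_nonneg (1 - supp f)
  have h3 : star (1 - supp f) * (1 - supp f) = 1 - supp f := by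
    rw [star_sub, star_one, hs.star_eq, mul_sub, mul_one, sub_mul, one_mul, hs.mul_self, sub_self,
      sub_zero]
  rw [normSq, h3, map_sub, A.isState.map_one, h1] at h2
  rw [normSq, he.star_eq, he.mul_self]
  simpa using h2

end IsColumn

theorem IsProj.normSq_pos {e : A.Elem} (he0 : e ≠ 0) : 0 < A.normSq e := by
  rw [← norm_toL2_sq]
  have : A.toL2 e ≠ 0 := fun h => he0 (A.toL2_injective (by rw [h, map_zero]))
  positivity

/-- Over a minimal projection there is a column whose support is central. -/
theorem exists_isColumn_central {e : A.Elem} (he : IsMinimalProj e) :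
    ∃ (k : ℕ) (f : Fin k → A.Elem), 0 < k ∧ IsColumn e f ∧
      ∀ a, IsColumn.supp f * a = a * IsColumn.supp f := by
  -- The trace bounds the lengths of columns, so there is a longest one. Its support will be central
  -- because a noncentral support would leave room for one more entry.
  set S : Set ℕ := {k | ∃ f : Fin k → A.Elem, IsColumn e f} with hS
  have hepos := IsProj.normSq_pos he.ne_zero
  have hbdd : BddAbove S := by
    refine ⟨⌈1 / A.normSq e⌉₊, ?_⟩
    rintro k ⟨f, hf⟩
    have h1 := hf.card_mul_le he.toIsProj
    have h2 : (k : ℝ) ≤ 1 / A.normSq e := by rwa [le_div_iff₀ hepos]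
    exact_mod_cast h2.trans (Nat.le_ceil _)
  have h1S : 1 ∈ S := ⟨fun _ => e, ⟨fun i j => by
    rw [if_pos (Subsingleton.elim i j), he.star_eq, he.mul_self]⟩⟩
  obtain ⟨f, hf⟩ : sSup S ∈ S := Nat.sSup_mem ⟨1, h1S⟩ hbdd
  refine ⟨sSup S, f, le_csSup hbdd h1S, hf, ?_⟩
  set z := IsColumn.supp f with hz
  have hzp : IsProj z := hf.isProj_supp he.toIsProj
  have hqs : star (1 - z) = 1 - z := by rw [star_sub, star_one, hzp.star_eq]
  have hqq : (1 - z) * (1 - z) = 1 - z := by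
    rw [mul_sub, mul_one, sub_mul, one_mul, hzp.mul_self, sub_self, sub_zero]
  have key : ∀ a j, (1 - z) * a * f j = 0 := by
    intro a j
    set b := (1 - z) * a * f j with hb
    have hbe : b * e = b := by rw [hb, mul_assoc, hf.mul_eq he.toIsProj]
    have heb : e * star b = star b := by
      have := congrArg star hbe
      rwa [star_mul, he.star_eq] at this
    obtain ⟨c, hc⟩ := he.exists_smul (star b * b) (by rw [← mul_assoc, heb])
      (by rw [mul_assoc, hbe])
    by_contra hb0
    have hnb := IsProj.normSq_pos hb0
    have hcre : c = ((A.normSq b / A.normSq e : ℝ) : ℂ) := by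
      have h1 : A.τ (star b * b) = c * A.τ e := by rw [hc, map_smul, smul_eq_mul]
      have him : ∀ x : A.Elem, A.τ (star x * x) = (A.normSq x : ℂ) := fun x =>
        Complex.ext rfl (Complex.nonneg_iff.1 (A.isState.nonneg x)).2.symm
      have h2 := him e
      rw [he.star_eq, he.mul_self] at h2
      rw [him, h2] at h1
      have h3 : (A.normSq e : ℂ) ≠ 0 := by exact_mod_cast hepos.ne'
      rw [Complex.ofReal_div, h1]
      field_simp
    set r : ℝ := A.normSq b / A.normSq e with hr
    have hr0 : 0 < r := by positivity
    -- Minimality makes b* b a multiple of e, and taking traces shows that the scalar is r > 0.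
    -- Rescaling gives g* g = e with g orthogonal to the column, so g lengthens it.
    set g : A.Elem := (((√r)⁻¹ : ℝ) : ℂ) • b with hg
    have hgg : star g * g = e := by
      rw [hg, star_smul, smul_mul_smul_comm, hc, hcre, smul_smul, Complex.star_def,
        Complex.conj_ofReal, ← Complex.ofReal_mul, ← Complex.ofReal_mul]
      have : (√r)⁻¹ * (√r)⁻¹ * r = 1 := by
        rw [← mul_inv, Real.mul_self_sqrt hr0.le, inv_mul_cancel₀ hr0.ne']
      rw [this, Complex.ofReal_one, one_smul]
    have hfg : ∀ i, star (f i) * g = 0 := by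
      intro i
      have : star (f i) * (1 - z) = 0 := by
        rw [mul_sub, mul_one, hf.star_mul_supp he.toIsProj, sub_self]
      rw [hg, mul_smul_comm, hb, ← mul_assoc, ← mul_assoc, this, zero_mul, zero_mul, smul_zero]
    have hgf : ∀ i, star g * f i = 0 := fun i => by
      have := congrArg star (hfg i)
      rwa [star_mul, star_star, star_zero] at this
    have hmem : sSup S + 1 ∈ S := by
      refine ⟨Fin.snoc (α := fun _ => A.Elem) f g, ⟨fun i j => ?_⟩⟩
      induction i using Fin.lastCases with
      | last =>
        induction j using Fin.lastCases with
        | last => simp [hgg]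
        | cast j => simp [hgf, (Fin.castSucc_ne_last j).symm]
      | cast i =>
        induction j using Fin.lastCases with
        | last => simp [hfg, Fin.castSucc_ne_last i]
        | cast j => simp [hf.ortho]
    have := le_csSup hbdd hmem
    omega
  -- Vanishing of (1 - z) a z for all a, together with the same for adjoints, makes z central.
  have key2 : ∀ a, a * z = z * a * z := by
    intro a
    have h1 : (1 - z) * a * z = 0 := by
      rw [show (1 - z) * a * z = (1 - z) * a * ∑ i, f i * star (f i) from rfl, Finset.mul_sum]
      exact Finset.sum_eq_zero fun i _ => by rw [← mul_assoc, key, zero_mul]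
    rwa [sub_mul, sub_mul, one_mul, sub_eq_zero] at h1
  intro a
  have h1 := congrArg star (key2 (star a))
  simp only [star_mul, star_star, hzp.star_eq] at h1
  rw [h1, ← mul_assoc]
  exact (key2 a).symm

end TracialVNA

theorem hsNorm_sq {n : ℕ} (a : Matrix (Fin n) (Fin n) ℂ) :
    hsNorm a ^ 2 = (a.conjTranspose * a).trace.re / n := by
  refine Real.sq_sqrt (div_nonneg ?_ n.cast_nonneg)
  exact (Complex.nonneg_iff.1 (Matrix.posSemidef_conjTranspose_mul_self a).trace_nonneg).1

namespace TracialVNA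

variable {A : TracialVNA.{v}}

theorem τ_star_mul_self (x : A.Elem) : A.τ (star x * x) = (A.normSq x : ℂ) :=
  Complex.ext rfl (Complex.nonneg_iff.1 (A.isState.nonneg x)).2.symm

variable [FiniteDimensional ℂ A.H]

/-! ### Matrix blocks over a column -/

namespace IsColumn

variable {e : A.Elem} {k : ℕ} {f : Fin k → A.Elem}

/-- The copy in `A` of a matrix, over the matrix units given by a column. -/
def mat (f : Fin k → A.Elem) (X : Matrix (Fin k) (Fin k) ℂ) : A.Elem :=
  ∑ i, ∑ j, X i j • (f i * star (f j))

theorem mat_sub (f : Fin k → A.Elem) (X Y : Matrix (Fin k) (Fin k) ℂ) :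
    mat f (X - Y) = mat f X - mat f Y := by
  simp [mat, sub_smul, Finset.sum_sub_distrib]

theorem mat_one (f : Fin k → A.Elem) : mat f 1 = supp f := by
  simp [mat, supp, Matrix.one_apply, ite_smul]

theorem mat_conjTranspose (f : Fin k → A.Elem) (X : Matrix (Fin k) (Fin k) ℂ) :
    mat f X.conjTranspose = star (mat f X) := by
  rw [mat, Finset.sum_comm]
  simp [mat]

theorem star_mul_mat (he : IsProj e) (hf : IsColumn e f) (X : Matrix (Fin k) (Fin k) ℂ)
    (i : Fin k) : star (f i) * mat f X = ∑ j, X i j • star (f j) := by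
  rw [mat, Finset.mul_sum, Finset.sum_eq_single i]
  · rw [Finset.mul_sum]
    refine Finset.sum_congr rfl fun j _ => ?_
    rw [mul_smul_comm, ← mul_assoc, hf.ortho, if_pos rfl, hf.mul_star_eq he]
  · intro j _ hj
    rw [Finset.mul_sum]
    refine Finset.sum_eq_zero fun l _ => ?_
    rw [mul_smul_comm, ← mul_assoc, hf.ortho, if_neg hj.symm, zero_mul, smul_zero]
  · simp

theorem mat_mul (he : IsProj e) (hf : IsColumn e f) (X Y : Matrix (Fin k) (Fin k) ℂ) :
    mat f (X * Y) = mat f X * mat f Y := by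
  conv_rhs => rw [mat, Finset.sum_mul]
  rw [mat]
  refine Finset.sum_congr rfl fun i _ => ?_
  rw [Finset.sum_mul]
  simp only [smul_mul_assoc, mul_assoc, hf.star_mul_mat he, Finset.mul_sum, mul_smul_comm,
    Finset.smul_sum, smul_smul, Matrix.mul_apply, Finset.sum_smul]
  exact Finset.sum_comm

theorem supp_mul_mat (he : IsProj e) (hf : IsColumn e f) (X : Matrix (Fin k) (Fin k) ℂ) :
    supp f * mat f X = mat f X := by
  rw [← mat_one, ← hf.mat_mul he, one_mul]

theorem τ_mat (hf : IsColumn e f) (X : Matrix (Fin k) (Fin k) ℂ) :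
    A.τ (mat f X) = X.trace * A.τ e := by
  simp only [mat, map_sum, map_smul, A.isState.tracial (f _) (star (f _)), hf.ortho]
  simp [Matrix.trace, Finset.sum_mul, apply_ite A.τ]

/-- The trace of A on the block is the matrix trace times τ(e), so after normalization only the
weight k τ(e) of the support remains. -/
theorem normSq_mat (he : IsProj e) (hf : IsColumn e f) (X : Matrix (Fin k) (Fin k) ℂ)
    (hk : 0 < k) : A.normSq (mat f X) = hsNorm X ^ 2 * (k * A.normSq e) := by
  have h := τ_star_mul_self e
  rw [he.star_eq, he.mul_self] at h
  rw [normSq, ← mat_conjTranspose, ← hf.mat_mul he, hf.τ_mat, h, Complex.re_mul_ofReal, hsNorm_sq]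
  have : (k : ℝ) ≠ 0 := by positivity
  field_simp

theorem normSq_supp (hf : IsColumn e f) (he : IsProj e) :
    A.normSq (supp f) = k * A.normSq e := by
  have h := τ_star_mul_self e
  rw [he.star_eq, he.mul_self] at h
  rw [normSq, (hf.isProj_supp he).star_eq, (hf.isProj_supp he).mul_self, ← mat_one, hf.τ_mat, h,
    Complex.re_mul_ofReal]
  simp

/-- If the support of the column is central, compression to it is given by a multiplicative map
to matrices. -/
theorem exists_coeff (he : IsMinimalProj e) (hf : IsColumn e f)
    (hz : ∀ a, supp f * a = a * supp f) :
    ∃ M : A.Elem → Matrix (Fin k) (Fin k) ℂ, (∀ a, mat f (M a) = supp f * a) ∧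
      (∀ a b, M (a * b) = M a * M b) ∧ (∀ a b, M (a - b) = M a - M b) ∧
      ∀ u : A.U, M u ∈ Matrix.unitaryGroup (Fin k) ℂ := by
  have hep := he.toIsProj
  -- The entries live in e A e, which consists of scalars by minimality.
  have h0 : ∀ a i j, ∃ c : ℂ, star (f i) * a * f j = c • e := fun a i j =>
    he.exists_smul _ (by rw [← mul_assoc, ← mul_assoc, hf.mul_star_eq hep])
      (by rw [mul_assoc, hf.mul_eq hep])
  obtain ⟨M, hM⟩ : ∃ M : A.Elem → Matrix (Fin k) (Fin k) ℂ,
      ∀ a i j, star (f i) * a * f j = M a i j • e := by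
    choose M hM using h0
    exact ⟨fun a => Matrix.of (M a), hM⟩
  have hcancel : ∀ c d : ℂ, c • e = d • e → c = d := fun c d h =>
    smul_left_injective ℂ he.ne_zero h
  have hmat : ∀ a, mat f (M a) = supp f * a := by
    intro a
    have h1 : supp f * a = supp f * (a * supp f) := by
      rw [← hz, ← mul_assoc, (hf.isProj_supp hep).mul_self]
    rw [h1, mat]
    rw [show supp f * (a * supp f) = ∑ i, f i * star (f i) * (a * supp f) from
      Finset.sum_mul _ _ _]
    refine Finset.sum_congr rfl fun i _ => ?_
    rw [show f i * star (f i) * (a * supp f) = ∑ j, f i * star (f i) * (a * (f j * star (f j))) by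
      simp [supp, Finset.mul_sum]]
    refine Finset.sum_congr rfl fun j _ => ?_
    have h2 : f i * star (f i) * (a * (f j * star (f j))) =
        f i * (star (f i) * a * f j) * star (f j) := by noncomm_ring
    rw [h2, hM, mul_smul_comm, hf.mul_eq hep, smul_mul_assoc]
  have hmul : ∀ a b, M (a * b) = M a * M b := by
    intro a b
    ext i j
    refine hcancel _ _ ?_
    rw [← hM, Matrix.mul_apply, Finset.sum_smul]
    -- Centrality lets the support be inserted between a and b, where it expands into the sum over
    -- the middle index of a matrix product.
    have h1 : star (f i) * (a * b) * f j = star (f i) * a * supp f * b * f j := by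
      rw [mul_assoc (star (f i)) a, ← hz, ← mul_assoc (star (f i)) (supp f), hf.star_mul_supp hep]
      noncomm_ring
    rw [h1, supp, Finset.mul_sum, Finset.sum_mul, Finset.sum_mul]
    refine Finset.sum_congr rfl fun l _ => ?_
    have h2 : star (f i) * a * (f l * star (f l)) * b * f j =
        (star (f i) * a * f l) * (star (f l) * b * f j) := by noncomm_ring
    rw [h2, hM, hM, smul_mul_smul_comm, hep.mul_self]
  have hsub : ∀ a b, M (a - b) = M a - M b := by
    intro a b
    ext i j
    refine hcancel _ _ ?_
    rw [← hM, mul_sub, sub_mul, hM, hM, ← sub_smul, Matrix.sub_apply]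
  refine ⟨M, hmat, hmul, hsub, fun u => ?_⟩
  rw [Matrix.mem_unitaryGroup_iff']
  have h1 : star (M (u : A.Elem)) = M (star (u : A.Elem)) := by
    ext i j
    refine hcancel _ _ ?_
    rw [← hM, Matrix.star_apply]
    have := congrArg star (hM (u : A.Elem) j i)
    rw [star_smul, hep.star_eq] at this
    rw [← this]
    simp [mul_assoc]
  have h2 := hmul (star (u : A.Elem)) u
  rw [Unitary.coe_star_mul_self] at h2
  rw [h1]
  refine h2.symm.trans ?_
  ext i j
  refine hcancel _ _ ?_
  rw [← hM, mul_one, hf.ortho, Matrix.one_apply]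
  split_ifs <;> simp

end IsColumn

/-- A quantitative form of Hilbert–Schmidt stability, on a finite set. -/
def MatrixStability {H : Type*} [Group H] (F : Finset H) (S : Finset (H × H)) (ε C : ℝ) : Prop :=
  ∀ k > 0, ∀ φ : H → Matrix.unitaryGroup (Fin k) ℂ,
    ∃ π : H →* Matrix.unitaryGroup (Fin k) ℂ,
      ∑ h ∈ F, hsNorm ((φ h).1 - (π h).1) ^ 2 ≤
        ε + C * ∑ s ∈ S, hsNorm ((φ (s.1 * s.2)).1 - (φ s.1).1 * (φ s.2).1) ^ 2

/-- Induction on the rank of a central projection p: split off a matrix block with central support z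
≤ p and treat p - z inductively. The two pieces are orthogonal, so homomorphisms and squared errors
add. As ε and C do not depend on the block size, the weights of the blocks sum to the weight of p.
-/
theorem MatrixStability.exists_partial {H : Type*} [Group H] {F : Finset H} {S : Finset (H × H)}
    {ε C : ℝ} (hst : MatrixStability F S ε C) (ψ : H → A.U) (n : ℕ) :
    ∀ p : A.Elem, IsProj p → (∀ a, p * a = a * p) → rank p = n →
      ∃ π : H → A.Elem, (∀ g h, π (g * h) = π g * π h) ∧ π 1 = p ∧
        (∀ h, star (π h) * π h = p) ∧
        ∑ h ∈ F, A.normSq (p * ψ h - π h) ≤ ε * A.normSq p + C * ∑ s ∈ S,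
          A.normSq (p * ((ψ (s.1 * s.2) : A.Elem) - (ψ s.1 : A.Elem) * (ψ s.2 : A.Elem))) := by
  induction n using Nat.strong_induction_on with
  | _ n ih =>
  intro p hp hpc hpn
  by_cases hp0 : p = 0
  · subst hp0
    have h0 : A.normSq 0 = 0 := by simp [normSq]
    exact ⟨fun _ => 0, by simp, rfl, by simp, by simp [h0]⟩
  obtain ⟨e, he, hpe⟩ := exists_isMinimalProj hp hp0
  have hep := he.toIsProj
  obtain ⟨k, f, hk, hf, hzc⟩ := exists_isColumn_central he
  set z := IsColumn.supp f with hz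
  have hzp : IsProj z := hf.isProj_supp hep
  have hpf : ∀ i, p * f i = f i := fun i => by
    rw [← hf.mul_eq hep, ← mul_assoc, hpc, mul_assoc, hpe]
  have hpz : p * z = z := by
    rw [hz, IsColumn.supp, Finset.mul_sum]
    exact Finset.sum_congr rfl fun i _ => by rw [← mul_assoc, hpf]
  have hzp' : z * p = z := by rw [← hpc, hpz]
  have hez := IsProj.normSq_pos he.ne_zero
  have hz0 : z ≠ 0 := by
    intro h
    have h1 := hf.normSq_supp hep
    rw [← hz, h] at h1
    have h0 : A.normSq 0 = 0 := by simp [normSq]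
    rw [h0] at h1
    have : 0 < k * A.normSq e := by positivity
    linarith
  set q := p - z with hq
  have hqp : IsProj q := by
    refine ⟨by rw [hq, star_sub, hp.star_eq, hzp.star_eq], ?_⟩
    rw [hq, sub_mul, mul_sub, mul_sub, hp.mul_self, hpz, hzp', hzp.mul_self]
    abel
  have hqc : ∀ a, q * a = a * q := fun a => by rw [hq, sub_mul, mul_sub, hpc, hzc]
  have hzq : z * q = 0 := by rw [hq, mul_sub, hzp', hzp.mul_self, sub_self]
  have hpq : p = z + q := by rw [hq]; abel
  have horth : ∀ x y, z * x = x → q * y = y → star x * y = 0 := by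
    intro x y hx hy
    rw [← hx, ← hy, star_mul, hzp.star_eq, mul_assoc, ← mul_assoc z, hzq, zero_mul, mul_zero]
  have horth' : ∀ x y, z * x = x → q * y = y → x * y = 0 := by
    intro x y hx hy
    rw [← hx, hzc, ← hy, mul_assoc, ← mul_assoc z, hzq, zero_mul, mul_zero]
  have horth'' : ∀ x y, z * x = x → q * y = y → y * x = 0 := by
    intro x y hx hy
    rw [← hx, ← hy, hqc, mul_assoc, ← mul_assoc q, ← hzc, hzq, zero_mul, mul_zero]
  obtain ⟨σ, hσmul, hσ1, hσs, hσ⟩ := ih (rank q)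
    (hpn ▸ rank_sub_lt hp hzp hpz hzp' hz0) q hqp hqc rfl
  obtain ⟨M, hM, hMmul, hMsub, hMu⟩ := hf.exists_coeff he hzc
  -- Matrix stability on the block z; below, the estimate is multiplied by τ(z) = k τ(e) to turn
  -- normalized Hilbert–Schmidt norms into norms of A.
  obtain ⟨ρ, hρ⟩ := hst k hk fun h => ⟨M (ψ h), hMu _⟩
  set θ : H → A.Elem := fun h => IsColumn.mat f (ρ h).1 with hθ
  have hθz : ∀ h, z * θ h = θ h := fun h => hf.supp_mul_mat hep _
  have hqσ : ∀ h, q * σ h = σ h := fun h => by rw [← hσ1, ← hσmul, one_mul]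
  refine ⟨fun h => θ h + σ h, fun g h => ?_, ?_, fun h => ?_, ?_⟩
  · change θ (g * h) + σ (g * h) = (θ g + σ g) * (θ h + σ h)
    rw [add_mul, mul_add, mul_add, horth' _ _ (hθz g) (hqσ h), horth'' _ _ (hθz h) (hqσ g), hσmul,
      add_zero, zero_add]
    congr 1
    simp only [hθ, map_mul]
    exact hf.mat_mul hep _ _
  · change θ 1 + σ 1 = p
    rw [hσ1, hpq]
    congr 1
    simp only [hθ, map_one]
    exact IsColumn.mat_one f
  · have h1 := horth _ _ (hθz h) (hqσ h)
    have h2 : star (σ h) * θ h = 0 := by simpa using congrArg star h1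
    rw [star_add, add_mul, mul_add, mul_add, h1, h2, hσs, add_zero, zero_add, hpq]
    congr 1
    simp only [hθ]
    rw [← IsColumn.mat_conjTranspose, ← hf.mat_mul hep]
    have h3 : (ρ h).1.conjTranspose * (ρ h).1 = 1 :=
      Matrix.mem_unitaryGroup_iff'.1 (ρ h).2
    rw [h3, IsColumn.mat_one]
  · have hsum : ∀ x y, z * x = x → q * y = y → A.normSq (x + y) = A.normSq x + A.normSq y :=
      fun x y hx hy => normSq_add_of_orthogonal (horth x y hx hy)
    have hzx : ∀ x, z * (z * x) = z * x := fun x => by rw [← mul_assoc, hzp.mul_self]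
    have hqx : ∀ x, q * (q * x) = q * x := fun x => by rw [← mul_assoc, hqp.mul_self]
    have e1 : ∀ h, A.normSq (p * ψ h - (θ h + σ h)) =
        A.normSq (z * ψ h - θ h) + A.normSq (q * ψ h - σ h) := fun h => by
      rw [← hsum _ _ (by rw [mul_sub, hzx, hθz]) (by rw [mul_sub, hqx, hqσ]), hpq]
      congr 1; noncomm_ring
    have e2 : ∀ x, A.normSq (p * x) = A.normSq (z * x) + A.normSq (q * x) := fun x => by
      rw [← hsum _ _ (hzx x) (hqx x), hpq, add_mul]
    have e3 : A.normSq p = A.normSq z + A.normSq q := by simpa using e2 1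
    have e4 : ∀ h, A.normSq (z * ψ h - θ h) =
        hsNorm (M (ψ h) - (ρ h).1) ^ 2 * (k * A.normSq e) := fun h => by
      rw [← hf.normSq_mat hep _ hk, IsColumn.mat_sub, hM]
    have e5 : ∀ g h, A.normSq (z * ((ψ (g * h) : A.Elem) - (ψ g : A.Elem) * (ψ h : A.Elem))) =
        hsNorm (M (ψ (g * h)) - M (ψ g) * M (ψ h)) ^ 2 * (k * A.normSq e) := fun g h => by
      rw [← hf.normSq_mat hep _ hk, ← hMmul, ← hMsub, hM]
    have e6 : A.normSq z = k * A.normSq e := hf.normSq_supp hep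
    simp only [e1, e2, e3, Finset.sum_add_distrib, e4, e5, e6, ← Finset.sum_mul]
    have h7 : (0 : ℝ) ≤ k * A.normSq e := by positivity
    have h8 := mul_le_mul_of_nonneg_right hρ h7
    linarith

/-- Quantitative stability for matrices implies quantitative stability for all finite-dimensional
tracial von Neumann algebras. -/
theorem MatrixStability.exists_hom {H : Type*} [Group H] {F : Finset H} {S : Finset (H × H)}
    {ε C : ℝ} (hst : MatrixStability F S ε C) (ψ : H → A.U) :
    ∃ π : H →* A.U, ∑ h ∈ F, A.normSq ((ψ h : A.Elem) - (π h : A.Elem)) ≤ ε + C * ∑ s ∈ S,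
      A.normSq ((ψ (s.1 * s.2) : A.Elem) - (ψ s.1 : A.Elem) * (ψ s.2 : A.Elem)) := by
  obtain ⟨π, hmul, h1, hs, h⟩ := hst.exists_partial ψ _ (1 : A.Elem)
    ⟨star_one _, one_mul _⟩ (fun a => by rw [one_mul, mul_one]) rfl
  have hinv : ∀ h, π h * star (π h) = 1 := fun h => by
    have h2 : π h * π h⁻¹ = 1 := by rw [← hmul, mul_inv_cancel, h1]
    have h3 : star (π h) = π h⁻¹ := left_inv_eq_right_inv (hs h) h2
    rw [h3, h2]
  refine ⟨{ toFun := fun h => ⟨π h, Unitary.mem_iff.2 ⟨hs h, hinv h⟩⟩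
            map_one' := Subtype.ext h1
            map_mul' := fun g h => Subtype.ext (hmul g h) }, ?_⟩
  have h0 : A.normSq 1 = 1 := normSq_unitary (1 : A.U)
  simpa [h0] using h

end TracialVNA

/-! ### Property (T) -/

section PropertyT

variable {G : Type u} [Group G]

/-- In a group with property (T), the distance to the invariant vectors is controlled by the
displacement under a fixed finite set. -/
theorem HasPropertyT.exists_bound (hG : HasPropertyT.{u, v} G) :
    ∃ (Q : Finset G) (c : ℝ),
      ∀ (K : Type v) [NormedAddCommGroup K] [InnerProductSpace ℂ K] [CompleteSpace K]
        (π : G →* unitary (K →L[ℂ] K)) (ξ : K),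
        ‖ξ - (invariantVectors π).starProjection ξ‖ ^ 2 ≤
          c * ∑ g ∈ Q, ‖(π g : K →L[ℂ] K) ξ - ξ‖ ^ 2 := by
  obtain ⟨Q, ε, hε, h⟩ := hG
  refine ⟨Q, (ε ^ 2)⁻¹, ?_⟩
  intro K _ _ _ π ξ
  set P := (invariantVectors π).starProjection with hP
  -- The representation on V has no nonzero invariant vector, so by property (T) each η in V is
  -- moved by at least ε ‖η‖ by some g in Q. The displacement of ξ equals that of its component in
  -- V.
  set V := (invariantVectors π)ᗮ with hV
  have hmap : ∀ g, ∀ η ∈ V, (π g : K →L[ℂ] K) η ∈ V := by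
    intro g η hη
    rw [hV, ← Submodule.starProjection_apply_eq_zero_iff] at hη ⊢
    rw [starProjection_invariantVectors_apply, hη]
  let ρ₀ : G →* (V →L[ℂ] V) :=
    { toFun := fun g => ((π g : K →L[ℂ] K).comp V.subtypeL).codRestrict V
        fun η => hmap g η.1 η.2
      map_one' := by ext η; simp
      map_mul' := fun g g' => by
        ext η
        exact congrArg (fun u : unitary (K →L[ℂ] K) => (u : K →L[ℂ] K) η.1) (map_mul π g g') }
  let ρ : G →* unitary (V →L[ℂ] V) := unitaryRep ρ₀ fun g η => Unitary.norm_map (π g) η.1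
  have key : ∀ η : V, η ≠ 0 → ∃ g ∈ Q, ε * ‖η‖ ≤ ‖(π g : K →L[ℂ] K) η - η‖ := by
    intro η hη
    by_contra! hcon
    have hn : 0 < ‖η‖ := norm_pos_iff.2 hη
    obtain ⟨ζ, hζ0, hζ⟩ := h V ρ ⟨((‖η‖⁻¹ : ℝ) : ℂ) • η, by
      rw [norm_smul, Complex.norm_real, norm_inv, norm_norm, inv_mul_cancel₀ hn.ne'], by
      intro g hg
      rw [map_smul, ← smul_sub, norm_smul, Complex.norm_real, norm_inv, norm_norm,
        inv_mul_lt_iff₀ hn, mul_comm]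
      exact hcon g hg⟩
    refine hζ0 (Subtype.ext ?_)
    have h1 : ζ.1 ∈ invariantVectors π := fun g => congrArg Subtype.val (hζ g)
    exact Submodule.disjoint_def.1 (invariantVectors π).orthogonal_disjoint ζ.1 h1 ζ.2
  have hη : ξ - P ξ ∈ V := Submodule.sub_starProjection_mem_orthogonal ξ
  have hPξ : ∀ g, (π g : K →L[ℂ] K) (P ξ) = P ξ :=
    mem_invariantVectors.1 (Submodule.starProjection_apply_mem _ _)
  rw [le_inv_mul_iff₀ (by positivity)]
  by_cases h0 : (⟨ξ - P ξ, hη⟩ : V) = 0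
  · have h1 : ξ - P ξ = 0 := congrArg Subtype.val h0
    rw [h1, norm_zero]
    have : 0 ≤ ∑ g ∈ Q, ‖(π g : K →L[ℂ] K) ξ - ξ‖ ^ 2 := Finset.sum_nonneg fun _ _ => by positivity
    simpa using this
  · obtain ⟨g, hg, hle⟩ := key _ h0
    have h1 : (π g : K →L[ℂ] K) (ξ - P ξ) - (ξ - P ξ) = (π g : K →L[ℂ] K) ξ - ξ := by
      rw [map_sub, hPξ]; abel
    change ε * ‖ξ - P ξ‖ ≤ ‖(π g : K →L[ℂ] K) (ξ - P ξ) - (ξ - P ξ)‖ at hle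
    rw [h1] at hle
    rw [← mul_pow]
    refine (pow_le_pow_left₀ (by positivity) hle 2).trans ?_
    exact Finset.single_le_sum (f := fun g => ‖(π g : K →L[ℂ] K) ξ - ξ‖ ^ 2)
      (fun _ _ => by positivity) hg

end PropertyT

/-! ### Matrix algebras -/

section MatrixAlgebra

/-- The Hilbert space on which the `d × d` matrices act. -/
abbrev MatSpace (d : ℕ) : Type v := EuclideanSpace ℂ (ULift.{v} (Fin d))

/-- Matrices as operators. -/
def matEquiv (d : ℕ) : Matrix (Fin d) (Fin d) ℂ ≃⋆ₐ[ℂ] (MatSpace.{v} d →L[ℂ] MatSpace.{v} d) :=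
  (Matrix.toEuclideanCLM (n := Fin d) (𝕜 := ℂ)).trans
    (LinearIsometryEquiv.piLpCongrLeft 2 ℂ ℂ
      (Equiv.ulift.symm : Fin d ≃ ULift.{v} (Fin d))).conjStarAlgEquiv

/-- Operators as matrices. -/
def opMat (d : ℕ) (x : MatSpace.{v} d →L[ℂ] MatSpace.{v} d) : Matrix (Fin d) (Fin d) ℂ :=
  (matEquiv d).symm x

theorem matEquiv_opMat (d : ℕ) (x : MatSpace.{v} d →L[ℂ] MatSpace.{v} d) :
    matEquiv d (opMat d x) = x := (matEquiv d).apply_symm_apply x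

theorem opMat_matEquiv (d : ℕ) (a : Matrix (Fin d) (Fin d) ℂ) :
    opMat d (matEquiv.{v} d a) = a := (matEquiv.{v} d).symm_apply_apply a

theorem matEquiv_injective (d : ℕ) : Function.Injective fun a => matEquiv.{v} d a :=
  Function.LeftInverse.injective (g := opMat d) (opMat_matEquiv d)

theorem matEquiv_add (d : ℕ) (a b : Matrix (Fin d) (Fin d) ℂ) :
    matEquiv.{v} d (a + b) = matEquiv d a + matEquiv d b := map_add (matEquiv d) a b

theorem matEquiv_smul (d : ℕ) (c : ℂ) (a : Matrix (Fin d) (Fin d) ℂ) :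
    matEquiv.{v} d (c • a) = c • matEquiv d a := map_smul (matEquiv d) c a

theorem matEquiv_mul (d : ℕ) (a b : Matrix (Fin d) (Fin d) ℂ) :
    matEquiv.{v} d (a * b) = matEquiv d a * matEquiv d b := map_mul (matEquiv d) a b

theorem matEquiv_star (d : ℕ) (a : Matrix (Fin d) (Fin d) ℂ) :
    matEquiv.{v} d (star a) = star (matEquiv d a) := map_star (matEquiv d) a

theorem matEquiv_one (d : ℕ) : matEquiv.{v} d 1 = 1 := map_one (matEquiv d)

theorem opMat_mul (d : ℕ) (x y : MatSpace.{v} d →L[ℂ] MatSpace.{v} d) :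
    opMat d (x * y) = opMat d x * opMat d y :=
  matEquiv_injective d (by beta_reduce; rw [matEquiv_mul, matEquiv_opMat, matEquiv_opMat, matEquiv_opMat])

theorem opMat_star (d : ℕ) (x : MatSpace.{v} d →L[ℂ] MatSpace.{v} d) :
    opMat d (star x) = star (opMat d x) :=
  matEquiv_injective d (by beta_reduce; rw [matEquiv_star, matEquiv_opMat, matEquiv_opMat])

theorem opMat_one (d : ℕ) : opMat.{v} d 1 = 1 :=
  matEquiv_injective d (by beta_reduce; rw [matEquiv_one, matEquiv_opMat])

theorem opMat_add (d : ℕ) (x y : MatSpace.{v} d →L[ℂ] MatSpace.{v} d) :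
    opMat d (x + y) = opMat d x + opMat d y :=
  matEquiv_injective d (by
    beta_reduce
    rw [matEquiv_add, matEquiv_opMat, matEquiv_opMat, matEquiv_opMat])

theorem opMat_smul (d : ℕ) (c : ℂ) (x : MatSpace.{v} d →L[ℂ] MatSpace.{v} d) :
    opMat d (c • x) = c • opMat d x :=
  matEquiv_injective d (by
    beta_reduce
    rw [matEquiv_smul, matEquiv_opMat, matEquiv_opMat])

/-- Writes diagonal entries, hence the trace, as vector functionals, from which normality follows.
-/
theorem inner_matEquiv (d : ℕ) (a : Matrix (Fin d) (Fin d) ℂ) (i : Fin d) :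
    ⟪EuclideanSpace.single (ULift.up.{v} i) (1 : ℂ),
      matEquiv.{v} d a (EuclideanSpace.single (ULift.up i) 1)⟫_ℂ = a i i := by
  rw [EuclideanSpace.inner_single_left, map_one, one_mul]
  have h : (LinearIsometryEquiv.piLpCongrLeft 2 ℂ ℂ
      (Equiv.ulift.symm : Fin d ≃ ULift.{v} (Fin d))).symm
      (EuclideanSpace.single (ULift.up i) 1) = EuclideanSpace.single i 1 := by
    ext j
    simp [LinearIsometryEquiv.piLpCongrLeft_symm]
  change (LinearIsometryEquiv.piLpCongrLeft 2 ℂ ℂ _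
    (Matrix.toEuclideanCLM (𝕜 := ℂ) a ((LinearIsometryEquiv.piLpCongrLeft 2 ℂ ℂ _).symm _)))
      (ULift.up i) = _
  rw [h]
  simp [EuclideanSpace.single]

/-- A vector functional is the case of sequences supported at index 0. -/
theorem continuous_inner_ultraweak {H : Type v} [NormedAddCommGroup H] [InnerProductSpace ℂ H]
    [CompleteSpace H] (ξ η : H) :
    @Continuous _ _ (ultraweakTopology H) _ fun x : H →L[ℂ] H => ⟪ξ, x η⟫_ℂ := by
  let _ : TopologicalSpace (H →L[ℂ] H) := ultraweakTopology H
  have h : (fun x : H →L[ℂ] H => ⟪ξ, x η⟫_ℂ) = fun x : H →L[ℂ] H =>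
      ∑' n, ⟪(lp.single 2 (0 : ℕ) ξ : lp (fun _ : ℕ => H) 2) n,
        x ((lp.single 2 (0 : ℕ) η : lp (fun _ : ℕ => H) 2) n)⟫_ℂ := by
    funext x
    rw [tsum_eq_single 0]
    · simp
    · intro n hn
      simp [lp.single_apply, hn]
  rw [h]
  exact continuous_iInf_dom (continuous_iInf_dom continuous_induced_dom)

/-- All bounded operators, as a von Neumann algebra. -/
def vonNeumannTop (H : Type v) [NormedAddCommGroup H] [InnerProductSpace ℂ H] [CompleteSpace H] :
    VonNeumannAlgebra H where
  toStarSubalgebra := ⊤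
  centralizer_centralizer' := by
    have h : (univ : Set (H →L[ℂ] H)).centralizer.centralizer = univ :=
      eq_univ_of_univ_subset Set.subset_centralizer_centralizer
    exact h

/-- The normalized trace on operators. -/
def matTrace (d : ℕ) : (vonNeumannTop (MatSpace.{v} d)).toStarSubalgebra →ₗ[ℂ] ℂ where
  toFun x := (d : ℂ)⁻¹ * (opMat d x.1).trace
  map_add' x y := by
    change _ * (opMat d (x.1 + y.1)).trace = _
    rw [opMat_add, Matrix.trace_add, mul_add]
  map_smul' c x := by
    change _ * (opMat d (c • x.1)).trace = _
    rw [opMat_smul, Matrix.trace_smul, smul_eq_mul, smul_eq_mul, mul_left_comm]; rfl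

theorem isNormalFaithfulTracialState_matTrace {d : ℕ} (hd : 0 < d) :
    IsNormalFaithfulTracialState (vonNeumannTop (MatSpace.{v} d)) (matTrace d) where
  nonneg x := by
    change 0 ≤ (d : ℂ)⁻¹ * (opMat d (star x.1 * x.1)).trace
    rw [opMat_mul, opMat_star]
    exact mul_nonneg (by positivity) (Matrix.posSemidef_conjTranspose_mul_self _).trace_nonneg
  map_one := by
    change (d : ℂ)⁻¹ * (opMat d 1).trace = 1
    rw [opMat_one, Matrix.trace_one, Fintype.card_fin]
    exact inv_mul_cancel₀ (by exact_mod_cast hd.ne')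
  faithful x hx := by
    change (d : ℂ)⁻¹ * (opMat d (star x.1 * x.1)).trace = 0 at hx
    rw [opMat_mul, opMat_star, mul_eq_zero, Matrix.star_eq_conjTranspose,
      Matrix.trace_conjTranspose_mul_self_eq_zero_iff] at hx
    rcases hx with hx | hx
    · exact absurd hx (inv_ne_zero (by exact_mod_cast hd.ne'))
    · refine Subtype.ext ?_
      rw [← matEquiv_opMat d x.1, hx, map_zero]; rfl
  tracial x y := by
    change (d : ℂ)⁻¹ * (opMat d (x.1 * y.1)).trace =
      (d : ℂ)⁻¹ * (opMat d (y.1 * x.1)).trace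
    rw [opMat_mul, opMat_mul, Matrix.trace_mul_comm]
  normal := by
    let _ : TopologicalSpace (MatSpace.{v} d →L[ℂ] MatSpace.{v} d) := ultraweakTopology _
    have h : (matTrace.{v} d : (vonNeumannTop (MatSpace.{v} d)).toStarSubalgebra → ℂ) = fun x =>
        (d : ℂ)⁻¹ * ∑ i, ⟪EuclideanSpace.single (ULift.up.{v} i) (1 : ℂ),
          x.1 (EuclideanSpace.single (ULift.up i) 1)⟫_ℂ := by
      funext x
      change (d : ℂ)⁻¹ * (opMat d x.1).trace = _
      congr 1
      refine Finset.sum_congr rfl fun i _ => ?_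
      rw [Matrix.diag_apply, ← inner_matEquiv.{v} d (opMat d x.1) i, matEquiv_opMat]
    rw [h]
    refine continuous_const.mul (continuous_finsetSum _ fun i _ => ?_)
    exact (continuous_inner_ultraweak _ _).comp continuous_subtype_val

/-- The `d × d` matrices, as a tracial von Neumann algebra. -/
def matVNA (d : ℕ) (hd : 0 < d) : TracialVNA.{v} where
  H := MatSpace.{v} d
  M := vonNeumannTop _
  τ := matTrace d
  isState := isNormalFaithfulTracialState_matTrace hd

/-- Unitary matrices, as unitary elements of `matVNA`. -/
def matU {d : ℕ} (hd : 0 < d) : Matrix.unitaryGroup (Fin d) ℂ ≃* (matVNA.{v} d hd).U where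
  toFun u := ⟨⟨matEquiv d u.1, trivial⟩, Unitary.mem_iff.2
    ⟨Subtype.ext (by
      change star (matEquiv d u.1) * matEquiv d u.1 = 1
      rw [← matEquiv_star, ← matEquiv_mul, Unitary.star_mul_self_of_mem u.2, matEquiv_one]),
    Subtype.ext (by
      change matEquiv d u.1 * star (matEquiv d u.1) = 1
      rw [← matEquiv_star, ← matEquiv_mul, Unitary.mul_star_self_of_mem u.2, matEquiv_one])⟩⟩
  invFun u := ⟨opMat d u.1.1, Unitary.mem_iff.2
    ⟨by
      refine (congrArg (· * _) (opMat_star.{v} d _)).symm.trans ((opMat_mul.{v} d _ _).symm.trans ?_)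
      refine (congrArg (opMat.{v} d) ?_).trans (opMat_one d)
      exact congrArg Subtype.val (Unitary.star_mul_self_of_mem u.2),
    by
      refine (congrArg (_ * ·) (opMat_star.{v} d _)).symm.trans ((opMat_mul.{v} d _ _).symm.trans ?_)
      refine (congrArg (opMat.{v} d) ?_).trans (opMat_one d)
      exact congrArg Subtype.val (Unitary.mul_star_self_of_mem u.2)⟩⟩
  left_inv u := Subtype.ext ((matEquiv d).symm_apply_apply u.1)
  right_inv u := Subtype.ext (Subtype.ext ((matEquiv d).apply_symm_apply u.1.1))
  map_mul' u w := Subtype.ext (Subtype.ext (map_mul (matEquiv d) u.1 w.1))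

theorem normSq_matVNA {d : ℕ} (hd : 0 < d) (a : Matrix (Fin d) (Fin d) ℂ) :
    (matVNA.{v} d hd).normSq ⟨matEquiv.{v} d a, trivial⟩ = hsNorm a ^ 2 := by
  change ((d : ℂ)⁻¹ * (opMat d (star (matEquiv.{v} d a) * matEquiv.{v} d a)).trace).re = _
  rw [hsNorm_sq, ← matEquiv_star, ← matEquiv_mul, opMat_matEquiv, ← Complex.ofReal_natCast,
    ← Complex.ofReal_inv, Complex.re_ofReal_mul, inv_mul_eq_div, Matrix.star_eq_conjTranspose]

theorem normSq_matU_sub {d : ℕ} (hd : 0 < d) (u w : Matrix.unitaryGroup (Fin d) ℂ) :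
    (matVNA.{v} d hd).normSq ((matU hd u : (matVNA.{v} d hd).Elem) - matU hd w) =
      hsNorm (u.1 - w.1) ^ 2 :=
  (congrArg (matVNA.{v} d hd).normSq
    (Subtype.ext (map_sub (matEquiv.{v} d) u.1 w.1).symm)).trans (normSq_matVNA hd _)

theorem normSq_matU_sub_mul {d : ℕ} (hd : 0 < d) (u w z : Matrix.unitaryGroup (Fin d) ℂ) :
    (matVNA.{v} d hd).normSq ((matU hd u : (matVNA.{v} d hd).Elem) - matU hd w * matU hd z) =
      hsNorm (u.1 - w.1 * z.1) ^ 2 := by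
  have := normSq_matU_sub.{v} hd u (w * z)
  rwa [map_mul] at this

theorem hsNorm_nonneg {d : ℕ} (a : Matrix (Fin d) (Fin d) ℂ) : 0 ≤ hsNorm a := Real.sqrt_nonneg _

theorem tendsto_hsNorm_sq_iff {d : ℕ → ℕ} {a : ∀ n, Matrix (Fin (d n)) (Fin (d n)) ℂ} :
    Tendsto (fun n => hsNorm (a n) ^ 2) atTop (𝓝 0) ↔ Tendsto (fun n => hsNorm (a n)) atTop (𝓝 0) := by
  constructor
  · intro h
    have := h.sqrt
    simpa [Real.sqrt_sq (hsNorm_nonneg _)] using this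
  · intro h
    simpa using h.pow 2

/-- Hilbert–Schmidt stability in terms of the matrix algebras as tracial von Neumann algebras. -/
theorem isHilbertSchmidtStable_iff {G : Type u} [Group G] :
    IsHilbertSchmidtStable G ↔ ∀ (d : ℕ → ℕ) (hd : ∀ n, 0 < d n)
      (φ : ∀ n, G → (matVNA.{v} (d n) (hd n)).U),
      (∀ g h, Tendsto (fun n => (matVNA.{v} (d n) (hd n)).normSq
        ((φ n (g * h) : (matVNA.{v} (d n) (hd n)).Elem) - φ n g * φ n h)) atTop (𝓝 0)) →
      ∃ π : ∀ n, G →* (matVNA.{v} (d n) (hd n)).U, ∀ g, Tendsto (fun n =>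
        (matVNA.{v} (d n) (hd n)).normSq
          ((φ n g : (matVNA.{v} (d n) (hd n)).Elem) - π n g)) atTop (𝓝 0) := by
  constructor
  · intro hG d hd φ hφ
    obtain ⟨π, hπ⟩ := hG d hd (fun n g => (matU (hd n)).symm (φ n g)) fun g h => by
      rw [← tendsto_hsNorm_sq_iff]
      simpa [← normSq_matU_sub_mul.{v} (hd _)] using hφ g h
    refine ⟨fun n => (matU (hd n)).toMonoidHom.comp (π n), fun g => ?_⟩
    have := tendsto_hsNorm_sq_iff.2 (hπ g)
    simpa [← normSq_matU_sub.{v} (hd _)] using this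
  · intro hG d hd φ hφ
    obtain ⟨π, hπ⟩ := hG d hd (fun n g => matU (hd n) (φ n g)) fun g h => by
      simpa [normSq_matU_sub_mul.{v} (hd _)] using tendsto_hsNorm_sq_iff.2 (hφ g h)
    refine ⟨fun n => (matU.{v} (hd n)).symm.toMonoidHom.comp (π n), fun g => ?_⟩
    rw [← tendsto_hsNorm_sq_iff]
    simpa [← normSq_matU_sub.{v} (hd _)] using hπ g

theorem hsNorm_sub_unitary_sq_le {d : ℕ} (hd : 0 < d) (u w : Matrix.unitaryGroup (Fin d) ℂ) :
    hsNorm (u.1 - w.1) ^ 2 ≤ 4 := by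
  rw [← normSq_matU_sub.{0} hd]
  exact TracialVNA.normSq_sub_unitary_le _ _

end MatrixAlgebra

/-- A countable Hilbert–Schmidt stable group satisfies quantitative stability on finite sets. -/
theorem IsHilbertSchmidtStable.exists_matrixStability {H : Type u} [Group H] [Countable H]
    (hH : IsHilbertSchmidtStable H) (F : Finset H) {ε : ℝ} (hε : 0 < ε) :
    ∃ (S : Finset (H × H)) (C : ℝ), TracialVNA.MatrixStability F S ε C := by
  classical
  by_contra! hcon
  -- If no S and C work, take a counterexample φ n for the first n pairs of an enumeration and C =
  -- n. Comparison with the trivial homomorphism bounds n times the sum of its squared defects by 4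
  -- |F|, so the φ n form an asymptotic homomorphism, yet they stay away from all homomorphisms by ε
  -- on F.
  obtain ⟨f, hf⟩ := exists_surjective_nat (H × H)
  have h1 : ∀ n : ℕ, ∃ (k : ℕ) (_ : 0 < k) (φ : H → Matrix.unitaryGroup (Fin k) ℂ),
      ∀ π : H →* Matrix.unitaryGroup (Fin k) ℂ,
        ε + (n : ℝ) * ∑ s ∈ (Finset.range n).image f,
          hsNorm ((φ (s.1 * s.2)).1 - (φ s.1).1 * (φ s.2).1) ^ 2 <
            ∑ h ∈ F, hsNorm ((φ h).1 - (π h).1) ^ 2 := by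
    intro n
    have := hcon ((Finset.range n).image f) n
    simp only [TracialVNA.MatrixStability, not_forall, not_exists, not_le] at this
    obtain ⟨k, hk, φ, h⟩ := this
    exact ⟨k, hk, φ, h⟩
  choose k hk φ hφ using h1
  have hbound : ∀ n : ℕ, (n : ℝ) * ∑ s ∈ (Finset.range n).image f,
      hsNorm ((φ n (s.1 * s.2)).1 - (φ n s.1).1 * (φ n s.2).1) ^ 2 ≤ 4 * F.card := by
    intro n
    have h2 := hφ n 1
    have h3 : ∑ h ∈ F, hsNorm ((φ n h).1 - ((1 : H →* Matrix.unitaryGroup (Fin (k n)) ℂ) h).1) ^ 2 ≤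
        ∑ _h ∈ F, (4 : ℝ) := Finset.sum_le_sum fun h _ => hsNorm_sub_unitary_sq_le (hk n) _ _
    rw [Finset.sum_const, nsmul_eq_mul] at h3
    linarith
  obtain ⟨π, hπ⟩ := hH k hk φ fun g h => by
    rw [← tendsto_hsNorm_sq_iff]
    obtain ⟨m, hm⟩ := hf (g, h)
    refine squeeze_zero' (Eventually.of_forall fun n => by positivity) ?_
      (tendsto_const_div_atTop_nhds_zero_nat (4 * (F.card : ℝ)))
    filter_upwards [eventually_gt_atTop m] with n hn
    rw [le_div_iff₀ (by exact_mod_cast (Nat.zero_le m).trans_lt hn), mul_comm]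
    refine le_trans ?_ (hbound n)
    gcongr
    refine Finset.single_le_sum
      (f := fun s : H × H => hsNorm ((φ n (s.1 * s.2)).1 - (φ n s.1).1 * (φ n s.2).1) ^ 2)
      (fun _ _ => by positivity) (a := (g, h)) ?_
    exact Finset.mem_image.2 ⟨m, Finset.mem_range.2 hn, hm⟩
  have h4 : Tendsto (fun n => ∑ h ∈ F, hsNorm ((φ n h).1 - (π n h).1) ^ 2) atTop (𝓝 0) := by
    have := tendsto_finsetSum F fun h _ => tendsto_hsNorm_sq_iff.2 (hπ h)
    simpa using this
  obtain ⟨n, hn⟩ := (h4.eventually_lt_const hε).exists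
  have h5 := hφ n (π n)
  have h6 : 0 ≤ (n : ℝ) * ∑ s ∈ (Finset.range n).image f,
      hsNorm ((φ n (s.1 * s.2)).1 - (φ n s.1).1 * (φ n s.2).1) ^ 2 :=
    mul_nonneg n.cast_nonneg (Finset.sum_nonneg fun _ _ => by positivity)
  linarith

/-! ### Hilbert–Schmidt stability of products -/

open TracialVNA

/-- Take for m(n) the largest m ≤ n such that E m n holds; each fixed level is eventually available.
-/
theorem exists_tendsto_diagonal {E : ℕ → ℕ → Prop} (h : ∀ m, ∀ᶠ n in atTop, E m n) :
    ∃ m : ℕ → ℕ, Tendsto m atTop atTop ∧ ∀ᶠ n in atTop, E (m n) n := by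
  classical
  refine ⟨fun n => Nat.findGreatest (fun m => E m n) n, ?_, ?_⟩
  · refine tendsto_atTop.2 fun M => ?_
    filter_upwards [h M, eventually_ge_atTop M] with n hn hM
    exact Nat.le_findGreatest hM hn
  -- `Nat.findGreatest` returns 0 when nothing is found, so level 0 has to hold as well.
  · filter_upwards [h 0] with n hn
    exact Nat.findGreatest_spec (P := fun m => E m n) (Nat.zero_le n) hn

/-- An asymptotic homomorphism of a Hilbert–Schmidt stable group to finite-dimensional tracial
von Neumann algebras is close to homomorphisms. -/
theorem IsHilbertSchmidtStable.exists_hom {H : Type u} [Group H] [Countable H]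
    (hH : IsHilbertSchmidtStable H) (B : ℕ → TracialVNA.{v}) [∀ n, FiniteDimensional ℂ (B n).H]
    (ψ : ∀ n, H → (B n).U)
    (hψ : ∀ g h, Tendsto (fun n => (B n).normSq ((ψ n (g * h) : (B n).Elem) - ψ n g * ψ n h))
      atTop (𝓝 0)) :
    ∃ π : ∀ n, H →* (B n).U, ∀ h, Tendsto (fun n => (B n).normSq ((ψ n h : (B n).Elem) - π n h))
      atTop (𝓝 0) := by
  classical
  obtain ⟨f, hf⟩ := exists_surjective_nat H
  have hpos : ∀ m : ℕ, (0 : ℝ) < 1 / (m + 1) := fun m => by positivity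
  -- Level m controls the first m elements of H up to 1/(m + 1). The constants C m may grow, but for
  -- fixed m the defect term tends to 0 in n, so m may go to infinity slowly with n.
  choose S C hSC using fun m : ℕ =>
    hH.exists_matrixStability ((Finset.range m).image f) (hpos m)
  choose ρ hρ using fun m n => (hSC m).exists_hom (ψ n)
  set b : ℕ → ℕ → ℝ := fun m n => 1 / (m + 1) + C m * ∑ s ∈ S m,
    (B n).normSq ((ψ n (s.1 * s.2) : (B n).Elem) - ψ n s.1 * ψ n s.2) with hb
  have hev : ∀ m, ∀ᶠ n in atTop, b m n < 2 * (1 / (m + 1)) := by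
    intro m
    have h1 : Tendsto (b m) atTop (𝓝 (1 / (m + 1) + C m * ∑ _s ∈ S m, 0)) :=
      ((tendsto_finsetSum _ fun s _ => hψ s.1 s.2).const_mul _).const_add _
    refine h1.eventually_lt_const ?_
    have := hpos m
    simp only [Finset.sum_const_zero, mul_zero, add_zero]
    linarith
  obtain ⟨m, hm, hE⟩ := exists_tendsto_diagonal hev
  refine ⟨fun n => ρ (m n) n, fun h => ?_⟩
  obtain ⟨i, rfl⟩ := hf h
  have h0 : Tendsto (fun n => 2 * (1 / ((m n : ℝ) + 1))) atTop (𝓝 0) := by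
    simpa using (tendsto_one_div_add_atTop_nhds_zero_nat (𝕜 := ℝ)).comp hm |>.const_mul 2
  refine squeeze_zero' (Eventually.of_forall fun n => normSq_nonneg _) ?_ h0
  filter_upwards [hE, hm.eventually_gt_atTop i] with n hn hi
  refine le_trans ?_ ((hρ (m n) n).trans hn.le)
  exact Finset.single_le_sum
    (f := fun h => (B n).normSq ((ψ n h : (B n).Elem) - ρ (m n) n h))
    (fun _ _ => normSq_nonneg _) (Finset.mem_image.2 ⟨i, Finset.mem_range.2 hi, rfl⟩)

/-- In a group with property (T), a unitary that almost commutes with a representation is close to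
one in the commutant. -/
theorem HasPropertyT.exists_unitary_relCommutant {G : Type u} [Group G]
    (hG : HasPropertyT.{u, v} G) :
    ∃ (Q : Finset G) (c : ℝ), ∀ (A : TracialVNA.{v}) (π : G →* A.U) (x : A.U),
      ∃ u : A.U, ((u : A.Elem) : A.H →L[ℂ] A.H) ∈ relCommutant π ∧
        A.normSq ((x : A.Elem) - (u : A.Elem)) ≤ c * ∑ g ∈ Q, commSq (π g) x := by
  obtain ⟨Q, c, h⟩ := hG.exists_bound
  refine ⟨Q, 2 * c, fun A π x => ?_⟩
  obtain ⟨u, hu, hxu⟩ := exists_unitary_mem_relCommutant π x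
  refine ⟨u, hu, hxu.trans ?_⟩
  have := h A.L2 (conjRep π) (A.toL2 x)
  simp only [norm_conjRep_sub_sq] at this
  rw [mul_assoc]
  exact mul_le_mul_of_nonneg_left this zero_le_two

/-- The argument of part (1) along a sequence, pointwise in the group elements instead of in mean.
Each relative commutant acts on a finite-dimensional space without being a full matrix algebra in
general, which is why `IsHilbertSchmidtStable.exists_hom` is needed for H. -/
theorem IsHilbertSchmidtStable.prod_of_hasPropertyT {G : Type u₁} [Group G] {H : Type u₂} [Group H]
    [Countable H] (hT : HasPropertyT.{u₁, v} G) (hG : IsHilbertSchmidtStable G)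
    (hH : IsHilbertSchmidtStable H) : IsHilbertSchmidtStable (G × H) := by
  rw [isHilbertSchmidtStable_iff.{_, v}] at hG ⊢
  intro d hd φ hφ
  set A : ℕ → TracialVNA.{v} := fun n => matVNA (d n) (hd n) with hA
  replace hφ : ∀ p q, Tendsto (fun n => (A n).normSq
    ((φ n (p * q) : (A n).Elem) - φ n p * φ n q)) atTop (𝓝 0) := hφ
  obtain ⟨π₁, hπ₁⟩ := hG d hd (fun n g => φ n (g, 1)) fun g h => by
    simpa using hφ (g, 1) (h, 1)
  replace hπ₁ : ∀ g, Tendsto (fun n => (A n).normSq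
    ((φ n (g, 1) : (A n).Elem) - π₁ n g)) atTop (𝓝 0) := hπ₁
  have hgh : ∀ g h, Tendsto (fun n => (A n).normSq
      ((φ n (g, h) : (A n).Elem) - φ n (g, 1) * φ n (1, h))) atTop (𝓝 0) := fun g h => by
    simpa using hφ (g, 1) (1, h)
  have hhg : ∀ g h, Tendsto (fun n => (A n).normSq
      ((φ n (g, h) : (A n).Elem) - φ n (1, h) * φ n (g, 1))) atTop (𝓝 0) := fun g h => by
    simpa using hφ (1, h) (g, 1)
  have hcomm : ∀ g h, Tendsto (fun n => commSq (A := A n) (π₁ n g) (φ n (1, h))) atTop (𝓝 0) := by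
    intro g h
    have h1 := (((hgh g h).const_mul 4).add ((hhg g h).const_mul 4)).add ((hπ₁ g).const_mul 8)
    simp only [mul_zero, add_zero] at h1
    exact squeeze_zero (fun n => commSq_nonneg _ _) (fun n => commSq_perturb_le _ _ _ _) h1
  obtain ⟨Q, c, hQ⟩ := hT.exists_unitary_relCommutant
  choose ψ hψN hψ using fun n h => hQ (A n) (π₁ n) (φ n (1, h))
  have hφψ : ∀ h, Tendsto (fun n => (A n).normSq ((φ n (1, h) : (A n).Elem) - ψ n h))
      atTop (𝓝 0) := by
    intro h
    have h1 : Tendsto (fun n => c * ∑ g ∈ Q, commSq (A := A n) (π₁ n g) (φ n (1, h))) atTop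
        (𝓝 (c * ∑ _g ∈ Q, 0)) := (tendsto_finsetSum _ fun g _ => hcomm g h).const_mul c
    simp only [Finset.sum_const_zero, mul_zero] at h1
    exact squeeze_zero (fun n => normSq_nonneg _) (fun n => hψ n h) h1
  have hNM : ∀ n, relCommutant (π₁ n) ≤ (A n).M := fun n => relCommutant_le (π₁ n)
  let B : ℕ → TracialVNA.{v} := fun n => (A n).restrict (relCommutant (π₁ n)) (hNM n)
  have hfin : ∀ n, FiniteDimensional ℂ (B n).H := fun n =>
    inferInstanceAs (FiniteDimensional ℂ (MatSpace.{v} (d n)))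
  let ψ' : ∀ n, H → (B n).U := fun n h => ⟨⟨(ψ n h).1.1, hψN n h⟩, Unitary.mem_iff.2
    ⟨Subtype.ext (congrArg Subtype.val (Unitary.mem_iff.1 (ψ n h).2).1 :),
     Subtype.ext (congrArg Subtype.val (Unitary.mem_iff.1 (ψ n h).2).2 :)⟩⟩
  obtain ⟨π₂, hπ₂⟩ := hH.exists_hom B ψ' fun g h => by
    change Tendsto (fun n => (A n).normSq ((ψ n (g * h) : (A n).Elem) - ψ n g * ψ n h)) atTop (𝓝 0)
    have h1 : Tendsto (fun n => (A n).normSq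
        ((φ n (1, g * h) : (A n).Elem) - φ n (1, g) * φ n (1, h))) atTop (𝓝 0) := by
      simpa using hφ (1, g) (1, h)
    have h2 := ((((hφψ (g * h)).add h1).add (hφψ g)).add (hφψ h)).const_mul 4
    simp only [mul_zero, add_zero] at h2
    refine squeeze_zero (fun n => normSq_nonneg _) (fun n => ?_) h2
    have := normSq_defect_le (φ n (1, g)) (φ n (1, h)) (φ n (1, g * h)) (ψ n g) (ψ n h) (ψ n (g * h))
    linarith
  let σ : ∀ n, H →* (A n).U := fun n => ((A n).inclU _ (hNM n)).comp (π₂ n)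
  replace hπ₂ : ∀ h, Tendsto (fun n => (A n).normSq ((ψ n h : (A n).Elem) - σ n h))
    atTop (𝓝 0) := hπ₂
  have hc : ∀ n g h, Commute (π₁ n g) (σ n h) := fun n g h =>
    Subtype.ext (Subtype.ext ((mem_relCommutant.1 (π₂ n h).1.2).2 g))
  refine ⟨fun n => (π₁ n).noncommCoprod (σ n) (hc n), fun p => ?_⟩
  obtain ⟨g, h⟩ := p
  have h3 := (((hgh g h).add (hπ₁ g)).add ((hφψ h).add (hπ₂ h))).const_mul 4
  simp only [mul_zero, add_zero] at h3
  refine squeeze_zero (fun n => normSq_nonneg _) (fun n => ?_) h3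
  have e : (φ n (g, h) : (A n).Elem) - (π₁ n g : (A n).Elem) * σ n h =
      ((φ n (g, h) : (A n).Elem) - φ n (g, 1) * φ n (1, h)) +
      ((φ n (g, 1) : (A n).Elem) - π₁ n g) * φ n (1, h) +
      (π₁ n g : (A n).Elem) * ((φ n (1, h) : (A n).Elem) - ψ n h) +
      (π₁ n g : (A n).Elem) * ((ψ n h : (A n).Elem) - σ n h) := by noncomm_ring
  change (A n).normSq ((φ n (g, h) : (A n).Elem) - (π₁ n g : (A n).Elem) * σ n h) ≤ _
  rw [e]
  refine (normSq_add_four_le _ _ _ _).trans_eq ?_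
  rw [normSq_mul_unitary, normSq_unitary_mul, normSq_unitary_mul]
  ring

theorem IsHilbertSchmidtStable.of_mulEquiv {G : Type u₁} [Group G] {H : Type u₂} [Group H]
    (hG : IsHilbertSchmidtStable G) (e : G ≃* H) : IsHilbertSchmidtStable H := by
  intro d hd φ hφ
  obtain ⟨π, hπ⟩ := hG d hd (fun n g => φ n (e g)) fun g h => by simpa using hφ (e g) (e h)
  exact ⟨fun n => (π n).comp e.symm.toMonoidHom, fun h => by simpa using hπ (e.symm h)⟩

/-- A product of Hilbert–Schmidt stable groups, one of which has property (T), is Hilbert–Schmidt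
stable. -/
theorem IsHilbertSchmidtStable.prod {G : Type u₁} [Group G] [Countable G] {H : Type u₂} [Group H]
    [Countable H] (hT : HasPropertyT.{u₁, v} G ∨ HasPropertyT.{u₂, v} H)
    (hG : IsHilbertSchmidtStable G) (hH : IsHilbertSchmidtStable H) :
    IsHilbertSchmidtStable (G × H) := by
  rcases hT with hT | hT
  · exact hG.prod_of_hasPropertyT hT hH
  · exact (hH.prod_of_hasPropertyT hT hG).of_mulEquiv MulEquiv.prodComm

end

theorem mainTheorem3 :
    (∃ C : ℝ, 0 < C ∧
      ∀ (𝒞 : Set TracialVNA.{v}), ClosedUnderSubalgebras 𝒞 →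
      ∀ (G₁ : Type u₁) [Group G₁] [Countable G₁] (G₂ : Type u₂) [Group G₂] [Countable G₂]
        (μ₁ : PMF G₁) (μ₂ : PMF G₂), HasGeneratingSupport μ₁ → HasGeneratingSupport μ₂ →
        kappa.{u₁, v} μ₁ ≠ ∞ →
        HasGeneratingSupport (averagedMeasure μ₁ μ₂) ∧
        (IsStable 𝒞 μ₁ → IsStable 𝒞 μ₂ → IsStable 𝒞 (averagedMeasure μ₁ μ₂)) ∧
        (Nontrivial G₁ →
          ∀ δ₁ δ₂ : ℝ → ℝ, IsStabilityModulus 𝒞 μ₁ δ₁ → IsStabilityModulus 𝒞 μ₂ δ₂ →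
            ∃ δ : ℝ → ℝ, IsStabilityModulus 𝒞 (averagedMeasure μ₁ μ₂) δ ∧
              ∀ ε ∈ Icc (0 : ℝ) 4,
                δ ε ≤ C * δ₂ (min 4 ((kappa.{u₁, v} μ₁).toReal * δ₁ ε)))) ∧
    (∀ (G : Type u₁) [Group G] [Countable G] (H : Type u₂) [Group H] [Countable H],
      HasPropertyT.{u₁, v} G ∨ HasPropertyT.{u₂, v} H →
      IsHilbertSchmidtStable G → IsHilbertSchmidtStable H → IsHilbertSchmidtStable (G × H)) :=
  ⟨⟨2000, by norm_num, fun _ h𝒞 _ _ _ _ _ _ _ _ hμ₁ hμ₂ hκ =>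
    ⟨hasGeneratingSupport_averagedMeasure hμ₁ hμ₂,
      fun h₁ h₂ => isStable_averagedMeasure h𝒞 hμ₁ hκ h₁ h₂,
      fun _ _ _ h₁ h₂ => exists_isStabilityModulus_averagedMeasure h𝒞 hμ₁ hκ h₁ h₂⟩⟩,
    fun _ _ _ _ _ _ hT hG hH => hG.prod hT hH⟩
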